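/- Let $A\in \mathrm{SL}_3(\mathbb Z)$ have a real eigenvalue $\alpha>1$ and two non-real eigenvalues $\beta,\bar\beta$; let $(a_1,a_2,a_3)^t$ be a real eigenvector for $\alpha$ and $(b_1,b_2,b_3)^t$ a complex eigenvector for $\beta$. Let $\mathbb H$ be the upper half-plane and let $G_A$ be the group of transformations of $\mathbb C\times\mathbb H$ generated by $(z,w)\mapsto(\beta z,\alpha w)$ and $(z,w)\mapsto(z+b_i,w+a_i)$, $i=1,2,3$. Let $\mathcal S^0=(\mathbb C\times\mathbb H)/G_A$ be the associated Inoue surface, regarded as a smooth real $4$-manifold. Let $p:\mathcal S^0\to S^1$, $[z,w]\mapsto e^{2\pi \mathrm i\log_\alpha(\operatorname{Im} w)}$, and let $\vartheta$ be the pullback by $p$ of the volume form $\frac{d\zeta}{2\pi \mathrm i\,\zeta}$ of the circle of length $1$. For a closed one-form $\eta$ on a manifold $M$, let $H^i_\eta(M)$ be the $i$-th cohomology of the complex of smooth real forms on $M$ with the differential $d_\eta=d-\eta\wedge\cdot$ (Morse–Novikov cohomology). Then $\vartheta$ is a smooth closed one-form and: 1. If $t\in\mathbb R$ and $t\neq 0,\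 \ln\alpha,\ -\ln\alpha$, then $H^i_{t\vartheta}(\mathcal S^0)=0$ for all $i\ge 0$. 2. If $t=-\ln\alpha$, then $H^1_{t\vartheta}(\mathcal S^0)\simeq H^2_{t\vartheta}(\mathcal S^0)\simeq\mathbb R$ and all the other groups $H^i_{t\vartheta}(\mathcal S^0)$ vanish. 3. If $t=\ln\alpha$, then $H^2_{t\vartheta}(\mathcal S^0)\simeq H^3_{t\vartheta}(\mathcal S^0)\simeq\mathbb R$ and all the other groups $H^i_{t\vartheta}(\mathcal S^0)$ vanish. 4. If $t=0$, so that $H^i_{t\vartheta}(\mathcal S^0)$ is the de Rham cohomology $H^i_{dR}(\mathcal S^0)$, then $H^i_{dR}(\mathcal S^0)\simeq\mathbb R$ for $i=0,1,3,4$ and $H^i_{dR}(\mathcal S^0)=0$ for all other $i$. 5. For every smooth closed one-form $\eta$ on $\mathcal S^0$ there is exactly one $t\in\mathbb R$ such that $\eta=t\vartheta+df$ for some smooth function $f$, and then $H^i_\eta(\mathcal S^0)\simeq H^i_{t\vartheta}(\mathcal S^0)$ for all $i\ge0$. Hence 1–4 give the Morse–Novikov cohomology of $\mathcal S^0$ with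 respect to every closed one-form. -/

import Mathlib

open scoped Manifold ContDiff UpperHalfPlane ComplexConjugate

noncomputable section

/-! ### Differential forms on a manifold and the Morse–Novikov complex -/

namespace MorseNovikov

section Forms

variable {E : Type*} [NormedAddCommGroup E] [NormedSpace ℝ E]
  {H : Type*} [TopologicalSpace H] (I : ModelWithCorners ℝ E H)
  (M : Type*) [TopologicalSpace M] [ChartedSpace H M]

/-- Fields of alternating `k`-forms on the tangent spaces of `M`, without regularity. -/
def FormField (k : ℕ) : Type _ :=
  ∀ x : M, TangentSpace I x [⋀^Fin k]→L[ℝ] ℝ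

instance (k : ℕ) : AddCommGroup (FormField I M k) :=
  inferInstanceAs (AddCommGroup (∀ x : M, TangentSpace I x [⋀^Fin k]→L[ℝ] ℝ))

instance (k : ℕ) : Module ℝ (FormField I M k) :=
  inferInstanceAs (Module ℝ (∀ x : M, TangentSpace I x [⋀^Fin k]→L[ℝ] ℝ))

variable {I M}

/-- The expression of `σ` in the chart around `x₀`: its pullback by the inverse chart. -/
def FormField.inChart {k : ℕ} (σ : FormField I M k) (x₀ : M) : E → E [⋀^Fin k]→L[ℝ] ℝ :=
  fun u ↦ (σ ((extChartAt I x₀).symm u)).compContinuousLinearMap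
    (mfderivWithin 𝓘(ℝ, E) I (extChartAt I x₀).symm (Set.range I) u)

theorem FormField.inChart_add {k : ℕ} (σ τ : FormField I M k) (x₀ : M) :
    (σ + τ).inChart x₀ = σ.inChart x₀ + τ.inChart x₀ := rfl

theorem FormField.inChart_smul {k : ℕ} (c : ℝ) (σ : FormField I M k) (x₀ : M) :
    (c • σ).inChart x₀ = c • σ.inChart x₀ := rfl

variable (I M) in
/-- `Ω^k(M)`: the smooth `k`-forms, i.e. those with smooth coefficients in the charts. -/
def smoothForms (k : ℕ) : Submodule ℝ (FormField I M k) where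
  carrier := {σ | ∀ x₀ : M, ContDiffOn ℝ ∞ (σ.inChart x₀) (extChartAt I x₀).target}
  add_mem' := fun hσ hτ x₀ ↦ by
    rw [FormField.inChart_add]; exact (hσ x₀).add (hτ x₀)
  zero_mem' := fun _ ↦ contDiffOn_const (c := 0)
  smul_mem' := fun c σ hσ x₀ ↦ by
    rw [FormField.inChart_smul]; exact (hσ x₀).const_smul c

/-- The exterior derivative, computed at each point `x` in the chart around `x`. -/
def FormField.d {k : ℕ} (σ : FormField I M k) : FormField I M (k + 1) :=
  fun x ↦ ContinuousAlternatingMap.compContinuousLinearMap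
    (extDerivWithin (σ.inChart x) (Set.range I) (extChartAt I x x))
    (mfderiv I 𝓘(ℝ, E) (extChartAt I x) x)

/-- The wedge product of a `1`-form and a `k`-form,
`(η ∧ σ)(v₀, …, v_k) = ∑ i, (-1)^i η(v_i) σ(v₀, …, v̂_i, …, v_k)`. -/
def wedgeOne {k : ℕ} (η : E [⋀^Fin 1]→L[ℝ] ℝ) (σ : E [⋀^Fin k]→L[ℝ] ℝ) :
    E [⋀^Fin (k + 1)]→L[ℝ] ℝ :=
  .alternatizeUncurryFin
    (((ContinuousAlternatingMap.ofSubsingleton ℝ E ℝ (0 : Fin 1)).symm η).smulRight σ)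

theorem wedgeOne_apply {k : ℕ} (η : E [⋀^Fin 1]→L[ℝ] ℝ) (σ : E [⋀^Fin k]→L[ℝ] ℝ)
    (v : Fin (k + 1) → E) :
    wedgeOne η σ v = ∑ i : Fin (k + 1), (-1) ^ (i : ℕ) * (η ![v i] * σ (i.removeNth v)) := by
  have h (x : E) : (fun _ : Fin 1 ↦ x) = ![x] := by ext i; simp [Subsingleton.elim i 0]
  simp [wedgeOne, ContinuousAlternatingMap.alternatizeUncurryFin_apply,
    ContinuousAlternatingMap.ofSubsingleton, zsmul_eq_mul, h]

/-- The pointwise wedge product of a field of `1`-forms and a field of `k`-forms. -/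
def FormField.wedge {k : ℕ} (η : FormField I M 1) (σ : FormField I M k) :
    FormField I M (k + 1) :=
  fun x ↦ wedgeOne (E := E) (η x) (σ x)

theorem FormField.d_add {k : ℕ} {σ τ : FormField I M k}
    (hσ : σ ∈ smoothForms I M k) (hτ : τ ∈ smoothForms I M k) :
    (σ + τ).d = σ.d + τ.d := by
  funext x
  have key {ρ : FormField I M k} (hρ : ρ ∈ smoothForms I M k) :
      DifferentiableWithinAt ℝ (ρ.inChart x) (Set.range I) (extChartAt I x x) :=
    (((hρ x) _ (mem_extChartAt_target x)).differentiableWithinAt (by simp)).mono_of_mem_nhdsWithin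
      (extChartAt_target_mem_nhdsWithin x)
  have h := extDerivWithin_add (I.uniqueDiffOn _ (extChartAt_target_subset_range x
    (mem_extChartAt_target x))) (key hσ) (key hτ)
  simp only [FormField.d, FormField.inChart_add, h]
  rfl

theorem FormField.d_smul {k : ℕ} (c : ℝ) (σ : FormField I M k) : (c • σ).d = c • σ.d := by
  funext x
  have h := extDerivWithin_smul c (σ.inChart x) (I.uniqueDiffOn _ (extChartAt_target_subset_range x
    (mem_extChartAt_target x)))
  simp only [FormField.d, FormField.inChart_smul, h]
  rfl

theorem wedgeOne_add {k : ℕ} (η : E [⋀^Fin 1]→L[ℝ] ℝ) (σ τ : E [⋀^Fin k]→L[ℝ] ℝ) :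
    wedgeOne η (σ + τ) = wedgeOne η σ + wedgeOne η τ := by
  ext v; simp [wedgeOne_apply, mul_add, Finset.sum_add_distrib]

theorem wedgeOne_smul {k : ℕ} (c : ℝ) (η : E [⋀^Fin 1]→L[ℝ] ℝ) (σ : E [⋀^Fin k]→L[ℝ] ℝ) :
    wedgeOne η (c • σ) = c • wedgeOne η σ := by
  ext v; simp [wedgeOne_apply, Finset.mul_sum, mul_left_comm]

/-- The twisted differential `d_η = d - η ∧ ·` on smooth `k`-forms. -/
def twistedD (η : FormField I M 1) (k : ℕ) : smoothForms I M k →ₗ[ℝ] FormField I M (k + 1) where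
  toFun σ := (σ : FormField I M k).d - η.wedge (σ : FormField I M k)
  map_add' σ τ := by
    have h : η.wedge (σ.1 + τ.1) = η.wedge σ.1 + η.wedge τ.1 :=
      funext fun x ↦ wedgeOne_add (E := E) (η x) (σ.1 x) (τ.1 x)
    rw [Submodule.coe_add, FormField.d_add σ.2 τ.2, h]
    abel
  map_smul' c σ := by
    have h : η.wedge (c • (σ : FormField I M k)) = c • η.wedge σ.1 :=
      funext fun x ↦ wedgeOne_smul (E := E) c (η x) (σ.1 x)
    rw [Submodule.coe_smul, FormField.d_smul, h, RingHom.id_apply, smul_sub]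

/-- The smooth `d_η`-closed `k`-forms. -/
def cocycles (η : FormField I M 1) (k : ℕ) : Submodule ℝ (smoothForms I M k) :=
  LinearMap.ker (twistedD η k)

/-- The smooth `d_η`-exact `k`-forms: `d_η Ω^{k-1}(M)`, which is `0` for `k = 0`. -/
def coboundaries (η : FormField I M 1) : (k : ℕ) → Submodule ℝ (smoothForms I M k)
  | 0 => ⊥
  | k + 1 => (LinearMap.range (twistedD η k)).comap (smoothForms I M (k + 1)).subtype

/-- The Morse–Novikov cohomology `H^k_η(M)`: `d_η`-closed forms modulo `d_η`-exact forms. -/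
abbrev Cohomology (η : FormField I M 1) (k : ℕ) : Type _ :=
  cocycles η k ⧸ (coboundaries η k).submoduleOf (cocycles η k)

/-- Smooth closed `1`-forms. -/
def IsClosedOneForm (η : FormField I M 1) : Prop :=
  η ∈ smoothForms I M 1 ∧ η.d = 0

end Forms

end MorseNovikov

/-! ### The Inoue surface `S⁰` -/

/-- The data defining an Inoue surface `S⁰`: a matrix in `SL₃(ℤ)` with a real eigenvalue `α > 1`
and a non-real eigenvalue `β` (hence also the eigenvalue `conj β`), with a real eigenvector `a` for
`α` and a complex eigenvector `b` for `β`. -/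
structure InoueData where
  A : Matrix.SpecialLinearGroup (Fin 3) ℤ
  α : ℝ
  β : ℂ
  a : Fin 3 → ℝ
  b : Fin 3 → ℂ
  one_lt_α : 1 < α
  β_im_ne_zero : β.im ≠ 0
  a_ne_zero : a ≠ 0
  b_ne_zero : b ≠ 0
  mulVec_a : ((A : Matrix (Fin 3) (Fin 3) ℤ).map ((↑) : ℤ → ℝ)).mulVec a = α • a
  mulVec_b : ((A : Matrix (Fin 3) (Fin 3) ℤ).map ((↑) : ℤ → ℂ)).mulVec b = β • b

namespace InoueData

variable (D : InoueData)

theorem α_pos : 0 < D.α := zero_lt_one.trans D.one_lt_α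

theorem β_ne_zero : D.β ≠ 0 := fun h ↦ D.β_im_ne_zero (by simp [h])

/-- The transformation `(z, w) ↦ (β z, α w)` of `ℂ × ℍ`. -/
def scaling : Equiv.Perm (ℂ × ℍ) :=
  (Equiv.mulLeft₀ D.β D.β_ne_zero).prodCongr
    (MulAction.toPerm (⟨D.α, D.α_pos⟩ : {x : ℝ // 0 < x}))

/-- The transformation `(z, w) ↦ (z + bᵢ, w + aᵢ)` of `ℂ × ℍ`. -/
def translation (i : Fin 3) : Equiv.Perm (ℂ × ℍ) :=
  (Equiv.addRight (D.b i)).prodCongr (AddAction.toPerm (D.a i))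

/-- The group `G_A` of affine transformations of `ℂ × ℍ`. -/
def group : Subgroup (Equiv.Perm (ℂ × ℍ)) :=
  Subgroup.closure (insert D.scaling (Set.range D.translation))

/-- `g` is `(z, w) ↦ (β ^ n z + ∑ mᵢ bᵢ, α ^ n w + ∑ mᵢ aᵢ)`. -/
def IsNormalForm (g : Equiv.Perm (ℂ × ℍ)) (n : ℤ) (m : Fin 3 → ℤ) : Prop :=
  ∀ p : ℂ × ℍ, (g p).1 = D.β ^ n * p.1 + ∑ i, (m i : ℂ) * D.b i ∧
    ((g p).2 : ℂ) = ((D.α ^ n : ℝ) : ℂ) * p.2 + ((∑ i, (m i : ℝ) * D.a i : ℝ) : ℂ)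

theorem β_mul_sum (m : Fin 3 → ℤ) : D.β * ∑ i, (m i : ℂ) * D.b i =
    ∑ i, ((Matrix.vecMul m (D.A : Matrix (Fin 3) (Fin 3) ℤ) i : ℤ) : ℂ) * D.b i := by
  have h (i : Fin 3) := congrFun D.mulVec_b i
  simp only [Matrix.mulVec, dotProduct, Matrix.map_apply, Pi.smul_apply, smul_eq_mul] at h
  simp only [Finset.mul_sum, Matrix.vecMul, dotProduct, Int.cast_sum, Int.cast_mul, Finset.sum_mul]
  rw [Finset.sum_comm]
  refine Finset.sum_congr rfl fun i _ ↦ ?_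
  rw [mul_left_comm, ← h i, Finset.mul_sum]
  exact Finset.sum_congr rfl fun j _ ↦ by ring

theorem α_mul_sum (m : Fin 3 → ℤ) : D.α * ∑ i, (m i : ℝ) * D.a i =
    ∑ i, ((Matrix.vecMul m (D.A : Matrix (Fin 3) (Fin 3) ℤ) i : ℤ) : ℝ) * D.a i := by
  have h (i : Fin 3) := congrFun D.mulVec_a i
  simp only [Matrix.mulVec, dotProduct, Matrix.map_apply, Pi.smul_apply, smul_eq_mul] at h
  simp only [Finset.mul_sum, Matrix.vecMul, dotProduct, Int.cast_sum, Int.cast_mul, Finset.sum_mul]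
  rw [Finset.sum_comm]
  refine Finset.sum_congr rfl fun i _ ↦ ?_
  rw [mul_left_comm, ← h i, Finset.mul_sum]
  exact Finset.sum_congr rfl fun j _ ↦ by ring

theorem exists_zpow_mul_sum (n : ℤ) (m : Fin 3 → ℤ) : ∃ m' : Fin 3 → ℤ,
    D.β ^ n * ∑ i, (m i : ℂ) * D.b i = ∑ i, (m' i : ℂ) * D.b i ∧
    D.α ^ n * ∑ i, (m i : ℝ) * D.a i = ∑ i, (m' i : ℝ) * D.a i := by
  induction n with
  | zero => exact ⟨m, by simp, by simp⟩
  | succ n ih =>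
    obtain ⟨m', h₁, h₂⟩ := ih
    refine ⟨Matrix.vecMul m' (D.A : Matrix (Fin 3) (Fin 3) ℤ), ?_, ?_⟩
    · rw [← D.β_mul_sum, ← h₁, zpow_add_one₀ D.β_ne_zero]; ring
    · rw [← D.α_mul_sum, ← h₂, zpow_add_one₀ D.α_pos.ne']; ring
  | pred n ih =>
    obtain ⟨m', h₁, h₂⟩ := ih
    have hm : Matrix.vecMul (Matrix.vecMul m' ((D.A⁻¹ : Matrix.SpecialLinearGroup (Fin 3) ℤ) :
        Matrix (Fin 3) (Fin 3) ℤ)) (D.A : Matrix (Fin 3) (Fin 3) ℤ) = m' := by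
      rw [Matrix.vecMul_vecMul, ← Matrix.SpecialLinearGroup.coe_mul]; simp
    refine ⟨Matrix.vecMul m' ((D.A⁻¹ : Matrix.SpecialLinearGroup (Fin 3) ℤ) :
        Matrix (Fin 3) (Fin 3) ℤ), ?_, ?_⟩
    · apply mul_left_cancel₀ D.β_ne_zero
      rw [D.β_mul_sum, hm, ← h₁, zpow_sub_one₀ D.β_ne_zero]
      field_simp [D.β_ne_zero]
    · apply mul_left_cancel₀ D.α_pos.ne'
      rw [D.α_mul_sum, hm, ← h₂, zpow_sub_one₀ D.α_pos.ne']
      field_simp [D.α_pos.ne']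

theorem exists_isNormalForm {g : Equiv.Perm (ℂ × ℍ)} (hg : g ∈ D.group) :
    ∃ n m, D.IsNormalForm g n m := by
  induction hg using Subgroup.closure_induction with
  | mem g hg =>
    rcases hg with rfl | ⟨i, rfl⟩
    · exact ⟨1, 0, fun p ↦ by simp [scaling]⟩
    · refine ⟨0, Pi.single i 1, fun p ↦ ?_⟩
      simp [translation, Pi.single_apply, add_comm]
  | one => exact ⟨0, 0, fun p ↦ by simp⟩
  | mul g h _ _ hg hh =>
    obtain ⟨n, m, hg⟩ := hg
    obtain ⟨n', m', hh⟩ := hh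
    obtain ⟨m'', h₁, h₂⟩ := D.exists_zpow_mul_sum n m'
    refine ⟨n + n', m'' + m, fun p ↦ ⟨?_, ?_⟩⟩
    · rw [Equiv.Perm.mul_apply, (hg _).1, (hh _).1, mul_add, h₁, zpow_add₀ D.β_ne_zero]
      simp only [Pi.add_apply, Int.cast_add, add_mul, Finset.sum_add_distrib]; ring
    · have : (∑ i, ((m'' + m) i : ℝ) * D.a i) =
          D.α ^ n * ∑ i, (m' i : ℝ) * D.a i + ∑ i, (m i : ℝ) * D.a i := by
        rw [h₂]; simp only [Pi.add_apply, Int.cast_add, add_mul, Finset.sum_add_distrib]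
      rw [Equiv.Perm.mul_apply, (hg _).2, (hh _).2, mul_add, this, zpow_add₀ D.α_pos.ne']
      push_cast; ring
  | inv g _ hg =>
    obtain ⟨n, m, hg⟩ := hg
    obtain ⟨m', h₁, h₂⟩ := D.exists_zpow_mul_sum (-n) (-m)
    refine ⟨-n, m', fun p ↦ ?_⟩
    have hp := hg (g⁻¹ p)
    rw [show g (g⁻¹ p) = p from g.apply_symm_apply p] at hp
    rw [← h₁, ← h₂, hp.1, hp.2]
    have hβ := zpow_ne_zero n D.β_ne_zero
    have hα : ((D.α : ℂ) ^ n) ≠ 0 := zpow_ne_zero n (by exact_mod_cast D.α_pos.ne')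
    constructor
    · simp only [zpow_neg, Pi.neg_apply, Int.cast_neg, neg_mul, Finset.sum_neg_distrib]
      field_simp; ring
    · push_cast
      simp only [zpow_neg, Pi.neg_apply, Int.cast_neg, neg_mul, Finset.sum_neg_distrib]
      field_simp; ring

theorem IsNormalForm.ext {D : InoueData} {g h : Equiv.Perm (ℂ × ℍ)} {n : ℤ} {m : Fin 3 → ℤ}
    (hg : D.IsNormalForm g n m) (hh : D.IsNormalForm h n m) : g = h :=
  Equiv.ext fun p ↦ Prod.ext ((hg p).1.trans (hh p).1.symm)
    (UpperHalfPlane.ext ((hg p).2.trans (hh p).2.symm))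

theorem IsNormalForm.im {D : InoueData} {g : Equiv.Perm (ℂ × ℍ)} {n : ℤ} {m : Fin 3 → ℤ}
    (hg : D.IsNormalForm g n m) (p : ℂ × ℍ) : (g p).2.im = D.α ^ n * p.2.im := by
  have := congrArg Complex.im (hg p).2
  rwa [Complex.add_im, Complex.im_ofReal_mul, Complex.ofReal_im, add_zero] at this

/-- The linear map `x ↦ (∑ xᵢ bᵢ, ∑ xᵢ aᵢ)`. -/
def periodMap : (Fin 3 → ℝ) →ₗ[ℝ] ℂ × ℝ where
  toFun x := (∑ i, (x i : ℂ) * D.b i, ∑ i, x i * D.a i)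
  map_add' x y := by simp [add_mul, Finset.sum_add_distrib]
  map_smul' c x := by simp [Finset.mul_sum, mul_assoc]

theorem ker_periodMap : LinearMap.ker D.periodMap = ⊥ := by
  rw [LinearMap.ker_eq_bot']
  intro x hx
  obtain ⟨hb, ha⟩ := Prod.ext_iff.1 hx
  replace hb : ∑ i, (x i : ℂ) * D.b i = 0 := hb
  replace ha : ∑ i, x i * D.a i = 0 := ha
  set B : Matrix (Fin 3) (Fin 3) ℂ := (D.A : Matrix (Fin 3) (Fin 3) ℤ).map ((↑) : ℤ → ℂ) with hB
  let μ : Fin 3 → ℂ := ![D.α, D.β, conj D.β]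
  let v : Fin 3 → Fin 3 → ℂ := ![fun i ↦ (D.a i : ℂ), D.b, fun i ↦ conj (D.b i)]
  have hβ := D.β_im_ne_zero
  have hμ : Function.Injective μ := by
    have h₁ : (D.α : ℂ) ≠ D.β := fun h ↦ hβ (by simp [← h])
    have h₂ : (D.α : ℂ) ≠ conj D.β := fun h ↦ hβ (by simpa using congrArg Complex.im h)
    have h₃ : D.β ≠ conj D.β := fun h ↦ hβ (by
      have := congrArg Complex.im h
      rw [Complex.conj_im] at this
      linarith)
    intro i j hij
    fin_cases i <;> fin_cases j <;> simp_all [μ, eq_comm]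
  have hv (i : Fin 3) : Module.End.HasEigenvector (Matrix.toLin' B) (μ i) (v i) := by
    rw [Module.End.hasEigenvector_iff, Module.End.mem_eigenspace_iff, Matrix.toLin'_apply]
    have ea (j : Fin 3) := congrFun D.mulVec_a j
    have eb (j : Fin 3) := congrFun D.mulVec_b j
    simp only [Matrix.mulVec, dotProduct, Matrix.map_apply, Pi.smul_apply, smul_eq_mul] at ea eb
    fin_cases i
    · refine ⟨funext fun j ↦ ?_, fun h ↦ D.a_ne_zero (funext fun j ↦ ?_)⟩
      · have := congrArg ((↑) : ℝ → ℂ) (ea j)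
        push_cast at this
        simpa [μ, v, Matrix.mulVec, dotProduct, hB] using this
      · simpa [v] using congrFun h j
    · exact ⟨D.mulVec_b, D.b_ne_zero⟩
    · refine ⟨funext fun j ↦ ?_, fun h ↦ D.b_ne_zero (funext fun j ↦ ?_)⟩
      · have := congrArg conj (eb j)
        simpa [μ, v, Matrix.mulVec, dotProduct, hB] using this
      · simpa [v] using congrFun h j
  have hli := Module.End.eigenvectors_linearIndependent' _ μ hμ v hv
  have hunit : IsUnit (Matrix.of v) := Matrix.linearIndependent_rows_iff_isUnit.1 hli
  have hzero : (Matrix.of v).mulVec (fun i ↦ (x i : ℂ)) = 0 := by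
    funext j
    fin_cases j
    · have := congrArg ((↑) : ℝ → ℂ) ha
      push_cast at this
      simpa [v, Matrix.mulVec, dotProduct, mul_comm] using this
    · simpa [v, Matrix.mulVec, dotProduct, mul_comm] using hb
    · have := congrArg conj hb
      simpa [v, Matrix.mulVec, dotProduct, mul_comm] using this
  have := Matrix.mulVec_injective_of_isUnit hunit (hzero.trans (Matrix.mulVec_zero _).symm)
  funext i
  simpa using congrFun this i

instance : ContinuousConstSMul D.group (ℂ × ℍ) where
  continuous_const_smul g := by
    obtain ⟨n, m, h⟩ := D.exists_isNormalForm g.2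
    refine Continuous.prodMk ?_ (UpperHalfPlane.isEmbedding_coe.continuous_iff.2 ?_)
    · refine (?_ : Continuous fun p : ℂ × ℍ ↦ ((g : Equiv.Perm (ℂ × ℍ)) p).1)
      simp only [(h _).1]; fun_prop
    · refine (?_ : Continuous fun p : ℂ × ℍ ↦ (((g : Equiv.Perm (ℂ × ℍ)) p).2 : ℂ))
      simp only [(h _).2]; fun_prop

instance : IsCancelSMul D.group (ℂ × ℍ) where
  left_cancel' g _ _ h := MulAction.injective g h
  right_cancel' g h p hgh := by
    obtain ⟨n, m, hg⟩ := D.exists_isNormalForm g.2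
    obtain ⟨n', m', hh⟩ := D.exists_isNormalForm h.2
    replace hgh : (g : Equiv.Perm (ℂ × ℍ)) p = (h : Equiv.Perm (ℂ × ℍ)) p := hgh
    have hn : n = n' := by
      have := hg.im p
      rw [hgh, hh.im p] at this
      exact zpow_right_injective₀ D.α_pos D.one_lt_α.ne'
        (mul_right_cancel₀ p.2.im_pos.ne' this).symm
    subst hn
    have hm : m = m' := by
      have h₁ := (hg p).1
      have h₂ := (hg p).2
      rw [hgh, (hh p).1] at h₁
      rw [hgh, (hh p).2] at h₂
      replace h₁ := add_left_cancel h₁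
      replace h₂ := Complex.ofReal_injective (add_left_cancel h₂)
      have := LinearMap.ker_eq_bot.1 D.ker_periodMap
        (a₁ := fun i ↦ (m i : ℝ)) (a₂ := fun i ↦ (m' i : ℝ))
        (Prod.ext (by simpa [periodMap] using h₁.symm) (by simpa [periodMap] using h₂.symm))
      funext i
      exact_mod_cast congrFun this i
    subst hm
    exact Subtype.ext (hg.ext hh)

instance : ProperlyDiscontinuousSMul D.group (ℂ × ℍ) where
  finite_disjoint_inter_image := by
    intro K L hK hL
    obtain ⟨c, C, hc, hcC⟩ : ∃ c C : ℝ, 0 < c ∧ ∀ p ∈ K ∪ L, c ≤ p.2.im ∧ p.2.im ≤ C := by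
      have hKL := hK.union hL
      have hcont : Continuous fun p : ℂ × ℍ ↦ p.2.im :=
        UpperHalfPlane.continuous_im.comp continuous_snd
      rcases (K ∪ L).eq_empty_or_nonempty with h | h
      · exact ⟨1, 1, one_pos, by simp [h]⟩
      · obtain ⟨p, -, hp⟩ := hKL.exists_isMinOn h hcont.continuousOn
        obtain ⟨q, -, hq⟩ := hKL.exists_isMaxOn h hcont.continuousOn
        exact ⟨p.2.im, q.2.im, p.2.im_pos, fun r hr ↦ ⟨hp hr, hq hr⟩⟩
    obtain ⟨R, hR⟩ : ∃ R : ℝ, ∀ p ∈ K ∪ L, ‖p.1‖ ≤ R ∧ ‖(p.2 : ℂ)‖ ≤ R := by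
      have hcont : Continuous fun p : ℂ × ℍ ↦ (p.1, (p.2 : ℂ)) :=
        continuous_fst.prodMk (UpperHalfPlane.continuous_coe.comp continuous_snd)
      obtain ⟨R, hR⟩ := (hK.union hL).exists_bound_of_continuousOn hcont.continuousOn
      exact ⟨R, fun p hp ↦
        ⟨(norm_fst_le (p.1, (p.2 : ℂ))).trans (hR p hp),
          (norm_snd_le (p.1, (p.2 : ℂ))).trans (hR p hp)⟩⟩
    obtain ⟨N, hN⟩ := pow_unbounded_of_one_lt (C / c) D.one_lt_α
    obtain ⟨κ, -, hκ⟩ := D.periodMap.exists_antilipschitzWith D.ker_periodMap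
    let T (n : ℤ) : ℝ := max (R + ‖D.β‖ ^ n * R) (R + D.α ^ n * R)
    have hfin : (⋃ n ∈ Set.Icc (-(N : ℤ)) N, ⋃ m ∈ Set.Icc (fun _ : Fin 3 ↦ -⌈κ * T n⌉)
        (fun _ : Fin 3 ↦ ⌈κ * T n⌉),
        {g : D.group | D.IsNormalForm g n m}).Finite :=
      (Set.finite_Icc _ _).biUnion fun n _ ↦ (Set.finite_Icc _ _).biUnion fun m _ ↦
        Set.Subsingleton.finite fun g hg h hh ↦ Subtype.ext (IsNormalForm.ext hg hh)
    refine hfin.subset ?_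
    rintro g ⟨_, ⟨p, hpK, rfl⟩, hpL⟩
    replace hpL : (g : Equiv.Perm (ℂ × ℍ)) p ∈ L := hpL
    obtain ⟨n, m, hg⟩ := D.exists_isNormalForm g.2
    have hp := Or.inl (b := p ∈ L) hpK
    have hgp := Or.inr (a := (g : Equiv.Perm (ℂ × ℍ)) p ∈ K) hpL
    have him := hg.im p
    have hc₁ := hcC p hp
    have hc₂ := hcC _ hgp
    rw [him] at hc₂
    have hCpos : 0 < C := hc.trans_le (hc₁.1.trans hc₁.2)
    have hlt {k : ℤ} (hk : D.α ^ k ≤ C / c) : k ≤ N := by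
      by_contra hcon
      have : D.α ^ (N : ℤ) ≤ D.α ^ k := zpow_le_zpow_right₀ D.one_lt_α.le (by omega)
      rw [zpow_natCast] at this
      linarith
    have hαn := zpow_pos D.α_pos n
    have hn₁ : n ≤ N := hlt <| by
      rw [le_div_iff₀ hc]
      exact (mul_le_mul_of_nonneg_left hc₁.1 hαn.le).trans hc₂.2
    have hn₂ : -n ≤ N := hlt <| by
      rw [zpow_neg, le_div_iff₀ hc, inv_mul_le_iff₀ hαn]
      exact hc₂.1.trans (mul_le_mul_of_nonneg_left hc₁.2 hαn.le)
    have hnorm : ‖D.periodMap fun i ↦ (m i : ℝ)‖ ≤ T n := by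
      refine max_le ((le_max_left _ _).trans' ?_) ((le_max_right _ _).trans' ?_)
      · have h : (D.periodMap fun i ↦ (m i : ℝ)).1 =
            ((g : Equiv.Perm (ℂ × ℍ)) p).1 - D.β ^ n * p.1 := by
          rw [(hg p).1]; simp [periodMap]
        rw [h]
        refine (norm_sub_le _ _).trans (add_le_add (hR _ hgp).1 ?_)
        rw [norm_mul, norm_zpow]
        exact mul_le_mul_of_nonneg_left (hR p hp).1 (zpow_nonneg (norm_nonneg _) _)
      · have h : (((D.periodMap fun i ↦ (m i : ℝ)).2 : ℝ) : ℂ) =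
            (((g : Equiv.Perm (ℂ × ℍ)) p).2 : ℂ) - ((D.α ^ n : ℝ) : ℂ) * p.2 := by
          rw [(hg p).2]; simp [periodMap]
        rw [← Complex.norm_real, h]
        refine (norm_sub_le _ _).trans (add_le_add (hR _ hgp).2 ?_)
        rw [norm_mul, Complex.norm_real, Real.norm_of_nonneg hαn.le]
        exact mul_le_mul_of_nonneg_left (hR p hp).2 hαn.le
    have hm (i : Fin 3) : |m i| ≤ ⌈κ * T n⌉ := by
      have h₁ : ‖fun i ↦ (m i : ℝ)‖ ≤ κ * ‖D.periodMap fun i ↦ (m i : ℝ)‖ := by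
        simpa using hκ.le_mul_dist (fun i ↦ (m i : ℝ)) 0
      have h₂ : |(m i : ℝ)| ≤ κ * T n :=
        (norm_le_pi_norm (fun i ↦ (m i : ℝ)) i).trans
          (h₁.trans (mul_le_mul_of_nonneg_left hnorm κ.2))
      exact_mod_cast h₂.trans (Int.le_ceil _)
    simp only [Set.mem_iUnion]
    exact ⟨n, ⟨by omega, hn₁⟩, m, ⟨fun i ↦ (abs_le.1 (hm i)).1, fun i ↦ (abs_le.1 (hm i)).2⟩, hg⟩

/-- The Inoue surface `S⁰ = (ℂ × ℍ) / G_A`. -/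
abbrev Surface : Type := MulAction.orbitRel.Quotient D.group (ℂ × ℍ)

/-- The real model of the (complex two-dimensional) surface. -/
abbrev model : ModelWithCorners ℝ (ℂ × ℂ) (ModelProd ℂ ℂ) := 𝓘(ℝ, ℂ).prod 𝓘(ℝ, ℂ)

theorem isLocalHomeomorph_mk :
    IsLocalHomeomorph (Quotient.mk (MulAction.orbitRel D.group (ℂ × ℍ))) :=
  isQuotientCoveringMap_quotientMk_of_properlyDiscontinuousSMul.isCoveringMap.isLocalHomeomorph

/-- `S⁰` is a smooth manifold: the changes of charts are locally given by elements of `G_A`. -/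
instance : IsManifold model ∞ D.Surface := by
  refine isManifold_of_contDiffOn _ _ _ ?_
  rintro _ _ ⟨x, rfl⟩ ⟨y, rfl⟩
  generalize (Quotient.mk_surjective (s := MulAction.orbitRel D.group
    (ℂ × ℍ))).hasRightInverse.choose x = p
  generalize (Quotient.mk_surjective (s := MulAction.orbitRel D.group
    (ℂ × ℍ))).hasRightInverse.choose y = p'
  have hq := D.isLocalHomeomorph_mk
  rintro u ⟨hu, -⟩
  set s := hq.localInverseAt p
  set s' := hq.localInverseAt p'
  set e := chartAt (ModelProd ℂ ℂ) p
  set e' := chartAt (ModelProd ℂ ℂ) p'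
  have hu₁ : u ∈ e.target := hu.1.1
  have hu₂ : s.symm (e.symm u) ∈ s'.source := hu.2.1
  have hsym : s.symm = Quotient.mk (MulAction.orbitRel D.group (ℂ × ℍ)) :=
    hq.localInverseAt_symm p
  have hsym' : s'.symm = Quotient.mk (MulAction.orbitRel D.group (ℂ × ℍ)) :=
    hq.localInverseAt_symm p'
  obtain ⟨g, hg⟩ : s' (s.symm (e.symm u)) ∈ MulAction.orbit D.group (e.symm u) := by
    apply Quotient.exact (s := MulAction.orbitRel D.group (ℂ × ℍ))
    rw [← congrFun hsym', s'.left_inv hu₂, hsym]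
  obtain ⟨n, m, hnm⟩ := D.exists_isNormalForm g.2
  have hmem : ∀ᶠ v in nhds u, g • e.symm v ∈ s'.target := by
    have hcont : ContinuousAt (fun v ↦ g • e.symm v) u :=
      (e.continuousAt_symm hu₁).const_smul g
    refine hcont.eventually_mem (s'.open_target.mem_nhds ?_)
    exact (congrArg (· ∈ s'.target) hg).mpr (s'.map_source hu₂)
  have hev : ∀ᶠ v in nhds u, (model ∘ ((s.trans e).symm.trans (s'.trans e')) ∘ model.symm) v =
      (D.β ^ n * v.1 + ∑ i, (m i : ℂ) * D.b i,
        ((D.α ^ n : ℝ) : ℂ) * v.2 + ((∑ i, (m i : ℝ) * D.a i : ℝ) : ℂ)) := by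
    filter_upwards [hmem, e.open_target.mem_nhds hu₁] with v hv hve
    have h₁ : s' (s.symm (e.symm v)) = g • e.symm v := by
      have : s.symm (e.symm v) = s'.symm (g • e.symm v) := by
        rw [hsym, hsym']
        exact Quotient.sound (s := MulAction.orbitRel D.group (ℂ × ℍ)) ⟨g⁻¹, inv_smul_smul _ _⟩
      rw [this, s'.right_inv hv]
    have h₂ : (((e.symm v).1, ((e.symm v).2 : ℂ)) : ℂ × ℂ) = v := e.right_inv hve
    have h₃ := hnm (e.symm v)
    rw [show (e.symm v).1 = v.1 from (Prod.ext_iff.1 h₂).1,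
      show ((e.symm v).2 : ℂ) = v.2 from (Prod.ext_iff.1 h₂).2] at h₃
    change e' (s' (s.symm (e.symm v))) = _
    rw [h₁]
    exact Prod.ext h₃.1 h₃.2
  refine ContDiffAt.contDiffWithinAt (ContDiffAt.congr_of_eventuallyEq ?_ hev)
  fun_prop

/-- The fibration `S⁰ → S¹`, `[z, w] ↦ exp (2 π i log_α (Im w))`. -/
def proj : D.Surface → Circle :=
  Quotient.lift (fun p : ℂ × ℍ ↦ Circle.exp (2 * Real.pi * Real.logb D.α p.2.im)) <| by
    rintro p q ⟨g, hg⟩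
    obtain ⟨n, m, h⟩ := D.exists_isNormalForm g.2
    replace hg : (g : Equiv.Perm (ℂ × ℍ)) q = p := hg
    have hα := Real.log_pos D.one_lt_α
    have : Real.logb D.α p.2.im = n + Real.logb D.α q.2.im := by
      rw [← hg, h.im, Real.logb_mul (zpow_pos D.α_pos n).ne' q.2.im_pos.ne', Real.logb, Real.log_zpow,
        mul_div_assoc, div_self hα.ne', mul_one]
    simp only [this, mul_add, Circle.exp_add]
    rw [mul_comm (2 * Real.pi) (n : ℝ), Circle.exp_int_mul_two_pi, one_mul]

/-- The form `ϑ`: the pullback by `proj` of the volume form `dζ / (2 π i ζ)` of the circle of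
length `1`. -/
def vartheta : MorseNovikov.FormField model D.Surface 1 := fun x ↦
  ContinuousAlternatingMap.ofSubsingleton ℝ (TangentSpace model x) ℝ (0 : Fin 1)
    ((2 * Real.pi)⁻¹ • Complex.imCLM ∘L
      (ContinuousLinearMap.mul ℝ ℂ (conj (D.proj x : ℂ))) ∘L
      mvfderiv model (fun y : D.Surface ↦ (D.proj y : ℂ)) x)

end InoueData

end

/-!
Let `B` be the map `(z, x) ↦ (β z, α x)` of `ℂ × ℝ` and let `S` be the map
`(w, s) ↦ (B w, s + 1)` of `(ℂ × ℝ) × ℝ`. The covering `((z, x), s) ↦ [z, x + i α ^ s]` presents the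
Inoue surface as the mapping torus of `B` on the torus `(ℂ × ℝ) / L`, where `L` is spanned by the
vectors `(bᵢ, aᵢ)`, and `ϑ` lifts to `ds`. If the lift of `η` is the differential of `F`, where
`F` is `L`-periodic and `F ∘ S = F + t`, then pulling back along the covering and multiplying by
`exp (-F)` turns `d_η` into `d` and the forms on the surface into the `L`-periodic forms `σ` with
`S^* σ = exp (-t) σ`. Thus the cohomology depends on `t` only.

A closed periodic form is a constant form on `ℂ × ℝ` modulo the exact ones (average over the torus
and contract the `s`-direction), and `S^* - exp (-t)` is onto on periodic forms. Hence
`H^{k + 1} = E_{k + 1} ⊕ ds ∧ E_k` and `H^0 = E_0`, where `E_k` is the space of constant `k`-forms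
`e` with `B^* e = exp (-t) e`. The only real eigenvalues of `B^*` in the degrees `0, 1, 2, 3` are
`1, α, α⁻¹, 1`, and they are simple.
-/

noncomputable section

open MeasureTheory Filter Topology Set

namespace MorseNovikov

section Alternating

open scoped Nat

variable {𝕜 E F G N ι : Type*} [NontriviallyNormedField 𝕜]
  [NormedAddCommGroup E] [NormedSpace 𝕜 E] [NormedAddCommGroup F] [NormedSpace 𝕜 F]
  [NormedAddCommGroup G] [NormedSpace 𝕜 G] [NormedAddCommGroup N] [NormedSpace 𝕜 N]
  [Fintype ι] {n : WithTop ℕ∞}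

theorem norm_alternatization_le [DecidableEq ι]
    (f : ContinuousMultilinearMap 𝕜 (fun _ : ι ↦ E) N) :
    ‖f.alternatization‖ ≤ (Fintype.card ι)! * ‖f‖ := by
  refine ContinuousAlternatingMap.opNorm_le_bound _ (by positivity) fun v ↦ ?_
  rw [ContinuousMultilinearMap.alternatization_apply_apply]
  have bound (π : Equiv.Perm ι) : ‖π.sign • f (v ∘ π)‖ ≤ ‖f‖ * ∏ i, ‖v i‖ := by
    have hsign : ‖π.sign • f (v ∘ π)‖ = ‖f (v ∘ π)‖ := by
      rcases Int.units_eq_one_or π.sign with h | h <;> simp [h]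
    rw [hsign, ← Equiv.prod_comp π fun i ↦ ‖v i‖]
    exact f.le_opNorm _
  calc _ ≤ ∑ _π : Equiv.Perm ι, ‖f‖ * ∏ i, ‖v i‖ := norm_sum_le_of_le _ fun π _ ↦ bound π
    _ = _ := by
      rw [Finset.sum_const, Finset.card_univ, Fintype.card_perm, nsmul_eq_mul, mul_assoc]

/-- Alternatization as a continuous linear map between spaces of multilinear maps. -/
def alternatizationCLM [DecidableEq ι] :
    ContinuousMultilinearMap 𝕜 (fun _ : ι ↦ E) N →L[𝕜] E [⋀^ι]→L[𝕜] N :=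
  LinearMap.mkContinuous
    { toFun := ContinuousMultilinearMap.alternatization
      map_add' := map_add _
      map_smul' := fun c f ↦ by
        ext v
        simp [ContinuousMultilinearMap.alternatization_apply_apply, Finset.smul_sum,
          smul_comm c] }
    _ norm_alternatization_le

theorem alternatizationCLM_coe [DecidableEq ι] (f : E [⋀^ι]→L[𝕜] N) :
    alternatizationCLM f.toContinuousMultilinearMap = (Fintype.card ι)! • f := by
  ext v
  exact congrArg (fun g : E [⋀^ι]→ₗ[𝕜] N ↦ g v)
    ((ContinuousMultilinearMap.alternatization_apply_toAlternatingMap _).trans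
      (AlternatingMap.coe_alternatization f.toAlternatingMap))

theorem contDiffAt_compContinuousLinearMap [CharZero 𝕜] {f : F → G [⋀^ι]→L[𝕜] N}
    {g : F → E →L[𝕜] G} {x : F} (hf : ContDiffAt 𝕜 n f x) (hg : ContDiffAt 𝕜 n g x) :
    ContDiffAt 𝕜 n (fun y ↦ (f y).compContinuousLinearMap (g y)) x := by
  classical
  have hmul : ContDiffAt 𝕜 n (fun y ↦
      ContinuousMultilinearMap.compContinuousLinearMapContinuousMultilinear 𝕜
        (fun _ : ι ↦ E) (fun _ ↦ G) N (fun _ ↦ g y) (f y).toContinuousMultilinearMap) x :=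
    ((ContinuousMultilinearMap.contDiff _).contDiffAt.comp x (contDiffAt_pi.2 fun _ ↦ hg)).clm_apply
      ((ContinuousAlternatingMap.toContinuousMultilinearMapLI (𝕜 := 𝕜) (E := G) (F := N)
        (ι := ι)).toContinuousLinearMap.contDiff.contDiffAt.comp x hf)
  have hfactorial : ((Fintype.card ι)! : 𝕜) ≠ 0 := Nat.cast_ne_zero.2 (Nat.factorial_ne_zero _)
  refine (((alternatizationCLM (𝕜 := 𝕜)).contDiff.contDiffAt.comp x hmul).const_smul
    ((Fintype.card ι)! : 𝕜)⁻¹).congr_of_eventuallyEq (.of_forall fun y ↦ ?_)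
  rw [eq_inv_smul_iff₀ hfactorial, Nat.cast_smul_eq_nsmul]
  exact (alternatizationCLM_coe _).symm

theorem contDiff_compContinuousLinearMap [CharZero 𝕜] {f : F → G [⋀^ι]→L[𝕜] N}
    {g : F → E →L[𝕜] G} (hf : ContDiff 𝕜 n f) (hg : ContDiff 𝕜 n g) :
    ContDiff 𝕜 n fun y ↦ (f y).compContinuousLinearMap (g y) :=
  contDiff_iff_contDiffAt.2 fun _ ↦
    contDiffAt_compContinuousLinearMap hf.contDiffAt hg.contDiffAt

end Alternating

section ExtDeriv

variable {E F : Type*} [NormedAddCommGroup E] [NormedSpace ℝ E] [NormedAddCommGroup F]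
  [NormedSpace ℝ F] {k : ℕ} {σ τ : E → E [⋀^Fin k]→L[ℝ] F}

theorem contDiff_extDeriv (hσ : ContDiff ℝ ∞ σ) : ContDiff ℝ ∞ (extDeriv σ) :=
  (ContinuousAlternatingMap.alternatizeUncurryFinCLM ℝ E F (n := k)).contDiff.comp
    (hσ.fderiv_right (by simp))

theorem extDeriv_const (c : E [⋀^Fin k]→L[ℝ] F) : extDeriv (fun _ : E ↦ c) = 0 := by
  funext v
  rw [extDeriv, fderiv_const_apply]
  exact map_zero (ContinuousAlternatingMap.alternatizeUncurryFinCLM ℝ E F (n := k))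

theorem extDeriv_add_eq (hσ : ContDiff ℝ ∞ σ) (hτ : ContDiff ℝ ∞ τ) :
    extDeriv (σ + τ) = extDeriv σ + extDeriv τ :=
  funext fun v ↦ extDeriv_add (hσ.differentiable (by simp) v) (hτ.differentiable (by simp) v)

theorem extDeriv_smul_eq (c : ℝ) (σ : E → E [⋀^Fin k]→L[ℝ] F) :
    extDeriv (c • σ) = c • extDeriv σ :=
  funext fun _ ↦ extDeriv_smul c σ

theorem extDeriv_neg_eq (σ : E → E [⋀^Fin k]→L[ℝ] F) : extDeriv (-σ) = -extDeriv σ := by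
  simpa only [neg_one_smul] using extDeriv_smul_eq (-1) σ

theorem extDeriv_sub_eq (hσ : ContDiff ℝ ∞ σ) (hτ : ContDiff ℝ ∞ τ) :
    extDeriv (σ - τ) = extDeriv σ - extDeriv τ := by
  rw [sub_eq_add_neg, extDeriv_add_eq (τ := -τ) hσ hτ.neg, extDeriv_neg_eq, sub_eq_add_neg]

theorem extDeriv_extDeriv_eq_zero (hσ : ContDiff ℝ ∞ σ) : extDeriv (extDeriv σ) = 0 :=
  extDeriv_extDeriv hσ (by simpa using WithTop.coe_le_coe.2 (le_top : (2 : ℕ∞) ≤ ⊤))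

theorem extDeriv_comp_add_right (σ : E → E [⋀^Fin k]→L[ℝ] F) (a v : E) :
    extDeriv (fun v ↦ σ (v + a)) v = extDeriv σ (v + a) := by
  rw [extDeriv, extDeriv, fderiv_comp_add_right]

theorem eq_of_extDeriv_eq_zero {σ : E → E [⋀^Fin 0]→L[ℝ] F} (hσ : Differentiable ℝ σ)
    (hd : extDeriv σ = 0) (v w : E) : σ v = σ w := by
  refine is_const_of_fderiv_eq_zero hσ (fun x ↦ ?_) v w
  ext y u
  have hx : extDeriv σ x ![y] = 0 := congrArg (· ![y]) (congrFun hd x)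
  simpa [extDeriv, ContinuousAlternatingMap.alternatizeUncurryFin_apply,
    Subsingleton.elim _ u] using hx

/-- The interior product of an alternating map with the vector `X`. -/
def interiorProduct (X : E) : E [⋀^Fin (k + 1)]→L[ℝ] F →L[ℝ] E [⋀^Fin k]→L[ℝ] F :=
  ContinuousLinearMap.apply ℝ _ X ∘L
    (ContinuousAlternatingMap.curryLeftLI (𝕜 := ℝ) (E := E) (F := F)).toContinuousLinearMap

theorem interiorProduct_apply (X : E) (f : E [⋀^Fin (k + 1)]→L[ℝ] F) (v : Fin k → E) :
    interiorProduct X f v = f (Matrix.vecCons X v) := rfl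

theorem contDiff_interiorProduct {G : Type*} [NormedAddCommGroup G] [NormedSpace ℝ G]
    {n : WithTop ℕ∞} {X : G → E} {θ : G → E [⋀^Fin (k + 1)]→L[ℝ] F} (hX : ContDiff ℝ n X)
    (hθ : ContDiff ℝ n θ) : ContDiff ℝ n fun y ↦ interiorProduct (X y) (θ y) := by
  have hcurry : IsBoundedLinearMap ℝ fun f : E [⋀^Fin (k + 1)]→L[ℝ] F ↦ f.curryLeft :=
    ⟨⟨fun _ _ ↦ rfl, fun _ _ ↦ rfl⟩, 1, one_pos, fun f ↦ by simp⟩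
  exact (hcurry.contDiff.comp hθ).clm_apply hX

theorem extDeriv_interiorProduct_add_interiorProduct_extDeriv
    {σ : E → E [⋀^Fin (k + 1)]→L[ℝ] F} {y : E} (hσ : DifferentiableAt ℝ σ y) (X : E) :
    extDeriv (fun y ↦ interiorProduct X (σ y)) y + interiorProduct X (extDeriv σ y) =
      fderiv ℝ σ y X := by
  have hfderiv := ((interiorProduct X).hasFDerivAt.comp y hσ.hasFDerivAt).fderiv
  simp only [Function.comp_def] at hfderiv
  have hremove (v : Fin (k + 1) → E) (i : Fin (k + 1)) :
      i.succ.removeNth (Matrix.vecCons X v) = Matrix.vecCons X (i.removeNth v) := by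
    funext j
    refine Fin.cases ?_ (fun j ↦ ?_) j <;> simp [Fin.removeNth, Matrix.vecCons]
  ext v
  simp [extDeriv, hfderiv, interiorProduct_apply,
    ContinuousAlternatingMap.alternatizeUncurryFin_apply, Fin.sum_univ_succ (n := k + 1), pow_succ,
    hremove]

end ExtDeriv

section ParametricIntegral

universe u

variable {P : Type*} [NormedAddCommGroup P] [SecondCountableTopology P] [MeasurableSpace P]
  [OpensMeasurableSpace P] {μ : Measure P} [IsFiniteMeasure μ] {K : Set P}

theorem integrable_of_continuous_of_ae_mem {F : Type*} [NormedAddCommGroup F] (hK : IsCompact K)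
    (hμ : ∀ᵐ p ∂μ, p ∈ K) {f : P → F} (hf : Continuous f) : Integrable f μ := by
  obtain ⟨C, hC⟩ := hK.exists_bound_of_continuousOn hf.continuousOn
  exact (integrable_const C).mono' hf.aestronglyMeasurable (hμ.mono fun p hp ↦ hC p hp)

variable [NormedSpace ℝ P] {E F : Type*} [NormedAddCommGroup E] [NormedSpace ℝ E]
  [NormedAddCommGroup F] [NormedSpace ℝ F]

theorem contDiff_fderiv_fst {P : Type*} [NormedAddCommGroup P] [NormedSpace ℝ P] {f : E → P → F}
    (hf : ContDiff ℝ ∞ fun x : E × P ↦ f x.1 x.2) :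
    ContDiff ℝ ∞ fun x : E × P ↦ fderiv ℝ (f · x.2) x.1 :=
  ContDiff.fderiv (f := fun (x : E × P) y ↦ f y x.2) (m := ∞)
    (hf.comp (by fun_prop : ContDiff ℝ ∞ fun z : (E × P) × E ↦ (z.2, z.1.2))) contDiff_fst (by simp)

theorem continuous_extDeriv_fst {P : Type*} [NormedAddCommGroup P] [NormedSpace ℝ P] {k : ℕ}
    {f : E → P → E [⋀^Fin k]→L[ℝ] F} (hf : ContDiff ℝ ∞ fun x : E × P ↦ f x.1 x.2) (x : E) :
    Continuous fun p ↦ extDeriv (f · p) x :=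
  (ContinuousAlternatingMap.alternatizeUncurryFinCLM ℝ E F (n := k)).continuous.comp
    ((contDiff_fderiv_fst hf).continuous.comp (by fun_prop : Continuous fun p : P ↦ (x, p)))

variable [ProperSpace E]

theorem hasFDerivAt_integral_of_contDiff (hK : IsCompact K) (hμ : ∀ᵐ p ∂μ, p ∈ K)
    {f : E → P → F} (hf : ContDiff ℝ ∞ fun x : E × P ↦ f x.1 x.2) (x : E) :
    HasFDerivAt (fun x ↦ ∫ p, f x p ∂μ) (∫ p, fderiv ℝ (f · p) x ∂μ) x := by
  have hfderiv := (contDiff_fderiv_fst hf).continuous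
  obtain ⟨C, hC⟩ := ((isCompact_closedBall x 1).prod hK).exists_bound_of_continuousOn
    hfderiv.continuousOn
  have hfst (p : P) : Differentiable ℝ (f · p) :=
    (hf.comp (by fun_prop : ContDiff ℝ ∞ fun y ↦ (y, p))).differentiable (by simp)
  have hsnd (y : E) : Continuous (f y) :=
    hf.continuous.comp (by fun_prop : Continuous fun p ↦ (y, p))
  have hfderiv_x : Continuous fun p ↦ fderiv ℝ (f · p) x :=
    hfderiv.comp (by fun_prop : Continuous fun p : P ↦ (x, p))
  exact hasFDerivAt_integral_of_dominated_of_fderiv_le (bound := fun _ ↦ C)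
    (F' := fun x p ↦ fderiv ℝ (f · p) x)
    (Metric.closedBall_mem_nhds x one_pos) (.of_forall fun y ↦ (hsnd y).aestronglyMeasurable)
    (integrable_of_continuous_of_ae_mem hK hμ (hsnd x)) hfderiv_x.aestronglyMeasurable
    (hμ.mono fun p hp y hy ↦ hC (y, p) ⟨hy, hp⟩) (integrable_const C)
    (.of_forall fun p y _ ↦ (hfst p y).hasFDerivAt)

theorem contDiff_integral_of_contDiff {E F : Type u} [NormedAddCommGroup E] [NormedSpace ℝ E]
    [ProperSpace E] [NormedAddCommGroup F] [NormedSpace ℝ F] (hK : IsCompact K)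
    (hμ : ∀ᵐ p ∂μ, p ∈ K) {f : E → P → F} (hf : ContDiff ℝ ∞ fun x : E × P ↦ f x.1 x.2) :
    ContDiff ℝ ∞ fun x ↦ ∫ p, f x p ∂μ := by
  refine contDiff_infty.2 fun n ↦ ?_
  induction n generalizing F with
  | zero =>
    exact contDiff_zero.2 (continuous_iff_continuousAt.2 fun x ↦
      (hasFDerivAt_integral_of_contDiff hK hμ hf x).continuousAt)
  | succ n ih =>
    have hfderiv : fderiv ℝ (fun x ↦ ∫ p, f x p ∂μ) = fun x ↦ ∫ p, fderiv ℝ (f · p) x ∂μ :=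
      funext fun x ↦ (hasFDerivAt_integral_of_contDiff hK hμ hf x).fderiv
    push_cast
    refine contDiff_succ_iff_fderiv.2 ⟨fun x ↦
      (hasFDerivAt_integral_of_contDiff hK hμ hf x).differentiableAt, by simp, ?_⟩
    rw [hfderiv]
    exact ih (contDiff_fderiv_fst hf)

theorem fderiv_integral_apply [CompleteSpace F] {G : Type*} [NormedAddCommGroup G] [NormedSpace ℝ G]
    [CompleteSpace G] (hK : IsCompact K) (hμ : ∀ᵐ p ∂μ, p ∈ K) {f : E → P → F}
    (hf : ContDiff ℝ ∞ fun x : E × P ↦ f x.1 x.2) (T : (E →L[ℝ] F) →L[ℝ] G) (x : E) :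
    T (fderiv ℝ (fun x ↦ ∫ p, f x p ∂μ) x) = ∫ p, T (fderiv ℝ (f · p) x) ∂μ := by
  have hfderiv : Continuous fun p ↦ fderiv ℝ (f · p) x :=
    (contDiff_fderiv_fst hf).continuous.comp (by fun_prop : Continuous fun p : P ↦ (x, p))
  rw [(hasFDerivAt_integral_of_contDiff hK hμ hf x).fderiv]
  exact (T.integral_comp_comm (integrable_of_continuous_of_ae_mem hK hμ hfderiv)).symm

theorem extDeriv_integral [CompleteSpace F] {k : ℕ} (hK : IsCompact K) (hμ : ∀ᵐ p ∂μ, p ∈ K)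
    {f : E → P → E [⋀^Fin k]→L[ℝ] F} (hf : ContDiff ℝ ∞ fun x : E × P ↦ f x.1 x.2) (x : E) :
    extDeriv (fun x ↦ ∫ p, f x p ∂μ) x = ∫ p, extDeriv (f · p) x ∂μ :=
  fderiv_integral_apply hK hμ hf
    (ContinuousAlternatingMap.alternatizeUncurryFinCLM ℝ E F (n := k)) x

end ParametricIntegral

section Homotopy

variable {V F : Type*} [NormedAddCommGroup V] [NormedSpace ℝ V] [NormedAddCommGroup F]
  [NormedSpace ℝ F] {k : ℕ}

theorem hasDerivAt_compContinuousLinearMap_inr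
    {σ : ℝ × V → (ℝ × V) [⋀^Fin (k + 1)]→L[ℝ] F} (hσ : Differentiable ℝ σ)
    (hd : extDeriv σ = 0) (u : V) (τ : ℝ) :
    HasDerivAt (fun τ ↦ (σ (τ, u)).compContinuousLinearMap (.inr ℝ ℝ V))
      (extDeriv (fun u ↦ (interiorProduct (1, 0) (σ (τ, u))).compContinuousLinearMap
        (.inr ℝ ℝ V)) u)
      τ := by
  have hslice (u : V) : HasFDerivAt (fun u : V ↦ (τ, u)) (.inr ℝ ℝ V) u :=
    hasFDerivAt_prodMk_right τ u
  have hinterior : DifferentiableAt ℝ (fun z ↦ interiorProduct (1, 0) (σ z)) (τ, u) :=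
    (interiorProduct (F := F) (k := k) ((1, 0) : ℝ × V)).differentiableAt.comp (τ, u) (hσ _)
  have hpull := extDeriv_pullback (r := ∞) (f := fun u : V ↦ (τ, u)) hinterior (by fun_prop)
    (by simpa using WithTop.coe_le_coe.2 (le_top : (2 : ℕ∞) ≤ ⊤))
  simp only [fun u ↦ (hslice u).fderiv] at hpull
  have hcartan := extDeriv_interiorProduct_add_interiorProduct_extDeriv (hσ (τ, u)) (1, 0)
  rw [hd, Pi.zero_apply, map_zero, add_zero] at hcartan
  rw [hpull, hcartan]
  have hline : HasDerivAt (fun τ : ℝ ↦ (τ, u)) (1, 0) τ :=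
    (hasDerivAt_id τ).prodMk (hasDerivAt_const τ u)
  exact ((ContinuousAlternatingMap.compContinuousLinearMapCLM
    (.inr ℝ ℝ V)).hasFDerivAt.comp_hasDerivAt τ ((hσ (τ, u)).hasFDerivAt.comp_hasDerivAt τ hline))

/-- The homotopy operator at time `τ` of the affine homotopy `u ↦ u + τ • (x - p u)`: the pullback
by the homotopy of the contraction of `σ` with its velocity. -/
def homotopyContraction (p : V →L[ℝ] V) (σ : V → V [⋀^Fin (k + 1)]→L[ℝ] F) (x : V) (τ : ℝ)
    (u : V) : V [⋀^Fin k]→L[ℝ] F :=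
  (interiorProduct (x - p u) (σ (u + τ • (x - p u)))).compContinuousLinearMap
    (ContinuousLinearMap.id ℝ V - τ • p)

theorem hasDerivAt_affineHomotopy {p : V →L[ℝ] V} {σ : V → V [⋀^Fin (k + 1)]→L[ℝ] F}
    (hσ : Differentiable ℝ σ) (hd : extDeriv σ = 0) (x u : V) (τ : ℝ) :
    HasDerivAt (fun τ : ℝ ↦ (σ (u + τ • (x - p u))).compContinuousLinearMap
      (ContinuousLinearMap.id ℝ V - τ • p)) (extDeriv (homotopyContraction p σ x τ) u) τ := by
  let Φ : ℝ × V → V := fun z ↦ z.2 + z.1 • (x - p z.2)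
  let Φ' : ℝ × V → ℝ × V →L[ℝ] V := fun z ↦
    .snd ℝ ℝ V + (z.1 • -(p ∘L .snd ℝ ℝ V) + (ContinuousLinearMap.fst ℝ ℝ V).smulRight (x - p z.2))
  have hΦ (z : ℝ × V) : HasFDerivAt Φ (Φ' z) z :=
    hasFDerivAt_snd.fun_add (hasFDerivAt_fst.fun_smul
      ((p.hasFDerivAt.comp z hasFDerivAt_snd).const_sub x))
  have hΦ' : Differentiable ℝ Φ' := by fun_prop
  let ρ : ℝ × V → (ℝ × V) [⋀^Fin (k + 1)]→L[ℝ] F := fun z ↦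
    (σ (Φ z)).compContinuousLinearMap (Φ' z)
  have hρ : Differentiable ℝ ρ := fun z ↦
    ((hσ _).comp z (hΦ z).differentiableAt).continuousAlternatingMapCompContinuousLinearMap (hΦ' z)
  have hdρ : extDeriv ρ = 0 := by
    funext z
    have hpull := extDeriv_pullback (r := ∞) (f := Φ) (hσ (Φ z)) (x := z) (by fun_prop)
      (by simpa using WithTop.coe_le_coe.2 (le_top : (2 : ℕ∞) ≤ ⊤))
    simp only [fun z ↦ (hΦ z).fderiv, hd, Pi.zero_apply] at hpull
    exact hpull.trans rfl
  have hinr (τ : ℝ) (u : V) : Φ' (τ, u) ∘L .inr ℝ ℝ V = ContinuousLinearMap.id ℝ V - τ • p := by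
    ext v; simp [Φ', sub_eq_add_neg]
  have hvelocity (u : V) : Φ' (τ, u) (1, 0) = x - p u := by simp [Φ']
  convert hasDerivAt_compContinuousLinearMap_inr hρ hdρ u τ using 1
  · funext τ
    rw [← hinr τ u]
    rfl
  · congr 1
    funext u
    ext v
    rw [show homotopyContraction p σ x τ u = (interiorProduct (Φ' (τ, u) (1, 0))
      (σ (Φ (τ, u)))).compContinuousLinearMap (Φ' (τ, u) ∘L .inr ℝ ℝ V) by
        rw [hvelocity, hinr]; rfl]
    exact congrArg (σ (Φ (τ, u))) (funext fun j ↦ Fin.cases rfl (fun _ ↦ rfl) j)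

end Homotopy

section AffinePullback

variable {V V' V'' F : Type*} [NormedAddCommGroup V] [NormedSpace ℝ V] [NormedAddCommGroup V']
  [NormedSpace ℝ V'] [NormedAddCommGroup V''] [NormedSpace ℝ V''] [NormedAddCommGroup F]
  [NormedSpace ℝ F] {k : ℕ}

/-- The pullback of `F`-valued `k`-forms by the affine map `v ↦ A v + a`. -/
def affinePullback (A : V →L[ℝ] V') (a : V') (k : ℕ) :
    (V' → V' [⋀^Fin k]→L[ℝ] F) →ₗ[ℝ] (V → V [⋀^Fin k]→L[ℝ] F) where
  toFun σ v := (σ (A v + a)).compContinuousLinearMap A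
  map_add' _ _ := rfl
  map_smul' _ _ := rfl

theorem affinePullback_apply (A : V →L[ℝ] V') (a : V') (σ : V' → V' [⋀^Fin k]→L[ℝ] F) (v : V) :
    affinePullback A a k σ v = (σ (A v + a)).compContinuousLinearMap A := rfl

theorem affinePullback_affinePullback (A : V →L[ℝ] V') (a : V') (A' : V' →L[ℝ] V'') (a' : V'')
    (σ : V'' → V'' [⋀^Fin k]→L[ℝ] F) :
    affinePullback A a k (affinePullback A' a' k σ) =
      affinePullback (A' ∘L A) (A' a + a') k σ := by
  funext v
  simp only [affinePullback_apply, map_add, add_assoc, ContinuousLinearMap.comp_apply]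
  rfl

theorem affinePullback_id_zero (σ : V → V [⋀^Fin k]→L[ℝ] F) :
    affinePullback (.id ℝ V) 0 k σ = σ := by
  funext v
  rw [affinePullback_apply, ContinuousLinearMap.id_apply, add_zero]
  rfl

variable {A : V →L[ℝ] V'} {a : V'} {σ : V' → V' [⋀^Fin k]→L[ℝ] F}

theorem contDiff_affinePullback (hσ : ContDiff ℝ ∞ σ) :
    ContDiff ℝ ∞ (affinePullback A a k σ) :=
  contDiff_compContinuousLinearMap (hσ.comp (by fun_prop : ContDiff ℝ ∞ fun v ↦ A v + a))
    contDiff_const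

theorem extDeriv_affinePullback (hσ : ContDiff ℝ ∞ σ) :
    extDeriv (affinePullback A a k σ) = affinePullback A a (k + 1) (extDeriv σ) := by
  have hfderiv (v : V) : fderiv ℝ (fun v ↦ A v + a) v = A := by
    rw [fderiv_add_const, A.fderiv]
  funext v
  have hpull := extDeriv_pullback (r := ∞) (f := fun v ↦ A v + a) (x := v)
    (hσ.differentiable (by simp) _) (by fun_prop)
    (by simpa using WithTop.coe_le_coe.2 (le_top : (2 : ℕ∞) ≤ ⊤))
  rw [hfderiv] at hpull
  simp only [hfderiv] at hpull
  exact hpull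

end AffinePullback

end MorseNovikov

namespace MappingTorus

open MorseNovikov

section Periodic

variable {W : Type*} [NormedAddCommGroup W] [NormedSpace ℝ W] {k : ℕ} {L : Submodule ℤ W}

/-- The smooth forms on `W × ℝ` that are invariant under the translations by the vectors of the
lattice `L` of `W`. -/
def periodicForms (L : Submodule ℤ W) (k : ℕ) :
    Submodule ℝ (W × ℝ → (W × ℝ) [⋀^Fin k]→L[ℝ] ℝ) where
  carrier := {σ | ContDiff ℝ ∞ σ ∧ ∀ m ∈ L, ∀ v, σ (v + (m, 0)) = σ v}
  add_mem' := fun hσ hτ ↦ ⟨hσ.1.add hτ.1, fun m hm v ↦ by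
    rw [Pi.add_apply, Pi.add_apply, hσ.2 m hm, hτ.2 m hm]⟩
  zero_mem' := ⟨contDiff_const (c := 0), fun _ _ _ ↦ rfl⟩
  smul_mem' := fun c σ hσ ↦ ⟨hσ.1.const_smul c, fun m hm v ↦ by
    rw [Pi.smul_apply, Pi.smul_apply, hσ.2 m hm]⟩

theorem apply_add_mk_zero_of_mem_periodicForms {σ : W × ℝ → (W × ℝ) [⋀^Fin k]→L[ℝ] ℝ}
    (hσ : σ ∈ periodicForms L k) {m : W} (hm : m ∈ L) (w : W) (s : ℝ) :
    σ (w + m, s) = σ (w, s) := by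
  simpa only [Prod.mk_add_mk, add_zero] using hσ.2 m hm (w, s)

theorem extDeriv_mem_periodicForms {σ : W × ℝ → (W × ℝ) [⋀^Fin k]→L[ℝ] ℝ}
    (hσ : σ ∈ periodicForms L k) : extDeriv σ ∈ periodicForms L (k + 1) :=
  ⟨contDiff_extDeriv hσ.1, fun m hm v ↦ by
    rw [← extDeriv_comp_add_right, funext (hσ.2 m hm)]⟩

/-- The forms that are exact in the complex of periodic forms. -/
def exactPeriodicForms (L : Submodule ℤ W) :
    ∀ k, Submodule ℝ (W × ℝ → (W × ℝ) [⋀^Fin k]→L[ℝ] ℝ)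
  | 0 => ⊥
  | k + 1 =>
    { carrier := {σ | ∃ η ∈ periodicForms L k, extDeriv η = σ}
      add_mem' := by
        rintro _ _ ⟨η, hη, rfl⟩ ⟨θ, hθ, rfl⟩
        exact ⟨η + θ, add_mem hη hθ, extDeriv_add_eq hη.1 hθ.1⟩
      zero_mem' := ⟨0, zero_mem _, extDeriv_const 0⟩
      smul_mem' := by
        rintro c _ ⟨η, hη, rfl⟩
        exact ⟨c • η, Submodule.smul_mem _ c hη, extDeriv_smul_eq c η⟩ }

theorem exactPeriodicForms_le_periodicForms :
    ∀ k, exactPeriodicForms L k ≤ periodicForms L k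
  | 0 => bot_le
  | _ + 1 => by
    rintro _ ⟨η, hη, rfl⟩
    exact extDeriv_mem_periodicForms hη

theorem extDeriv_eq_zero_of_mem_exactPeriodicForms :
    ∀ {k : ℕ} {σ : W × ℝ → (W × ℝ) [⋀^Fin k]→L[ℝ] ℝ}, σ ∈ exactPeriodicForms L k → extDeriv σ = 0
  | 0, _, rfl => extDeriv_const 0
  | _ + 1, _, ⟨_, hη, rfl⟩ => extDeriv_extDeriv_eq_zero hη.1

/-- An alternating map on `W` as a form on `W × ℝ` with constant coefficients. -/
def cylinder (k : ℕ) :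
    (W [⋀^Fin k]→L[ℝ] ℝ) →ₗ[ℝ] (W × ℝ → (W × ℝ) [⋀^Fin k]→L[ℝ] ℝ) where
  toFun e := fun _ ↦ e.compContinuousLinearMap (.fst ℝ W ℝ)
  map_add' _ _ := rfl
  map_smul' _ _ := rfl

theorem cylinder_apply (e : W [⋀^Fin k]→L[ℝ] ℝ) (v : W × ℝ) :
    cylinder k e v = e.compContinuousLinearMap (.fst ℝ W ℝ) := rfl

theorem cylinder_mem_periodicForms (L : Submodule ℤ W) (e : W [⋀^Fin k]→L[ℝ] ℝ) :
    cylinder k e ∈ periodicForms L k :=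
  ⟨contDiff_const, fun _ _ _ ↦ rfl⟩

theorem extDeriv_cylinder (e : W [⋀^Fin k]→L[ℝ] ℝ) : extDeriv (cylinder k e) = 0 :=
  extDeriv_const _

end Periodic

section Average

variable {W ι : Type*} [NormedAddCommGroup W] [NormedSpace ℝ W] {k : ℕ}

/-- The projection of `W × ℝ` onto its second factor. -/
def vertical (W : Type*) [NormedAddCommGroup W] [NormedSpace ℝ W] : W × ℝ →L[ℝ] W × ℝ :=
  .inr ℝ W ℝ ∘L .snd ℝ W ℝ

theorem contDiff_homotopyContraction_vertical {σ : W × ℝ → (W × ℝ) [⋀^Fin (k + 1)]→L[ℝ] ℝ}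
    (hσ : ContDiff ℝ ∞ σ) :
    ContDiff ℝ ∞ fun x : (W × ℝ) × (W × ℝ) ↦
      homotopyContraction (vertical W) σ (x.2.1, 0) x.2.2 x.1 := by
  have hvelocity : ContDiff ℝ ∞ fun x : (W × ℝ) × (W × ℝ) ↦
      ((x.2.1, (0 : ℝ)) - vertical W x.1) := by fun_prop
  have hpoint : ContDiff ℝ ∞ fun x : (W × ℝ) × (W × ℝ) ↦
      x.1 + x.2.2 • ((x.2.1, (0 : ℝ)) - vertical W x.1) := by fun_prop
  exact contDiff_compContinuousLinearMap (contDiff_interiorProduct hvelocity (hσ.comp hpoint))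
    (by fun_prop : ContDiff ℝ ∞ fun x : (W × ℝ) × (W × ℝ) ↦
      ContinuousLinearMap.id ℝ (W × ℝ) - x.2.2 • vertical W)

theorem continuous_extDeriv_homotopyContraction_vertical
    {σ : W × ℝ → (W × ℝ) [⋀^Fin (k + 1)]→L[ℝ] ℝ} (hσ : ContDiff ℝ ∞ σ) (v : W × ℝ) :
    Continuous fun q : W × ℝ ↦ extDeriv (homotopyContraction (vertical W) σ (q.1, 0) q.2) v :=
  continuous_extDeriv_fst
    (f := fun v (q : W × ℝ) ↦ homotopyContraction (vertical W) σ (q.1, 0) q.2 v)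
    (contDiff_homotopyContraction_vertical hσ) v

variable [Fintype ι] (b : Module.Basis ι ℝ W)

theorem isCompact_parallelepiped_prod_Icc : IsCompact (parallelepiped b ×ˢ Icc (0 : ℝ) 1) :=
  b.parallelepiped.isCompact.prod isCompact_Icc

theorem integral_extDeriv_homotopyContraction_vertical
    {σ : W × ℝ → (W × ℝ) [⋀^Fin (k + 1)]→L[ℝ] ℝ} (hσ : ContDiff ℝ ∞ σ) (hd : extDeriv σ = 0)
    (y : W) (v : W × ℝ) :
    ∫ τ in Icc (0 : ℝ) 1, extDeriv (homotopyContraction (vertical W) σ (y, 0) τ) v =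
      (σ (v.1 + y, 0)).compContinuousLinearMap (.inl ℝ W ℝ ∘L .fst ℝ W ℝ) - σ v := by
  have hcont := (continuous_extDeriv_homotopyContraction_vertical hσ v).comp
    (by fun_prop : Continuous fun τ : ℝ ↦ (y, τ))
  rw [integral_Icc_eq_integral_Ioc, ← intervalIntegral.integral_of_le zero_le_one,
    intervalIntegral.integral_eq_sub_of_hasDerivAt
      (fun τ _ ↦ hasDerivAt_affineHomotopy (hσ.differentiable (by simp)) hd (y, 0) v τ)
      (hcont.intervalIntegrable _ _)]
  have hone : v + (1 : ℝ) • ((y, (0 : ℝ)) - vertical W v) = (v.1 + y, 0) := by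
    ext <;> simp [vertical]
  have hid : ContinuousLinearMap.id ℝ (W × ℝ) - (1 : ℝ) • vertical W =
      .inl ℝ W ℝ ∘L .fst ℝ W ℝ := by
    ext <;> simp [vertical]
  rw [hone, hid, zero_smul, zero_smul, add_zero, sub_zero]
  rfl

variable [MeasurableSpace W] [BorelSpace W]

/-- The Haar measure on a fundamental domain of the lattice spanned by `b`, normalized to be a
probability measure. -/
def torusMeasure : Measure W := b.addHaar.restrict (ZSpan.fundamentalDomain b)

instance : IsProbabilityMeasure (torusMeasure b) where
  measure_univ := by
    rw [torusMeasure, Measure.restrict_apply_univ,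
      measure_congr (ZSpan.fundamentalDomain_ae_parallelepiped b _), b.addHaar_self]

theorem ae_mem_torusMeasure : ∀ᵐ y ∂torusMeasure b, y ∈ parallelepiped b := by
  have : FiniteDimensional ℝ W := b.finiteDimensional_of_finite
  exact (ae_restrict_mem (ZSpan.fundamentalDomain_measurableSet b)).mono fun _ hy ↦
    ZSpan.fundamentalDomain_subset_parallelepiped b hy

theorem ae_mem_parallelepiped_prod_Icc :
    ∀ᵐ q ∂((torusMeasure b).prod (volume.restrict (Icc (0 : ℝ) 1))),
      q ∈ parallelepiped b ×ˢ Icc (0 : ℝ) 1 := by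
  filter_upwards [Measure.quasiMeasurePreserving_fst.ae (ae_mem_torusMeasure b),
    Measure.quasiMeasurePreserving_snd.ae (ae_restrict_mem measurableSet_Icc)]
    with q hfst hsnd using ⟨hfst, hsnd⟩

theorem integral_torusMeasure_add {F : Type*} [NormedAddCommGroup F] [NormedSpace ℝ F] {f : W → F}
    (hf : ∀ m ∈ Submodule.span ℤ (range b), ∀ y, f (y + m) = f y) (w : W) :
    ∫ y, f (w + y) ∂torusMeasure b = ∫ y, f y ∂torusMeasure b := by
  have : FiniteDimensional ℝ W := b.finiteDimensional_of_finite
  have : VAddInvariantMeasure (Submodule.span ℤ (range b)) W b.addHaar :=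
    ⟨fun m _ _ ↦ measure_preimage_add b.addHaar (m : W) _⟩
  have hdomain := ZSpan.isAddFundamentalDomain b b.addHaar
  have htranslate := (hdomain.vadd_of_comm w).setIntegral_eq hdomain (f := f) fun g y ↦ by
    rw [Submodule.vadd_def, vadd_eq_add, add_comm]; exact hf g g.2 y
  rw [torusMeasure, ← htranslate]
  exact ((measurePreserving_add_left b.addHaar w).setIntegral_image_emb
    (measurableEmbedding_addLeft w) f _).symm

/-- The mean value over the torus fibre of the restriction of a form to the fibre. -/
def fiberMean (σ : W × ℝ → (W × ℝ) [⋀^Fin k]→L[ℝ] ℝ) : W [⋀^Fin k]→L[ℝ] ℝ :=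
  ∫ y, affinePullback (.inl ℝ W ℝ) 0 k σ y ∂torusMeasure b

theorem integral_compContinuousLinearMap_eq_cylinder_fiberMean
    {σ : W × ℝ → (W × ℝ) [⋀^Fin k]→L[ℝ] ℝ}
    (hσ : σ ∈ periodicForms (Submodule.span ℤ (range b)) k) (v : W × ℝ) :
    ∫ y, (σ (v.1 + y, 0)).compContinuousLinearMap (.inl ℝ W ℝ ∘L .fst ℝ W ℝ) ∂torusMeasure b =
      cylinder k (fiberMean b σ) v := by
  have : FiniteDimensional ℝ W := b.finiteDimensional_of_finite
  have hcont : Continuous fun y ↦ affinePullback (.inl ℝ W ℝ) 0 k σ (v.1 + y) :=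
    (contDiff_affinePullback hσ.1).continuous.comp (by fun_prop)
  have hint := integrable_of_continuous_of_ae_mem b.parallelepiped.isCompact
    (ae_mem_torusMeasure b) hcont
  have hperiodic : ∀ m ∈ Submodule.span ℤ (range b), ∀ y,
      affinePullback (.inl ℝ W ℝ) 0 k σ (y + m) = affinePullback (.inl ℝ W ℝ) 0 k σ y := by
    intro m hm y
    simp only [affinePullback_apply, add_zero, ContinuousLinearMap.inl_apply,
      apply_add_mk_zero_of_mem_periodicForms hσ hm]
  rw [cylinder_apply, fiberMean, ← integral_torusMeasure_add b hperiodic v.1]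
  refine Eq.trans (integral_congr_ae (.of_forall fun y ↦ ?_))
    ((ContinuousAlternatingMap.compContinuousLinearMapCLM (.fst ℝ W ℝ)).integral_comp_comm hint)
  simp only [affinePullback_apply, add_zero]
  rfl

/-- The mean over `y` in the torus of the homotopy operators of the affine contractions of
`W × ℝ` onto the slice `W × {0}` that move every point by an element of `y + ℝ`. -/
def averagedContraction (σ : W × ℝ → (W × ℝ) [⋀^Fin (k + 1)]→L[ℝ] ℝ) (v : W × ℝ) :
    (W × ℝ) [⋀^Fin k]→L[ℝ] ℝ :=
  ∫ q : W × ℝ, homotopyContraction (vertical W) σ (q.1, 0) q.2 v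
    ∂((torusMeasure b).prod (volume.restrict (Icc 0 1)))

theorem averagedContraction_mem_periodicForms {L : Submodule ℤ W}
    {σ : W × ℝ → (W × ℝ) [⋀^Fin (k + 1)]→L[ℝ] ℝ} (hσ : σ ∈ periodicForms L (k + 1)) :
    averagedContraction b σ ∈ periodicForms L k := by
  have : FiniteDimensional ℝ W := b.finiteDimensional_of_finite
  refine ⟨contDiff_integral_of_contDiff (isCompact_parallelepiped_prod_Icc b)
    (ae_mem_parallelepiped_prod_Icc b)
    (f := fun v q ↦ homotopyContraction (vertical W) σ (q.1, 0) q.2 v)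
    (contDiff_homotopyContraction_vertical hσ.1), fun m hm v ↦
      integral_congr_ae (.of_forall fun q ↦ ?_)⟩
  have hvertical : vertical W (v + (m, 0)) = vertical W v := by simp [vertical]
  simp only [homotopyContraction, hvertical]
  rw [add_right_comm, hσ.2 m hm]

theorem extDeriv_averagedContraction {σ : W × ℝ → (W × ℝ) [⋀^Fin (k + 1)]→L[ℝ] ℝ}
    (hσ : σ ∈ periodicForms (Submodule.span ℤ (range b)) (k + 1)) (hd : extDeriv σ = 0) :
    extDeriv (averagedContraction b σ) = cylinder (k + 1) (fiberMean b σ) - σ := by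
  have : FiniteDimensional ℝ W := b.finiteDimensional_of_finite
  funext v
  have hK := isCompact_parallelepiped_prod_Icc b
  have hμ := ae_mem_parallelepiped_prod_Icc b
  have hderiv : extDeriv (averagedContraction b σ) v = ∫ q : W × ℝ,
      extDeriv (homotopyContraction (vertical W) σ (q.1, 0) q.2) v
        ∂((torusMeasure b).prod (volume.restrict (Icc 0 1))) :=
    extDeriv_integral hK hμ
      (f := fun v q ↦ homotopyContraction (vertical W) σ (q.1, 0) q.2 v)
      (contDiff_homotopyContraction_vertical hσ.1) v
  have hcont : Continuous fun y ↦
      (σ (v.1 + y, 0)).compContinuousLinearMap (.inl ℝ W ℝ ∘L .fst ℝ W ℝ) :=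
    (ContinuousAlternatingMap.compContinuousLinearMapCLM
      (.inl ℝ W ℝ ∘L .fst ℝ W ℝ)).continuous.comp (hσ.1.continuous.comp (by fun_prop))
  rw [hderiv, integral_prod _ (integrable_of_continuous_of_ae_mem hK hμ
    (continuous_extDeriv_homotopyContraction_vertical hσ.1 v))]
  simp only [integral_extDeriv_homotopyContraction_vertical hσ.1 hd]
  rw [integral_sub (integrable_of_continuous_of_ae_mem b.parallelepiped.isCompact
      (ae_mem_torusMeasure b) hcont) (integrable_const _),
    integral_compContinuousLinearMap_eq_cylinder_fiberMean b hσ, integral_const, probReal_univ,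
    one_smul]
  rfl

theorem integral_periodicForms_add_inl {η : W × ℝ → (W × ℝ) [⋀^Fin k]→L[ℝ] ℝ}
    (hη : η ∈ periodicForms (Submodule.span ℤ (range b)) k) (w : W) :
    ∫ y, η ((w, 0) + (y, 0)) ∂torusMeasure b = ∫ y, η (y, 0) ∂torusMeasure b := by
  simpa only [Prod.mk_add_mk, add_zero] using integral_torusMeasure_add b
    (f := fun y ↦ η (y, 0))
    (fun m hm y ↦ apply_add_mk_zero_of_mem_periodicForms hη hm y 0) w

end Average

section ConstantCoefficients

variable {W ι : Type*} [NormedAddCommGroup W] [NormedSpace ℝ W] [Finite ι] (b : Module.Basis ι ℝ W)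

theorem exists_sub_cylinder_mem_exactPeriodicForms :
    ∀ {k : ℕ} {σ : W × ℝ → (W × ℝ) [⋀^Fin k]→L[ℝ] ℝ},
      σ ∈ periodicForms (Submodule.span ℤ (range b)) k → extDeriv σ = 0 →
        ∃ e, σ - cylinder k e ∈ exactPeriodicForms (Submodule.span ℤ (range b)) k
  | 0, σ, hσ, hd => by
    refine ⟨(σ 0).compContinuousLinearMap (.inl ℝ W ℝ), sub_eq_zero.2 (funext fun v ↦ ?_)⟩
    rw [eq_of_extDeriv_eq_zero (hσ.1.differentiable (by simp)) hd v 0]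
    ext u
    exact congrArg (σ 0) (Subsingleton.elim _ _)
  | k + 1, σ, hσ, hd => by
    have := Fintype.ofFinite ι
    borelize W
    refine ⟨fiberMean b σ, -averagedContraction b σ,
      neg_mem (averagedContraction_mem_periodicForms b hσ), ?_⟩
    rw [extDeriv_neg_eq, extDeriv_averagedContraction b hσ hd, neg_sub]

theorem eq_zero_of_cylinder_mem_exactPeriodicForms :
    ∀ {k : ℕ} {e : W [⋀^Fin k]→L[ℝ] ℝ},
      cylinder k e ∈ exactPeriodicForms (Submodule.span ℤ (range b)) k → e = 0
  | 0, e, he => by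
    ext u
    have h := congrArg (· fun i ↦ (u i, 0)) (congrFun he 0)
    exact h
  | k + 1, e, he => by
    have := Fintype.ofFinite ι
    have : FiniteDimensional ℝ W := b.finiteDimensional_of_finite
    borelize W
    obtain ⟨η, hη, hηe⟩ := he
    have hs : ContDiff ℝ ∞ fun x : (W × ℝ) × W ↦ η (x.1 + (x.2, 0)) := hη.1.comp (by fun_prop)
    have hK := b.parallelepiped.isCompact
    have hμ := ae_mem_torusMeasure b
    let mean : W × ℝ → (W × ℝ) [⋀^Fin k]→L[ℝ] ℝ := fun v ↦ ∫ y, η (v + (y, 0)) ∂torusMeasure b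
    have hmean : extDeriv mean = cylinder (k + 1) e := by
      funext v
      rw [extDeriv_integral hK hμ (f := fun v y ↦ η (v + (y, 0))) hs v]
      simp only [extDeriv_comp_add_right, hηe, cylinder_apply, integral_const, probReal_univ,
        one_smul]
    have hconst : affinePullback (.inl ℝ W ℝ) 0 k mean =
        fun _ ↦ affinePullback (.inl ℝ W ℝ) 0 k mean 0 := by
      funext w
      simp only [affinePullback_apply, add_zero, ContinuousLinearMap.inl_apply, mean,
        integral_periodicForms_add_inl b hη]
    have hzero := extDeriv_affinePullback (A := .inl ℝ W ℝ) (a := 0)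
      (contDiff_integral_of_contDiff hK hμ (f := fun v y ↦ η (v + (y, 0))) hs)
    rw [show (fun v ↦ ∫ y, η (v + (y, 0)) ∂torusMeasure b) = mean from rfl, hmean, hconst,
      extDeriv_const] at hzero
    exact (congrFun hzero 0).symm

end ConstantCoefficients

section LocallyFiniteSum

variable {V F : Type*} [NormedAddCommGroup F] [NormedSpace ℝ F]

/-- The solution `∑ Tⁿ (η (gⁿ v))` of the equation `X v = η v + T (X (g v))`. It is meant for `h`
decreasing by one under `g` and `η` vanishing where `h ≤ 0`, so that the omitted terms are zero. -/
def orbitSum (T : F →L[ℝ] F) (g : V → V) (h : V → ℝ) (η : V → F) (v : V) : F :=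
  ∑ n ∈ Finset.range ⌈h v⌉₊, (T ^ n) (η (g^[n] v))

variable {T : F →L[ℝ] F} {g : V → V} {h : V → ℝ} {η : V → F}

theorem orbitSum_eq (hg : ∀ v, h (g v) = h v - 1) (hη : ∀ v, h v ≤ 0 → η v = 0) (v : V) :
    orbitSum T g h η v = η v + T (orbitSum T g h η (g v)) := by
  rcases le_or_gt (h v) 0 with hv | hv
  · have hceil : ⌈h v⌉₊ = 0 := Nat.ceil_eq_zero.2 hv
    have hceil' : ⌈h (g v)⌉₊ = 0 := Nat.ceil_eq_zero.2 (by rw [hg]; linarith)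
    simp [orbitSum, hceil, hceil', hη v hv]
  · have hceil : ⌈h v⌉₊ = ⌈h (g v)⌉₊ + 1 := by
      rw [hg, Nat.ceil_sub_one, Nat.sub_add_cancel (Nat.one_le_ceil_iff.2 hv)]
    rw [orbitSum, hceil, Finset.sum_range_succ', add_comm, orbitSum, map_sum]
    simp [pow_succ']

theorem orbitSum_add [Add V] {S : Set V} (hS : ∀ m ∈ S, ∃ m' ∈ S, ∀ v, g (v + m) = g v + m')
    (hhS : ∀ m ∈ S, ∀ v, h (v + m) = h v) (hηS : ∀ m ∈ S, ∀ v, η (v + m) = η v) {m : V}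
    (hm : m ∈ S) (v : V) : orbitSum T g h η (v + m) = orbitSum T g h η v := by
  have hiterate (n : ℕ) : η (g^[n] (v + m)) = η (g^[n] v) := by
    induction n generalizing v m with
    | zero => exact hηS m hm v
    | succ n ih =>
      obtain ⟨m', hm', hgm⟩ := hS m hm
      rw [Function.iterate_succ_apply, Function.iterate_succ_apply, hgm, ih hm']
  simp only [orbitSum, hhS m hm, hiterate]

variable [NormedAddCommGroup V] [NormedSpace ℝ V]

theorem contDiff_orbitSum (hg : ∀ v, h (g v) = h v - 1) (hη : ∀ v, h v ≤ 0 → η v = 0)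
    (hh : Continuous h) (hgs : ContDiff ℝ ∞ g) (hηs : ContDiff ℝ ∞ η) :
    ContDiff ℝ ∞ (orbitSum T g h η) := by
  have hiterate (n : ℕ) : ContDiff ℝ ∞ g^[n] := by
    induction n with
    | zero => exact contDiff_id
    | succ n ih => rw [Function.iterate_succ]; exact ih.comp hgs
  have hh_iterate (n : ℕ) (v : V) : h (g^[n] v) = h v - n := by
    induction n with
    | zero => simp
    | succ n ih => rw [Function.iterate_succ_apply', hg, ih]; push_cast; ring
  refine contDiff_iff_contDiffAt.2 fun v ↦ ?_
  have hsum : ContDiff ℝ ∞ fun w ↦ ∑ n ∈ Finset.range (⌈h v⌉₊ + 1), (T ^ n) (η (g^[n] w)) :=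
    ContDiff.sum fun n _ ↦ (T ^ n).contDiff.comp (hηs.comp (hiterate n))
  refine hsum.contDiffAt.congr_of_eventuallyEq ?_
  have hlt : h v < (⌈h v⌉₊ + 1 : ℕ) := by
    push_cast
    linarith [Nat.le_ceil (h v)]
  filter_upwards [hh.continuousAt.eventually_lt continuousAt_const hlt] with w hw
  refine Finset.sum_subset (Finset.range_subset_range.2 (Nat.ceil_le.2 hw.le)) fun n _ hn ↦ ?_
  rw [Finset.mem_range, not_lt] at hn
  rw [hη _ (by rw [hh_iterate]; linarith [Nat.ceil_le.1 hn]), map_zero]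

end LocallyFiniteSum

section Shift

variable {W : Type*} [NormedAddCommGroup W] [NormedSpace ℝ W] {k : ℕ} {L : Submodule ℤ W}

theorem smul_snd_mem_periodicForms {φ : ℝ → ℝ} (hφ : ContDiff ℝ ∞ φ)
    {σ : W × ℝ → (W × ℝ) [⋀^Fin k]→L[ℝ] ℝ} (hσ : σ ∈ periodicForms L k) :
    (fun v ↦ φ v.2 • σ v) ∈ periodicForms L k :=
  ⟨(hφ.comp contDiff_snd).smul hσ.1, fun m hm v ↦ by
    simp only [hσ.2 m hm, Prod.snd_add, add_zero]⟩

theorem affinePullback_mem_periodicForms {G : W × ℝ →L[ℝ] W × ℝ} (a : W × ℝ)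
    (hG : ∀ m ∈ L, ∃ m' ∈ L, G (m, 0) = (m', 0)) {σ : W × ℝ → (W × ℝ) [⋀^Fin k]→L[ℝ] ℝ}
    (hσ : σ ∈ periodicForms L k) : affinePullback G a k σ ∈ periodicForms L k := by
  refine ⟨contDiff_affinePullback hσ.1, fun m hm v ↦ ?_⟩
  obtain ⟨m', hm', hGm⟩ := hG m hm
  rw [affinePullback_apply, map_add, hGm, add_right_comm, hσ.2 m' hm', affinePullback_apply]

theorem exists_eq_add_smul_affinePullback {G : W × ℝ →L[ℝ] W × ℝ} {a : W × ℝ} {h : W × ℝ → ℝ}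
    (hG : ∀ m ∈ L, ∃ m' ∈ L, G (m, 0) = (m', 0)) (hh : Continuous h)
    (hGa : ∀ v, h (G v + a) = h v - 1) (hhL : ∀ m ∈ L, ∀ v, h (v + (m, 0)) = h v) (c : ℝ)
    {η : W × ℝ → (W × ℝ) [⋀^Fin k]→L[ℝ] ℝ} (hη : η ∈ periodicForms L k)
    (hη0 : ∀ v, h v ≤ 0 → η v = 0) :
    ∃ X ∈ periodicForms L k, X = η + c • affinePullback G a k X := by
  let T : (W × ℝ) [⋀^Fin k]→L[ℝ] ℝ →L[ℝ] (W × ℝ) [⋀^Fin k]→L[ℝ] ℝ :=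
    c • ContinuousAlternatingMap.compContinuousLinearMapCLM G
  refine ⟨orbitSum T (fun v ↦ G v + a) h η,
    ⟨contDiff_orbitSum hGa hη0 hh (by fun_prop) hη.1, fun m hm v ↦ ?_⟩,
    funext fun v ↦ orbitSum_eq hGa hη0 v⟩
  refine orbitSum_add (S := (fun m ↦ (m, 0)) '' (L : Set W)) ?_ ?_ ?_ ⟨m, hm, rfl⟩ v
  · rintro _ ⟨m, hm, rfl⟩
    obtain ⟨m', hm', hGm⟩ := hG m hm
    exact ⟨(m', 0), ⟨m', hm', rfl⟩, fun v ↦ by rw [map_add, hGm, add_right_comm]⟩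
  · rintro _ ⟨m, hm, rfl⟩
    exact hhL m hm
  · rintro _ ⟨m, hm, rfl⟩
    exact hη.2 m hm

variable {B : W ≃L[ℝ] W} {r : ℝ}

/-- The pullback of forms by the affine map `(w, s) ↦ (B w, s + r)`. -/
def shiftPullback (B : W ≃L[ℝ] W) (r : ℝ) (k : ℕ) :
    (W × ℝ → (W × ℝ) [⋀^Fin k]→L[ℝ] ℝ) →ₗ[ℝ] (W × ℝ → (W × ℝ) [⋀^Fin k]→L[ℝ] ℝ) :=
  affinePullback (B.prodCongr (.refl ℝ ℝ) : W × ℝ →L[ℝ] W × ℝ) (0, r) k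

/-- The pullback of alternating maps by `B`. -/
def altPullback (B : W ≃L[ℝ] W) (k : ℕ) : (W [⋀^Fin k]→L[ℝ] ℝ) →ₗ[ℝ] (W [⋀^Fin k]→L[ℝ] ℝ) where
  toFun e := e.compContinuousLinearMap (B : W →L[ℝ] W)
  map_add' _ _ := rfl
  map_smul' _ _ := rfl

theorem shiftPullback_shiftPullback (B B' : W ≃L[ℝ] W) (r r' : ℝ)
    (σ : W × ℝ → (W × ℝ) [⋀^Fin k]→L[ℝ] ℝ) :
    shiftPullback B r k (shiftPullback B' r' k σ) = shiftPullback (B' * B) (r' + r) k σ := by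
  rw [shiftPullback, shiftPullback, affinePullback_affinePullback, shiftPullback]
  congr 2
  simp [add_comm]

theorem shiftPullback_shiftPullback_symm (σ : W × ℝ → (W × ℝ) [⋀^Fin k]→L[ℝ] ℝ) :
    shiftPullback B r k (shiftPullback B.symm (-r) k σ) = σ := by
  rw [shiftPullback_shiftPullback, neg_add_cancel]
  exact (congrArg (shiftPullback · 0 k σ) (inv_mul_cancel B)).trans (affinePullback_id_zero σ)

theorem shiftPullback_mem_periodicForms (hB : ∀ m ∈ L, B m ∈ L) (r : ℝ)
    {σ : W × ℝ → (W × ℝ) [⋀^Fin k]→L[ℝ] ℝ} (hσ : σ ∈ periodicForms L k) :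
    shiftPullback B r k σ ∈ periodicForms L k :=
  affinePullback_mem_periodicForms _ (fun m hm ↦ ⟨B m, hB m hm, rfl⟩) hσ

/-- The operator `S^* - c` on forms, where `S` is the map `(w, s) ↦ (B w, s + 1)`. -/
def shiftDefect (B : W ≃L[ℝ] W) (c : ℝ) (k : ℕ) :
    (W × ℝ → (W × ℝ) [⋀^Fin k]→L[ℝ] ℝ) →ₗ[ℝ] (W × ℝ → (W × ℝ) [⋀^Fin k]→L[ℝ] ℝ) :=
  shiftPullback B 1 k - c • LinearMap.id

theorem shiftDefect_apply (c : ℝ) (σ : W × ℝ → (W × ℝ) [⋀^Fin k]→L[ℝ] ℝ) :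
    shiftDefect B c k σ = shiftPullback B 1 k σ - c • σ := rfl

theorem extDeriv_shiftDefect (c : ℝ) {σ : W × ℝ → (W × ℝ) [⋀^Fin k]→L[ℝ] ℝ}
    (hσ : ContDiff ℝ ∞ σ) :
    extDeriv (shiftDefect B c k σ) = shiftDefect B c (k + 1) (extDeriv σ) := by
  have hshift : ContDiff ℝ ∞ (shiftPullback B 1 k σ) := contDiff_affinePullback hσ
  rw [shiftDefect_apply, extDeriv_sub_eq (τ := c • σ) hshift (hσ.const_smul c), extDeriv_smul_eq]
  exact congrArg (· - _) (extDeriv_affinePullback hσ)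

theorem shiftDefect_mem_periodicForms (hB : ∀ m ∈ L, B m ∈ L) (c : ℝ)
    {σ : W × ℝ → (W × ℝ) [⋀^Fin k]→L[ℝ] ℝ} (hσ : σ ∈ periodicForms L k) :
    shiftDefect B c k σ ∈ periodicForms L k :=
  sub_mem (shiftPullback_mem_periodicForms hB 1 hσ) (Submodule.smul_mem _ c hσ)

theorem shiftDefect_mem_exactPeriodicForms (hB : ∀ m ∈ L, B m ∈ L) (c : ℝ) :
    ∀ {k : ℕ} {σ : W × ℝ → (W × ℝ) [⋀^Fin k]→L[ℝ] ℝ},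
      σ ∈ exactPeriodicForms L k → shiftDefect B c k σ ∈ exactPeriodicForms L k
  | 0, _, rfl => map_zero _
  | _ + 1, _, ⟨_, hη, rfl⟩ =>
    ⟨_, shiftDefect_mem_periodicForms hB c hη, extDeriv_shiftDefect c hη.1⟩

/- The form is cut into a part supported in `s ≥ 0` and a part supported in `s ≤ 1`: on the former
`S^* - c` is inverted by a sum over the backward orbit, on the latter by a sum over the forward
orbit. -/
theorem exists_shiftDefect_eq (hB : ∀ m, B m ∈ L ↔ m ∈ L) {c : ℝ} (hc : c ≠ 0)
    {η : W × ℝ → (W × ℝ) [⋀^Fin k]→L[ℝ] ℝ} (hη : η ∈ periodicForms L k) :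
    ∃ ξ ∈ periodicForms L k, shiftDefect B c k ξ = η := by
  have hBsymm (m : W) (hm : m ∈ L) : B.symm m ∈ L := (hB _).1 (by simpa using hm)
  have hφ : ContDiff ℝ ∞ Real.smoothTransition := Real.smoothTransition.contDiff
  obtain ⟨X, hX, hXeq⟩ := exists_eq_add_smul_affinePullback
    (G := (B.symm.prodCongr (.refl ℝ ℝ) : W × ℝ →L[ℝ] W × ℝ)) (a := (0, -1)) (h := Prod.snd)
    (fun m hm ↦ ⟨_, hBsymm m hm, rfl⟩) continuous_snd (fun v ↦ by simp [sub_eq_add_neg])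
    (fun _ _ v ↦ by simp) c (smul_snd_mem_periodicForms hφ hη)
    (fun v hv ↦ by simp only [Real.smoothTransition.zero_of_nonpos hv, zero_smul])
  obtain ⟨Y, hY, hYeq⟩ := exists_eq_add_smul_affinePullback
    (G := (B.prodCongr (.refl ℝ ℝ) : W × ℝ →L[ℝ] W × ℝ)) (a := (0, 1)) (h := fun v ↦ 1 - v.2)
    (fun m hm ↦ ⟨_, (hB m).2 hm, rfl⟩) (by fun_prop) (fun v ↦ by simp)
    (fun _ _ v ↦ by simp) c⁻¹
    (smul_snd_mem_periodicForms ((contDiff_const (c := (1 : ℝ))).sub hφ) hη)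
    (fun v hv ↦ by
      simp only [Real.smoothTransition.one_of_one_le (sub_nonpos.1 hv), sub_self, zero_smul])
  have hXmem := shiftPullback_mem_periodicForms hBsymm (-1) hX
  refine ⟨shiftPullback B.symm (-1) k X - c⁻¹ • Y,
    sub_mem hXmem (Submodule.smul_mem _ _ hY), ?_⟩
  have hXdefect : shiftDefect B c k (shiftPullback B.symm (-1) k X) =
      fun v ↦ Real.smoothTransition v.2 • η v := by
    rw [shiftDefect_apply, shiftPullback_shiftPullback_symm]
    exact sub_eq_of_eq_add hXeq
  have hYdefect : shiftDefect B c k (c⁻¹ • Y) =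
      -fun v ↦ (1 - Real.smoothTransition v.2) • η v := by
    rw [shiftDefect_apply, map_smul, smul_inv_smul₀ hc, ← neg_sub]
    exact congrArg Neg.neg (sub_eq_of_eq_add hYeq)
  rw [map_sub, hXdefect, hYdefect, sub_neg_eq_add]
  funext v
  rw [Pi.add_apply, ← add_smul, add_sub_cancel, one_smul]

theorem exists_mem_exactPeriodicForms_shiftDefect_eq (hB : ∀ m, B m ∈ L ↔ m ∈ L) {c : ℝ}
    (hc : c ≠ 0) :
    ∀ {k : ℕ} {σ : W × ℝ → (W × ℝ) [⋀^Fin k]→L[ℝ] ℝ}, σ ∈ exactPeriodicForms L k →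
      ∃ ξ ∈ exactPeriodicForms L k, shiftDefect B c k ξ = σ
  | 0, _, rfl => ⟨0, zero_mem _, map_zero _⟩
  | _ + 1, _, ⟨η, hη, rfl⟩ => by
    obtain ⟨ξ, hξ, rfl⟩ := exists_shiftDefect_eq hB hc hη
    exact ⟨extDeriv ξ, ⟨ξ, hξ, rfl⟩, (extDeriv_shiftDefect c hξ.1).symm⟩

end Shift

section Cohomology

theorem finiteDimensional_alternating (W : Type*) [NormedAddCommGroup W] [NormedSpace ℝ W]
    [FiniteDimensional ℝ W] (k : ℕ) : FiniteDimensional ℝ (W [⋀^Fin k]→L[ℝ] ℝ) :=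
  Module.Finite.of_injective
    (AlternatingMap.toMultilinearMapLM ∘ₗ
      ContinuousAlternatingMap.toAlternatingMapLinear (R := ℝ) (A := ℝ))
    (AlternatingMap.coe_multilinearMap_injective.comp
      ContinuousAlternatingMap.toAlternatingMap_injective)

variable {W : Type*} [NormedAddCommGroup W] [NormedSpace ℝ W] {k : ℕ}

/-- The smooth forms on `W × ℝ` that are invariant under translations by `L` and are multiplied by
`c` under the pullback by `(w, s) ↦ (B w, s + 1)`. -/
def twistedForms (L : Submodule ℤ W) (B : W ≃L[ℝ] W) (c : ℝ) (k : ℕ) :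
    Submodule ℝ (W × ℝ → (W × ℝ) [⋀^Fin k]→L[ℝ] ℝ) :=
  periodicForms L k ⊓ LinearMap.ker (shiftDefect B c k)

/-- The operator `B^* - c` on alternating maps. -/
def altDefect (B : W ≃L[ℝ] W) (c : ℝ) (k : ℕ) :
    (W [⋀^Fin k]→L[ℝ] ℝ) →ₗ[ℝ] (W [⋀^Fin k]→L[ℝ] ℝ) :=
  altPullback B k - c • LinearMap.id

/-- The alternating maps on `W` that are multiplied by `c` under the pullback by `B`. -/
def eigenforms (B : W ≃L[ℝ] W) (c : ℝ) (k : ℕ) : Submodule ℝ (W [⋀^Fin k]→L[ℝ] ℝ) :=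
  LinearMap.ker (altDefect B c k)

variable {L : Submodule ℤ W} {B : W ≃L[ℝ] W} {c : ℝ}

theorem mem_twistedForms {σ : W × ℝ → (W × ℝ) [⋀^Fin k]→L[ℝ] ℝ} :
    σ ∈ twistedForms L B c k ↔ σ ∈ periodicForms L k ∧ shiftPullback B 1 k σ = c • σ :=
  and_congr_right fun _ ↦ sub_eq_zero

theorem mem_eigenforms {e : W [⋀^Fin k]→L[ℝ] ℝ} :
    e ∈ eigenforms B c k ↔ altPullback B k e = c • e :=
  sub_eq_zero

theorem altDefect_apply (e : W [⋀^Fin k]→L[ℝ] ℝ) :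
    altDefect B c k e = altPullback B k e - c • e := rfl

theorem shiftDefect_cylinder (e : W [⋀^Fin k]→L[ℝ] ℝ) :
    shiftDefect B c k (cylinder k e) = cylinder k (altDefect B c k e) := rfl

theorem extDeriv_mem_twistedForms {σ : W × ℝ → (W × ℝ) [⋀^Fin k]→L[ℝ] ℝ}
    (hσ : σ ∈ twistedForms L B c k) : extDeriv σ ∈ twistedForms L B c (k + 1) := by
  refine ⟨extDeriv_mem_periodicForms hσ.1, LinearMap.mem_ker.2 ?_⟩
  rw [← extDeriv_shiftDefect c hσ.1.1, LinearMap.mem_ker.1 hσ.2]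
  exact extDeriv_const 0

theorem cylinder_mem_twistedForms {e : W [⋀^Fin k]→L[ℝ] ℝ} (he : e ∈ eigenforms B c k) :
    cylinder k e ∈ twistedForms L B c k := by
  refine ⟨cylinder_mem_periodicForms L e, LinearMap.mem_ker.2 ?_⟩
  rw [shiftDefect_cylinder, LinearMap.mem_ker.1 he, map_zero]

/-- The form `s e` on `W × ℝ`, where `s` is the second coordinate. It is a primitive of `ds ∧ e`
that is periodic but not twisted. -/
def slant (k : ℕ) :
    (W [⋀^Fin k]→L[ℝ] ℝ) →ₗ[ℝ] (W × ℝ → (W × ℝ) [⋀^Fin k]→L[ℝ] ℝ) where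
  toFun e := fun v ↦ v.2 • cylinder k e v
  map_add' e e' := funext fun v ↦ smul_add v.2 (cylinder k e v) (cylinder k e' v)
  map_smul' t e := funext fun v ↦ smul_comm v.2 t (cylinder k e v)

theorem slant_mem_periodicForms (L : Submodule ℤ W) (e : W [⋀^Fin k]→L[ℝ] ℝ) :
    slant k e ∈ periodicForms L k :=
  smul_snd_mem_periodicForms contDiff_id (cylinder_mem_periodicForms L e)

theorem shiftDefect_slant {e : W [⋀^Fin k]→L[ℝ] ℝ} (he : e ∈ eigenforms B c k) :
    shiftDefect B c k (slant k e) = c • cylinder k e := by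
  have hslant : shiftPullback B 1 k (slant k e) =
      slant k (altPullback B k e) + cylinder k (altPullback B k e) := by
    funext v
    change (v.2 + 1) • cylinder k (altPullback B k e) v =
      v.2 • cylinder k (altPullback B k e) v + cylinder k (altPullback B k e) v
    rw [add_smul, one_smul]
  rw [shiftDefect_apply, hslant, mem_eigenforms.1 he, map_smul, map_smul, add_sub_cancel_left]

/-- The form `ds ∧ e` on `W × ℝ`, where `s` is the second coordinate. -/
def dsWedge (k : ℕ) :
    (W [⋀^Fin k]→L[ℝ] ℝ) →ₗ[ℝ] (W × ℝ → (W × ℝ) [⋀^Fin (k + 1)]→L[ℝ] ℝ) where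
  toFun e := extDeriv (slant k e)
  map_add' e e' := by
    rw [map_add, extDeriv_add_eq (slant_mem_periodicForms ⊥ e).1 (slant_mem_periodicForms ⊥ e').1]
  map_smul' t e := by rw [map_smul, extDeriv_smul_eq, RingHom.id_apply]

theorem dsWedge_apply (e : W [⋀^Fin k]→L[ℝ] ℝ) : dsWedge k e = extDeriv (slant k e) := rfl

theorem extDeriv_dsWedge (e : W [⋀^Fin k]→L[ℝ] ℝ) : extDeriv (dsWedge k e) = 0 :=
  extDeriv_extDeriv_eq_zero (slant_mem_periodicForms ⊥ e).1

theorem dsWedge_mem_twistedForms {e : W [⋀^Fin k]→L[ℝ] ℝ} (he : e ∈ eigenforms B c k) :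
    dsWedge k e ∈ twistedForms L B c (k + 1) := by
  have hslant := slant_mem_periodicForms L e
  refine ⟨extDeriv_mem_periodicForms hslant, LinearMap.mem_ker.2 ?_⟩
  rw [dsWedge_apply, ← extDeriv_shiftDefect c hslant.1, shiftDefect_slant he, extDeriv_smul_eq,
    extDeriv_cylinder, smul_zero]

variable {ι : Type*} [Finite ι] {b : Module.Basis ι ℝ W}

theorem mem_eigenforms_of_sub_cylinder_mem_exactPeriodicForms
    (hB : ∀ m ∈ Submodule.span ℤ (range b), B m ∈ Submodule.span ℤ (range b))
    {e : W [⋀^Fin k]→L[ℝ] ℝ} {σ : W × ℝ → (W × ℝ) [⋀^Fin k]→L[ℝ] ℝ}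
    (hσ : σ ∈ twistedForms (Submodule.span ℤ (range b)) B c k)
    (hσe : σ - cylinder k e ∈ exactPeriodicForms (Submodule.span ℤ (range b)) k) :
    e ∈ eigenforms B c k := by
  have hdefect := shiftDefect_mem_exactPeriodicForms hB c hσe
  rw [map_sub, LinearMap.mem_ker.1 hσ.2, zero_sub, shiftDefect_cylinder, neg_mem_iff] at hdefect
  exact eq_zero_of_cylinder_mem_exactPeriodicForms b hdefect

theorem exists_mem_eigenforms_sub_cylinder_mem_exactPeriodicForms
    (hB : ∀ m ∈ Submodule.span ℤ (range b), B m ∈ Submodule.span ℤ (range b))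
    {σ : W × ℝ → (W × ℝ) [⋀^Fin k]→L[ℝ] ℝ}
    (hσ : σ ∈ twistedForms (Submodule.span ℤ (range b)) B c k) (hd : extDeriv σ = 0) :
    ∃ e ∈ eigenforms B c k,
      σ - cylinder k e ∈ exactPeriodicForms (Submodule.span ℤ (range b)) k := by
  obtain ⟨e, hσe⟩ := exists_sub_cylinder_mem_exactPeriodicForms b hσ.1 hd
  exact ⟨e, mem_eigenforms_of_sub_cylinder_mem_exactPeriodicForms hB hσ hσe, hσe⟩

theorem exists_eq_cylinder_of_extDeriv_eq_zero
    (hB : ∀ m ∈ Submodule.span ℤ (range b), B m ∈ Submodule.span ℤ (range b))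
    {σ : W × ℝ → (W × ℝ) [⋀^Fin 0]→L[ℝ] ℝ}
    (hσ : σ ∈ twistedForms (Submodule.span ℤ (range b)) B c 0) (hd : extDeriv σ = 0) :
    ∃ e ∈ eigenforms B c 0, σ = cylinder 0 e := by
  obtain ⟨e, he, hσe⟩ := exists_mem_eigenforms_sub_cylinder_mem_exactPeriodicForms hB hσ hd
  exact ⟨e, he, sub_eq_zero.1 hσe⟩

theorem exists_extDeriv_eq_dsWedge_add_extDeriv (hc : c ≠ 0)
    (hB : ∀ m, B m ∈ Submodule.span ℤ (range b) ↔ m ∈ Submodule.span ℤ (range b))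
    (hss : Disjoint (eigenforms B c k) (LinearMap.range (altDefect B c k)))
    {η : W × ℝ → (W × ℝ) [⋀^Fin k]→L[ℝ] ℝ} (hη : η ∈ periodicForms (Submodule.span ℤ (range b)) k)
    (hd : extDeriv (shiftDefect B c k η) = 0) :
    ∃ e ∈ eigenforms B c k, ∃ θ ∈ twistedForms (Submodule.span ℤ (range b)) B c k,
      extDeriv η = dsWedge k e + extDeriv θ := by
  have : FiniteDimensional ℝ W := b.finiteDimensional_of_finite
  have := finiteDimensional_alternating W k
  obtain ⟨e₀, he₀⟩ := exists_sub_cylinder_mem_exactPeriodicForms b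
    (shiftDefect_mem_periodicForms (fun m hm ↦ (hB m).2 hm) c hη) hd
  obtain ⟨ξ, hξ, hξe₀⟩ := exists_mem_exactPeriodicForms_shiftDefect_eq hB hc he₀
  have hsup : eigenforms B c k ⊔ LinearMap.range (altDefect B c k) = ⊤ :=
    Submodule.eq_top_of_disjoint _ _
      (by rw [add_comm]; exact (LinearMap.finrank_range_add_finrank_ker _).ge) hss
  obtain ⟨e₁, he₁, _, ⟨e₂, rfl⟩, rfl⟩ := Submodule.mem_sup.1 (hsup ▸ Submodule.mem_top (x := e₀))
  have he : c⁻¹ • e₁ ∈ eigenforms B c k := Submodule.smul_mem _ _ he₁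
  have hslant := slant_mem_periodicForms (Submodule.span ℤ (range b)) (c⁻¹ • e₁)
  have hcylinder := cylinder_mem_periodicForms (Submodule.span ℤ (range b)) e₂
  have hξ' := exactPeriodicForms_le_periodicForms k hξ
  have hdiff := sub_mem (sub_mem hη hslant) hcylinder
  refine ⟨c⁻¹ • e₁, he, η - slant k (c⁻¹ • e₁) - cylinder k e₂ - ξ,
    ⟨sub_mem hdiff hξ', LinearMap.mem_ker.2 ?_⟩, ?_⟩
  · rw [map_sub, map_sub, map_sub, hξe₀, shiftDefect_slant he, map_smul, smul_inv_smul₀ hc,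
      shiftDefect_cylinder, map_add]
    abel
  · rw [extDeriv_sub_eq hdiff.1 hξ'.1, extDeriv_sub_eq (sub_mem hη hslant).1 hcylinder.1,
      extDeriv_sub_eq hη.1 hslant.1, extDeriv_cylinder,
      extDeriv_eq_zero_of_mem_exactPeriodicForms hξ, dsWedge_apply]
    abel

theorem exists_eq_cylinder_add_dsWedge_add_extDeriv (hc : c ≠ 0)
    (hB : ∀ m, B m ∈ Submodule.span ℤ (range b) ↔ m ∈ Submodule.span ℤ (range b))
    (hss : Disjoint (eigenforms B c k) (LinearMap.range (altDefect B c k)))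
    {σ : W × ℝ → (W × ℝ) [⋀^Fin (k + 1)]→L[ℝ] ℝ}
    (hσ : σ ∈ twistedForms (Submodule.span ℤ (range b)) B c (k + 1)) (hd : extDeriv σ = 0) :
    ∃ e ∈ eigenforms B c (k + 1), ∃ e' ∈ eigenforms B c k,
      ∃ θ ∈ twistedForms (Submodule.span ℤ (range b)) B c k,
        σ = cylinder (k + 1) e + dsWedge k e' + extDeriv θ := by
  obtain ⟨e, he, η, hη, hσe⟩ := exists_mem_eigenforms_sub_cylinder_mem_exactPeriodicForms
    (fun m hm ↦ (hB m).2 hm) hσ hd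
  have hclosed : extDeriv (shiftDefect B c k η) = 0 := by
    rw [extDeriv_shiftDefect c hη.1, hσe, map_sub, LinearMap.mem_ker.1 hσ.2, shiftDefect_cylinder,
      LinearMap.mem_ker.1 he, map_zero, sub_zero]
  obtain ⟨e', he', θ, hθ, hηθ⟩ := exists_extDeriv_eq_dsWedge_add_extDeriv hc hB hss hη hclosed
  refine ⟨e, he, e', he', θ, hθ, ?_⟩
  rw [add_assoc, ← hηθ, hσe, add_sub_cancel]

theorem eq_zero_of_extDeriv_sub_slant_eq_zero (hc : c ≠ 0)
    (hB : ∀ m ∈ Submodule.span ℤ (range b), B m ∈ Submodule.span ℤ (range b))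
    (hss : Disjoint (eigenforms B c k) (LinearMap.range (altDefect B c k)))
    {e : W [⋀^Fin k]→L[ℝ] ℝ} (he : e ∈ eigenforms B c k)
    {θ : W × ℝ → (W × ℝ) [⋀^Fin k]→L[ℝ] ℝ}
    (hθ : θ ∈ twistedForms (Submodule.span ℤ (range b)) B c k)
    (hd : extDeriv (θ - slant k e) = 0) : e = 0 := by
  obtain ⟨e₀, he₀⟩ := exists_sub_cylinder_mem_exactPeriodicForms b
    (sub_mem hθ.1 (slant_mem_periodicForms _ e)) hd
  have hexact := shiftDefect_mem_exactPeriodicForms hB c he₀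
  rw [map_sub, map_sub, LinearMap.mem_ker.1 hθ.2, shiftDefect_slant he, shiftDefect_cylinder,
    zero_sub, ← neg_add', neg_mem_iff, ← map_smul, ← map_add] at hexact
  have hrange : c • e ∈ LinearMap.range (altDefect B c k) :=
    ⟨-e₀, by
      rw [map_neg, eq_comm]
      exact eq_neg_of_add_eq_zero_left (eq_zero_of_cylinder_mem_exactPeriodicForms b hexact)⟩
  exact (smul_eq_zero.1 (Submodule.disjoint_def.1 hss _ (Submodule.smul_mem _ c he)
    hrange)).resolve_left hc

theorem eq_zero_of_cylinder_add_dsWedge_eq_extDeriv (hc : c ≠ 0)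
    (hB : ∀ m ∈ Submodule.span ℤ (range b), B m ∈ Submodule.span ℤ (range b))
    (hss : Disjoint (eigenforms B c k) (LinearMap.range (altDefect B c k)))
    {e : W [⋀^Fin (k + 1)]→L[ℝ] ℝ} {e' : W [⋀^Fin k]→L[ℝ] ℝ} (he' : e' ∈ eigenforms B c k)
    {θ : W × ℝ → (W × ℝ) [⋀^Fin k]→L[ℝ] ℝ}
    (hθ : θ ∈ twistedForms (Submodule.span ℤ (range b)) B c k)
    (h : cylinder (k + 1) e + dsWedge k e' = extDeriv θ) : e = 0 ∧ e' = 0 := by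
  have hslant := slant_mem_periodicForms (Submodule.span ℤ (range b)) e'
  have hprimitive : extDeriv (θ - slant k e') = cylinder (k + 1) e := by
    rw [extDeriv_sub_eq hθ.1.1 hslant.1, ← h, dsWedge_apply, add_sub_cancel_right]
  have he : e = 0 :=
    eq_zero_of_cylinder_mem_exactPeriodicForms b ⟨_, sub_mem hθ.1 hslant, hprimitive⟩
  refine ⟨he, eq_zero_of_extDeriv_sub_slant_eq_zero hc hB hss he' hθ ?_⟩
  rw [hprimitive, he, map_zero]

end Cohomology

section EigenEvaluation

variable {W : Type*} [NormedAddCommGroup W] [NormedSpace ℝ W]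

/-- The evaluation of alternating maps on the tuple `u` is an eigenvector for the eigenvalue `c₀` of
the transpose of `B^*`, and it detects the real eigenvectors of `B^*`. Thus `c₀` is the only real
eigenvalue of `B^*` in degree `k`, and it is simple. -/
structure IsEigenEvaluation (B : W ≃L[ℝ] W) {k : ℕ} (u : Fin k → W) (c₀ : ℝ) : Prop where
  apply_eq : ∀ e : W [⋀^Fin k]→L[ℝ] ℝ, altPullback B k e u = c₀ * e u
  eq_zero : ∀ (c : ℝ), ∀ e ∈ eigenforms B c k, e u = 0 → e = 0
  exists_ne_zero : ∃ e ∈ eigenforms B c₀ k, e u ≠ 0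

namespace IsEigenEvaluation

variable {B : W ≃L[ℝ] W} {k : ℕ} {u : Fin k → W} {c₀ c : ℝ}

theorem eigenforms_eq_bot (h : IsEigenEvaluation B u c₀) (hc : c ≠ c₀) :
    eigenforms B c k = ⊥ := by
  refine (Submodule.eq_bot_iff _).2 fun e he ↦ h.eq_zero c e he ?_
  have happly := congrArg (· u) (mem_eigenforms.1 he)
  simp only [h.apply_eq, ContinuousAlternatingMap.smul_apply, smul_eq_mul] at happly
  exact (mul_eq_mul_right_iff.1 happly).resolve_left hc.symm

theorem disjoint (h : IsEigenEvaluation B u c₀) (c : ℝ) :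
    Disjoint (eigenforms B c k) (LinearMap.range (altDefect B c k)) := by
  rcases ne_or_eq c c₀ with hc | rfl
  · rw [h.eigenforms_eq_bot hc]
    exact disjoint_bot_left
  · rw [Submodule.disjoint_def]
    rintro _ he ⟨e, rfl⟩
    refine h.eq_zero c _ he ?_
    rw [altDefect_apply, ContinuousAlternatingMap.sub_apply, h.apply_eq,
      ContinuousAlternatingMap.smul_apply, smul_eq_mul, sub_self]

theorem nonempty_equiv (h : IsEigenEvaluation B u c₀) :
    Nonempty (eigenforms B c₀ k ≃ₗ[ℝ] ℝ) := by
  let evaluation : eigenforms B c₀ k →ₗ[ℝ] ℝ :=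
    { toFun := fun e ↦ e.1 u
      map_add' := fun _ _ ↦ rfl
      map_smul' := fun _ _ ↦ rfl }
  have hinj : Function.Injective evaluation := fun e e' hee' ↦
    sub_eq_zero.1 (Subtype.ext (h.eq_zero c₀ _ (e - e').2 (sub_eq_zero.2 hee')))
  obtain ⟨e, he, hne⟩ := h.exists_ne_zero
  have hsurj : Function.Surjective evaluation :=
    LinearMap.surjective fun h₀ ↦ hne (LinearMap.congr_fun h₀ ⟨e, he⟩)
  exact ⟨.ofBijective evaluation ⟨hinj, hsurj⟩⟩

end IsEigenEvaluation

end EigenEvaluation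

section TopDegree

variable {W : Type*} [NormedAddCommGroup W] [NormedSpace ℝ W] {k : ℕ}

/-- The determinant in a basis as a continuous alternating map. -/
def detForm (b : Module.Basis (Fin k) ℝ W) : W [⋀^Fin k]→L[ℝ] ℝ where
  __ := b.det
  cont := by
    have := Module.Finite.of_basis b
    change Continuous fun v ↦ b.det v
    simp only [Module.Basis.det_apply]
    refine Continuous.matrix_det (continuous_matrix fun i j ↦ ?_)
    exact (b.coord i).continuous_of_finiteDimensional.comp (continuous_apply j)

theorem detForm_apply (b : Module.Basis (Fin k) ℝ W) (v : Fin k → W) :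
    detForm b v = b.det v := rfl

theorem apply_eq_mul_det (b : Module.Basis (Fin k) ℝ W) (e : W [⋀^Fin k]→L[ℝ] ℝ) (v : Fin k → W) :
    e v = e b * b.det v :=
  DFunLike.congr_fun (e.toAlternatingMap.eq_smul_basis_det b) v

theorem eq_zero_of_card_lt {n : ℕ} (b : Module.Basis (Fin n) ℝ W) (h : n < k)
    (e : W [⋀^Fin k]→L[ℝ] ℝ) : e = 0 := by
  refine ContinuousAlternatingMap.toAlternatingMap_injective
    (b.ext_alternating fun j hj ↦ absurd (Fintype.card_le_of_injective j hj) ?_)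
  simpa using h

theorem isEigenEvaluation_det (B : W ≃L[ℝ] W) (b : Module.Basis (Fin k) ℝ W) :
    IsEigenEvaluation B b (LinearMap.det (B : W →ₗ[ℝ] W)) where
  apply_eq e := by
    have hdet := b.det_comp (B : W →ₗ[ℝ] W) b
    rw [b.det_self, mul_one] at hdet
    exact (apply_eq_mul_det b e _).trans ((congrArg (e b * ·) hdet).trans (mul_comm _ _))
  eq_zero c e _ h := by
    ext v
    rw [apply_eq_mul_det b, h, zero_mul]
    rfl
  exists_ne_zero := by
    refine ⟨detForm b, mem_eigenforms.2 (ContinuousAlternatingMap.ext fun v ↦ ?_), ?_⟩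
    · exact b.det_comp (B : W →ₗ[ℝ] W) v
    · rw [detForm_apply, b.det_self]
      exact one_ne_zero

theorem isEigenEvaluation_zero (B : W ≃L[ℝ] W) : IsEigenEvaluation B (k := 0) ![] 1 where
  apply_eq e := by
    rw [one_mul]
    exact congrArg e (Subsingleton.elim _ _)
  eq_zero c e _ h := by
    ext v
    rw [Subsingleton.elim v ![], h]
    rfl
  exists_ne_zero := by
    refine ⟨.constOfIsEmpty ℝ W (Fin 0) 1, ?_, ?_⟩
    · rw [mem_eigenforms, one_smul]
      rfl
    · simp

theorem interiorProduct_altPullback (B : W ≃L[ℝ] W) (X : W) (e : W [⋀^Fin (k + 1)]→L[ℝ] ℝ) :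
    interiorProduct X (altPullback B (k + 1) e) = altPullback B k (interiorProduct (B X) e) :=
  ContinuousAlternatingMap.ext fun _ ↦
    congrArg e (funext <| Fin.cases rfl fun _ ↦ rfl)

theorem IsEigenEvaluation.of_retraction {U : Type*} [NormedAddCommGroup U] [NormedSpace ℝ U]
    {M : U ≃L[ℝ] U} {B : W ≃L[ℝ] W} {u : Fin k → U} {c₀ : ℝ} (h : IsEigenEvaluation M u c₀)
    {i : U →L[ℝ] W} {p : W →L[ℝ] U} (hpi : ∀ x, p (i x) = x) (hi : ∀ x, B (i x) = i (M x))
    (hp : ∀ w, p (B w) = M (p w))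
    (hinj : ∀ c, ∀ e ∈ eigenforms B c k, e.compContinuousLinearMap i = 0 → e = 0) :
    IsEigenEvaluation B (i ∘ u) c₀ := by
  have hpull (e : W [⋀^Fin k]→L[ℝ] ℝ) : (altPullback B k e).compContinuousLinearMap i =
      altPullback M k (e.compContinuousLinearMap i) :=
    ContinuousAlternatingMap.ext fun v ↦ congrArg e (funext fun j ↦ hi (v j))
  refine ⟨fun e ↦ ?_, fun c e he h₀ ↦ hinj c e he (h.eq_zero c _ ?_ h₀), ?_⟩
  · exact (DFunLike.congr_fun (hpull e) u).trans (h.apply_eq _)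
  · rw [mem_eigenforms, ← hpull, mem_eigenforms.1 he]
    rfl
  · obtain ⟨e, he, hne⟩ := h.exists_ne_zero
    refine ⟨e.compContinuousLinearMap p, mem_eigenforms.2 ?_, ?_⟩
    · ext v
      exact (congrArg e (funext fun j ↦ hp (v j))).trans
        (DFunLike.congr_fun (mem_eigenforms.1 he) (p ∘ v))
    · rwa [ContinuousAlternatingMap.compContinuousLinearMap_apply,
        show ⇑p ∘ ⇑i ∘ u = u from funext fun j ↦ hpi (u j)]

end TopDegree

end MappingTorus

namespace MorseNovikov

theorem apply_eq_zero_of_interiorProduct_eq_zero {E F : Type*} [NormedAddCommGroup E]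
    [NormedSpace ℝ E] [NormedAddCommGroup F] [NormedSpace ℝ F] {k : ℕ}
    {e : E [⋀^Fin (k + 1)]→L[ℝ] F} {X : E} (h : interiorProduct X e = 0) {v : Fin (k + 1) → E}
    {i : Fin (k + 1)} (hi : v i = X) : e v = 0 := by
  have hinsert := e.toAlternatingMap.map_insertNth i X (i.removeNth v)
  rw [← hi, Fin.insertNth_self_removeNth, hi] at hinsert
  refine hinsert.trans ?_
  rw [show e.toAlternatingMap (Matrix.vecCons X (i.removeNth v)) = 0 from
    DFunLike.congr_fun h (i.removeNth v), smul_zero]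

theorem eq_zero_of_map_mul_eq {f : ℂ →ₗ[ℝ] ℝ} {β : ℂ} (hβ : β.im ≠ 0) {c : ℝ}
    (h : ∀ z, f (β * z) = c * f z) : f = 0 := by
  have hne : β - c ≠ 0 := fun h₀ ↦ hβ (by simpa using congrArg Complex.im h₀)
  ext z
  have hz : f ((β - c) * ((β - c)⁻¹ * z)) = 0 := by
    rw [sub_mul, map_sub, h, ← Complex.real_smul, map_smul, smul_eq_mul, sub_self]
  rwa [mul_inv_cancel_left₀ hne] at hz

end MorseNovikov

namespace InoueData

open MappingTorus MorseNovikov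

variable (D : InoueData)

/-- The linear map `(z, x) ↦ (β z, α x)`, the monodromy of the fibration by tori. -/
def fiberMap : (ℂ × ℝ) ≃L[ℝ] (ℂ × ℝ) :=
  (ContinuousLinearEquiv.smulLeft (Units.mk0 D.β D.β_ne_zero)).prodCongr
    (ContinuousLinearEquiv.smulLeft (Units.mk0 D.α D.α_pos.ne'))

theorem fiberMap_apply (p : ℂ × ℝ) : D.fiberMap p = (D.β * p.1, D.α * p.2) := rfl

/-- The basis `(bᵢ, aᵢ)` of `ℂ × ℝ`. -/
def latticeBasis : Module.Basis (Fin 3) ℝ (ℂ × ℝ) :=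
  .ofEquivFun (D.periodMap.linearEquivOfInjective
    (LinearMap.ker_eq_bot.1 D.ker_periodMap) (by simp)).symm

theorem latticeBasis_apply (i : Fin 3) : D.latticeBasis i = (D.b i, D.a i) := by
  rw [latticeBasis, Module.Basis.coe_ofEquivFun]
  change D.periodMap (Pi.single i 1) = _
  simp [periodMap, Pi.single_apply, apply_ite ((↑) : ℝ → ℂ)]

/-- The lattice spanned by the vectors `(bᵢ, aᵢ)`. -/
abbrev lattice : Submodule ℤ (ℂ × ℝ) := Submodule.span ℤ (range D.latticeBasis)

theorem mem_lattice {p : ℂ × ℝ} : p ∈ D.lattice ↔ ∃ m : Fin 3 → ℤ,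
    p = (∑ i, (m i : ℂ) * D.b i, ∑ i, (m i : ℝ) * D.a i) := by
  rw [lattice, Submodule.mem_span_range_iff_exists_fun]
  refine exists_congr fun m ↦ ?_
  have hsum : ∑ i, m i • D.latticeBasis i =
      (∑ i, (m i : ℂ) * D.b i, ∑ i, (m i : ℝ) * D.a i) := by
    simp [latticeBasis_apply, Prod.ext_iff, Prod.fst_sum, Prod.snd_sum]
  rw [hsum, eq_comm]

theorem zpow_mul_mem_lattice (n : ℤ) {p : ℂ × ℝ} (hp : p ∈ D.lattice) :
    (D.β ^ n * p.1, D.α ^ n * p.2) ∈ D.lattice := by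
  obtain ⟨m, rfl⟩ := D.mem_lattice.1 hp
  obtain ⟨m', hb, ha⟩ := D.exists_zpow_mul_sum n m
  exact D.mem_lattice.2 ⟨m', Prod.ext hb ha⟩

theorem fiberMap_mem_lattice (p : ℂ × ℝ) : D.fiberMap p ∈ D.lattice ↔ p ∈ D.lattice := by
  constructor <;> intro hp
  · simpa [fiberMap_apply, D.β_ne_zero, D.α_pos.ne'] using D.zpow_mul_mem_lattice (-1) hp
  · simpa only [fiberMap_apply, zpow_one] using D.zpow_mul_mem_lattice 1 hp

theorem toMatrix_fiberMap : LinearMap.toMatrix D.latticeBasis D.latticeBasis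
    (D.fiberMap : (ℂ × ℝ) →ₗ[ℝ] (ℂ × ℝ)) =
      ((D.A : Matrix (Fin 3) (Fin 3) ℤ).map (Int.castRingHom ℝ)).transpose := by
  have happly (j : Fin 3) : (D.fiberMap : (ℂ × ℝ) →ₗ[ℝ] (ℂ × ℝ)) (D.latticeBasis j) =
      ∑ l, ((D.A : Matrix (Fin 3) (Fin 3) ℤ) j l : ℝ) • D.latticeBasis l := by
    have ha := congrFun D.mulVec_a j
    have hb := congrFun D.mulVec_b j
    simp only [Matrix.mulVec, dotProduct, Matrix.map_apply, Pi.smul_apply, smul_eq_mul] at ha hb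
    simp [fiberMap_apply, latticeBasis_apply, Prod.ext_iff, Prod.fst_sum, Prod.snd_sum, ha, hb]
  ext i j
  rw [LinearMap.toMatrix_apply, happly, map_sum]
  simp [Finsupp.single_apply]

theorem det_fiberMap : LinearMap.det (D.fiberMap : (ℂ × ℝ) →ₗ[ℝ] (ℂ × ℝ)) = 1 := by
  rw [← LinearMap.det_toMatrix D.latticeBasis, toMatrix_fiberMap, Matrix.det_transpose,
    ← RingHom.mapMatrix_apply, ← RingHom.map_det, D.A.2, map_one]

theorem normSq_β : Complex.normSq D.β = D.α⁻¹ := by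
  refine eq_inv_of_mul_eq_one_left ?_
  have hprod : (D.fiberMap : (ℂ × ℝ) →ₗ[ℝ] (ℂ × ℝ)) =
      (LinearMap.mul ℝ ℂ D.β).prodMap (LinearMap.mul ℝ ℝ D.α) := rfl
  have hβ : LinearMap.det (LinearMap.mul ℝ ℂ D.β) = Complex.normSq D.β :=
    Algebra.norm_complex_apply D.β
  have hα : LinearMap.det (LinearMap.mul ℝ ℝ D.α) = D.α := by simp
  rw [← D.det_fiberMap, hprod, LinearMap.det_prodMap, hβ, hα]

theorem eq_zero_of_comp_inr_eq_zero {c : ℝ} {e : (ℂ × ℝ) [⋀^Fin 1]→L[ℝ] ℝ}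
    (he : e ∈ eigenforms D.fiberMap c 1)
    (hinr : e.compContinuousLinearMap (.inr ℝ ℂ ℝ) = 0) : e = 0 := by
  obtain ⟨f, rfl⟩ := (ContinuousAlternatingMap.ofSubsingleton ℝ (ℂ × ℝ) ℝ (0 : Fin 1)).surjective e
  have hf (p : ℂ × ℝ) : f (D.fiberMap p) = c * f p :=
    DFunLike.congr_fun (mem_eigenforms.1 he) fun _ ↦ p
  have hsnd (x : ℝ) : f (0, x) = 0 := DFunLike.congr_fun hinr fun _ ↦ x
  have hfst : (f ∘L .inl ℝ ℂ ℝ : ℂ →ₗ[ℝ] ℝ) = 0 :=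
    eq_zero_of_map_mul_eq (c := c) D.β_im_ne_zero fun z ↦ by
      simpa [fiberMap_apply] using hf (z, 0)
  ext v
  change f (v 0) = 0
  rw [← Prod.fst_add_snd (v 0), map_add, hsnd, add_zero]
  exact LinearMap.congr_fun hfst (v 0).1

theorem interiorProduct_eq_zero_of_mem_eigenforms {c : ℝ} {e : (ℂ × ℝ) [⋀^Fin 2]→L[ℝ] ℝ}
    (he : e ∈ eigenforms D.fiberMap c 2) : interiorProduct ((0, 1) : ℂ × ℝ) e = 0 := by
  have hmap : D.fiberMap (0, 1) = D.α • (0, 1) := by simp [fiberMap_apply]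
  have hsmul : interiorProduct (D.α • ((0, 1) : ℂ × ℝ)) e = D.α • interiorProduct (0, 1) e :=
    map_smul e.curryLeft D.α (0, 1)
  refine D.eq_zero_of_comp_inr_eq_zero (c := D.α⁻¹ * c) (mem_eigenforms.2 ?_) ?_
  · have he' := congrArg (interiorProduct (0, 1)) (mem_eigenforms.1 he)
    rw [interiorProduct_altPullback, hmap, hsmul, map_smul, map_smul] at he'
    rw [mul_smul, ← he', inv_smul_smul₀ D.α_pos.ne']
  · ext
    exact e.map_eq_zero_of_eq _ (i := 0) (j := 1) rfl zero_ne_one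

theorem eq_zero_of_comp_inl_eq_zero {c : ℝ} {e : (ℂ × ℝ) [⋀^Fin 2]→L[ℝ] ℝ}
    (he : e ∈ eigenforms D.fiberMap c 2)
    (hinl : e.compContinuousLinearMap (.inl ℝ ℂ ℝ) = 0) : e = 0 := by
  refine ContinuousAlternatingMap.toAlternatingMap_injective
    ((Complex.basisOneI.prod (Module.Basis.singleton Unit ℝ)).ext_alternating fun j _ ↦ ?_)
  by_cases hj : ∃ i, j i = .inr ()
  · obtain ⟨i, hi⟩ := hj
    refine apply_eq_zero_of_interiorProduct_eq_zero
      (D.interiorProduct_eq_zero_of_mem_eigenforms he) (i := i) ?_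
    simp [hi]
  · have hleft (i : Fin 2) : ∃ l, j i = .inl l := by
      rcases hji : j i with l | ⟨⟩
      · exact ⟨l, rfl⟩
      · exact absurd ⟨i, hji⟩ hj
    choose l hl using hleft
    refine Eq.trans (congrArg e (funext fun i ↦ ?_))
      (DFunLike.congr_fun hinl (Complex.basisOneI ∘ l))
    simp [hl]

/-- The only real eigenvalue of `fiberMap` on the alternating maps of degree `k ≤ 3`. -/
def eigenvalue : ℕ → ℝ
  | 1 => D.α
  | 2 => D.α⁻¹
  | _ => 1

theorem isEigenEvaluation_one : IsEigenEvaluation D.fiberMap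
    (ContinuousLinearMap.inr ℝ ℂ ℝ ∘ Module.Basis.singleton (Fin 1) ℝ) D.α := by
  have hα := isEigenEvaluation_det
    (ContinuousLinearEquiv.smulLeft (Units.mk0 D.α D.α_pos.ne')) (Module.Basis.singleton (Fin 1) ℝ)
  have hdet : LinearMap.det (ContinuousLinearEquiv.smulLeft (R₁ := ℝ) (M₁ := ℝ)
      (Units.mk0 D.α D.α_pos.ne') : ℝ →ₗ[ℝ] ℝ) = D.α := by
    rw [LinearMap.det_ring]
    exact mul_one _
  rw [hdet] at hα
  exact hα.of_retraction (p := .snd ℝ ℂ ℝ) (fun _ ↦ rfl) (by simp [fiberMap]) (fun _ ↦ rfl)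
    fun c e ↦ D.eq_zero_of_comp_inr_eq_zero

theorem isEigenEvaluation_two : IsEigenEvaluation D.fiberMap
    (ContinuousLinearMap.inl ℝ ℂ ℝ ∘ Complex.basisOneI) D.α⁻¹ := by
  have hβ := isEigenEvaluation_det (ContinuousLinearEquiv.smulLeft (Units.mk0 D.β D.β_ne_zero))
    Complex.basisOneI
  have hdet : LinearMap.det (ContinuousLinearEquiv.smulLeft (R₁ := ℝ) (M₁ := ℂ)
      (Units.mk0 D.β D.β_ne_zero) : ℂ →ₗ[ℝ] ℂ) = D.α⁻¹ :=
    (Algebra.norm_complex_apply D.β).trans D.normSq_β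
  rw [hdet] at hβ
  exact hβ.of_retraction (p := .fst ℝ ℂ ℝ) (fun _ ↦ rfl) (by simp [fiberMap]) (fun _ ↦ rfl)
    fun c e ↦ D.eq_zero_of_comp_inl_eq_zero

theorem exists_isEigenEvaluation {k : ℕ} (hk : k ≤ 3) :
    ∃ u : Fin k → ℂ × ℝ, IsEigenEvaluation D.fiberMap u (D.eigenvalue k) :=
  match k, hk with
  | 0, _ => ⟨_, isEigenEvaluation_zero D.fiberMap⟩
  | 1, _ => ⟨_, D.isEigenEvaluation_one⟩
  | 2, _ => ⟨_, D.isEigenEvaluation_two⟩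
  | 3, _ => ⟨_, D.det_fiberMap ▸ isEigenEvaluation_det D.fiberMap D.latticeBasis⟩

theorem subsingleton_eigenforms {c : ℝ} {k : ℕ} (h : k ≤ 3 → c ≠ D.eigenvalue k) :
    Subsingleton (eigenforms D.fiberMap c k) := by
  rcases le_or_gt k 3 with hk | hk
  · obtain ⟨u, hu⟩ := D.exists_isEigenEvaluation hk
    rw [hu.eigenforms_eq_bot (h hk)]
    infer_instance
  · have hzero := eq_zero_of_card_lt D.latticeBasis hk
    exact ⟨fun e e' ↦ Subtype.ext ((hzero e).trans (hzero e').symm)⟩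

theorem disjoint_eigenforms (c : ℝ) (k : ℕ) :
    Disjoint (eigenforms D.fiberMap c k) (LinearMap.range (altDefect D.fiberMap c k)) := by
  rcases le_or_gt k 3 with hk | hk
  · obtain ⟨u, hu⟩ := D.exists_isEigenEvaluation hk
    exact hu.disjoint c
  · rw [Submodule.disjoint_def]
    exact fun e _ _ ↦ eq_zero_of_card_lt D.latticeBasis hk e

theorem nonempty_eigenforms_equiv {k : ℕ} (hk : k ≤ 3) :
    Nonempty (eigenforms D.fiberMap (D.eigenvalue k) k ≃ₗ[ℝ] ℝ) := by
  obtain ⟨u, hu⟩ := D.exists_isEigenEvaluation hk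
  exact hu.nonempty_equiv

end InoueData

namespace MappingTorus

open MorseNovikov

variable {W : Type*} [NormedAddCommGroup W] [NormedSpace ℝ W] {k : ℕ}

theorem shiftPullback_zpow_eq_self {B : W ≃L[ℝ] W} {σ : W × ℝ → (W × ℝ) [⋀^Fin k]→L[ℝ] ℝ}
    (hσ : shiftPullback B 1 k σ = σ) (n : ℤ) : shiftPullback (B ^ n) n k σ = σ := by
  have hinv : shiftPullback B⁻¹ (-1) k σ = σ := by
    conv_lhs => rw [← hσ]
    rw [shiftPullback_shiftPullback, mul_inv_cancel, add_neg_cancel]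
    exact affinePullback_id_zero σ
  induction n with
  | zero =>
    rw [zpow_zero, Int.cast_zero]
    exact affinePullback_id_zero σ
  | succ n ih =>
    rw [zpow_add_one, Int.cast_add, Int.cast_one, ← shiftPullback_shiftPullback, ih, hσ]
  | pred n ih =>
    rw [zpow_sub_one, Int.cast_sub, Int.cast_one, sub_eq_add_neg (_ : ℝ) 1,
      ← shiftPullback_shiftPullback, ih, hinv]

end MappingTorus

namespace InoueData

open MorseNovikov MappingTorus

variable (D : InoueData)

/-- The diffeomorphism `((z, x), s) ↦ (z, x + i α ^ s)` from `(ℂ × ℝ) × ℝ` onto `ℂ × ℍ ⊆ ℂ × ℂ`. -/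
def expCoord (v : (ℂ × ℝ) × ℝ) : ℂ × ℂ :=
  (v.1.1, v.1.2 + ((D.α ^ v.2 : ℝ) : ℂ) * Complex.I)

/-- The inverse of `expCoord` on `ℂ × ℍ`. -/
def logCoord (u : ℂ × ℂ) : (ℂ × ℝ) × ℝ :=
  ((u.1, u.2.re), Real.logb D.α u.2.im)

theorem expCoord_im (v : (ℂ × ℝ) × ℝ) : (D.expCoord v).2.im = D.α ^ v.2 := by
  simp [expCoord]

theorem expCoord_im_pos (v : (ℂ × ℝ) × ℝ) : 0 < (D.expCoord v).2.im := by
  rw [expCoord_im]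
  exact Real.rpow_pos_of_pos D.α_pos _

theorem logCoord_expCoord (v : (ℂ × ℝ) × ℝ) : D.logCoord (D.expCoord v) = v := by
  refine Prod.ext (Prod.ext rfl ?_) ?_
  · simp [logCoord, expCoord]
  · rw [logCoord, expCoord_im, Real.logb_rpow D.α_pos D.one_lt_α.ne']

theorem expCoord_logCoord {u : ℂ × ℂ} (hu : 0 < u.2.im) : D.expCoord (D.logCoord u) = u := by
  refine Prod.ext rfl (Complex.ext ?_ ?_)
  · simp [logCoord, expCoord]
  · rw [expCoord_im]
    exact Real.rpow_logb D.α_pos D.one_lt_α.ne' hu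

theorem contDiff_expCoord : ContDiff ℝ ∞ D.expCoord := by
  have hpow : ContDiff ℝ ∞ fun v : (ℂ × ℝ) × ℝ ↦ D.α ^ v.2 :=
    contDiff_const.rpow contDiff_snd fun _ ↦ D.α_pos.ne'
  exact (contDiff_fst.comp contDiff_fst).prodMk
    ((Complex.ofRealCLM.contDiff.comp (contDiff_snd.comp contDiff_fst)).add
      ((Complex.ofRealCLM.contDiff.comp hpow).mul contDiff_const))

theorem contDiffAt_logCoord {u : ℂ × ℂ} (hu : 0 < u.2.im) : ContDiffAt ℝ ∞ D.logCoord u := by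
  have him : ContDiffAt ℝ ∞ (fun u : ℂ × ℂ ↦ u.2.im) u :=
    (Complex.imCLM.contDiff.comp contDiff_snd).contDiffAt
  exact (contDiffAt_fst.prodMk (Complex.reCLM.contDiff.comp contDiff_snd).contDiffAt).prodMk
    ((him.log hu.ne').div_const _)

theorem fderiv_logCoord_comp_fderiv_expCoord (v : (ℂ × ℝ) × ℝ) :
    fderiv ℝ D.logCoord (D.expCoord v) ∘L fderiv ℝ D.expCoord v = .id ℝ _ := by
  rw [← fderiv_comp v ((D.contDiffAt_logCoord (D.expCoord_im_pos v)).differentiableAt (by simp))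
    (D.contDiff_expCoord.differentiable (by simp) v),
    show D.logCoord ∘ D.expCoord = id from funext D.logCoord_expCoord, fderiv_id]

/-- The universal covering `(ℂ × ℝ) × ℝ → S⁰`, `((z, x), s) ↦ [z, x + i α ^ s]`. -/
def cover (v : (ℂ × ℝ) × ℝ) : D.Surface :=
  Quotient.mk (MulAction.orbitRel D.group (ℂ × ℍ)) (v.1.1, ⟨(D.expCoord v).2, D.expCoord_im_pos v⟩)

theorem mk_smul (g : D.group) (p : ℂ × ℍ) :
    Quotient.mk (MulAction.orbitRel D.group (ℂ × ℍ)) ((g : Equiv.Perm (ℂ × ℍ)) p) =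
      Quotient.mk _ p :=
  Quotient.sound (s := MulAction.orbitRel D.group (ℂ × ℍ)) ⟨g, rfl⟩

theorem mk_eq_cover (p : ℂ × ℍ) :
    Quotient.mk (MulAction.orbitRel D.group (ℂ × ℍ)) p = D.cover (D.logCoord (p.1, p.2)) := by
  refine congrArg (Quotient.mk _) (Prod.ext rfl (UpperHalfPlane.ext ?_))
  exact (congrArg Prod.snd (D.expCoord_logCoord (u := (p.1, (p.2 : ℂ))) p.2.im_pos)).symm

theorem cover_fiberMap (p : ℂ × ℝ) (s : ℝ) :
    D.cover (D.fiberMap p, s + 1) = D.cover (p, s) := by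
  refine Eq.trans ?_ (D.mk_smul ⟨D.scaling, Subgroup.subset_closure (mem_insert _ _)⟩ _)
  refine congrArg (Quotient.mk _) (Prod.ext rfl (UpperHalfPlane.ext ?_))
  change (D.expCoord _).2 = (D.α : ℂ) * (D.expCoord (p, s)).2
  simp only [expCoord, fiberMap_apply, Real.rpow_add_one D.α_pos.ne']
  push_cast
  ring

theorem cover_fiberMap_zpow (n : ℤ) (p : ℂ × ℝ) (s : ℝ) :
    D.cover ((D.fiberMap ^ n) p, s + n) = D.cover (p, s) := by
  induction n generalizing p s with
  | zero =>
    rw [Int.cast_zero, add_zero]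
    rfl
  | succ n ih =>
    rw [zpow_add_one, Int.cast_add, Int.cast_one, add_comm (_ : ℝ) 1, ← add_assoc]
    exact (ih (D.fiberMap p) (s + 1)).trans (D.cover_fiberMap p s)
  | pred n ih =>
    rw [zpow_sub_one, Int.cast_sub, Int.cast_one, sub_eq_neg_add (_ : ℝ) 1, ← add_assoc]
    refine (ih (D.fiberMap⁻¹ p) (s + -1)).trans ?_
    rw [← cover_fiberMap, neg_add_cancel_right]
    exact congrArg (fun q ↦ D.cover (q, s)) (D.fiberMap.apply_symm_apply p)

theorem cover_add_lattice {m : ℂ × ℝ} (hm : m ∈ D.lattice) (v : (ℂ × ℝ) × ℝ) :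
    D.cover (v + (m, 0)) = D.cover v := by
  rw [lattice, ← Submodule.mem_toAddSubgroup, Submodule.span_int_eq_addSubgroupClosure] at hm
  induction hm using AddSubgroup.closure_induction generalizing v with
  | mem m hm =>
    obtain ⟨i, rfl⟩ := hm
    rw [latticeBasis_apply]
    refine Eq.trans ?_ (D.mk_smul ⟨D.translation i, Subgroup.subset_closure (Or.inr ⟨i, rfl⟩)⟩ _)
    refine congrArg (Quotient.mk _) (Prod.ext rfl (UpperHalfPlane.ext ?_))
    change (D.expCoord _).2 = (D.a i : ℂ) + (D.expCoord v).2
    simp only [expCoord, Prod.fst_add, Prod.snd_add, add_zero]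
    push_cast
    ring
  | zero => rw [Prod.mk_zero_zero, add_zero]
  | add m m' _ _ hm hm' =>
    rw [← hm v, ← hm' (v + (m, 0)), add_assoc, Prod.mk_add_mk m, add_zero]
  | neg m _ hm =>
    rw [← hm (v + (-m, 0)), add_assoc, Prod.mk_add_mk (-m), neg_add_cancel, add_zero,
      Prod.mk_zero_zero, add_zero]

theorem fiberMap_zpow_apply (n : ℤ) (p : ℂ × ℝ) :
    (D.fiberMap ^ n) p = (D.β ^ n * p.1, D.α ^ n * p.2) := by
  induction n generalizing p with
  | zero =>
    simp only [zpow_zero, one_mul]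
    rfl
  | succ n ih =>
    rw [zpow_add_one, zpow_add_one₀ D.β_ne_zero, zpow_add_one₀ D.α_pos.ne', mul_assoc, mul_assoc]
    exact ih (D.fiberMap p)
  | pred n ih =>
    rw [zpow_sub_one, zpow_sub_one₀ D.β_ne_zero, zpow_sub_one₀ D.α_pos.ne', mul_assoc, mul_assoc]
    exact ih (D.fiberMap⁻¹ p)

theorem exists_of_cover_eq {v v' : (ℂ × ℝ) × ℝ} (h : D.cover v' = D.cover v) :
    ∃ n : ℤ, ∃ m ∈ D.lattice, v' = ((D.fiberMap ^ n) v.1 + m, v.2 + n) := by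
  obtain ⟨g, hg⟩ := Quotient.exact (s := MulAction.orbitRel D.group (ℂ × ℍ)) h
  obtain ⟨n, m, hnm⟩ := D.exists_isNormalForm g.2
  obtain ⟨hz, hw⟩ := hnm (v.1.1, ⟨(D.expCoord v).2, D.expCoord_im_pos v⟩)
  replace hg : (g : Equiv.Perm (ℂ × ℍ)) (v.1.1, ⟨(D.expCoord v).2, D.expCoord_im_pos v⟩) =
    (v'.1.1, ⟨(D.expCoord v').2, D.expCoord_im_pos v'⟩) := hg
  rw [hg] at hz hw
  replace hw : (D.expCoord v').2 = ((D.α ^ n : ℝ) : ℂ) * (D.expCoord v).2 +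
    ((∑ i, (m i : ℝ) * D.a i : ℝ) : ℂ) := hw
  refine ⟨n, _, D.mem_lattice.2 ⟨m, rfl⟩, ?_⟩
  rw [fiberMap_zpow_apply]
  refine Prod.ext (Prod.ext hz ?_) ?_
  · have hre := congrArg Complex.re hw
    rw [Complex.add_re, Complex.re_ofReal_mul, Complex.ofReal_re] at hre
    simpa [expCoord] using hre
  · have him := congrArg Complex.im hw
    rw [Complex.add_im, Complex.im_ofReal_mul, Complex.ofReal_im, add_zero, expCoord_im,
      expCoord_im, ← Real.rpow_intCast, ← Real.rpow_add D.α_pos] at him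
    change v'.2 = v.2 + n
    rw [add_comm, ← Real.logb_rpow D.α_pos D.one_lt_α.ne' (x := v'.2), him,
      Real.logb_rpow D.α_pos D.one_lt_α.ne']

theorem exists_deck_of_cover_eq {v v' : (ℂ × ℝ) × ℝ} (h : D.cover v' = D.cover v) :
    ∃ (A : (ℂ × ℝ) × ℝ →L[ℝ] (ℂ × ℝ) × ℝ) (a : (ℂ × ℝ) × ℝ),
      (∀ w, D.cover (A w + a) = D.cover w) ∧
      (∀ k, ∀ τ ∈ twistedForms D.lattice D.fiberMap 1 k, affinePullback A a k τ = τ) ∧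
      v' = A v + a := by
  obtain ⟨n, m, hm, rfl⟩ := D.exists_of_cover_eq h
  refine ⟨(D.fiberMap ^ n).prodCongr (.refl ℝ ℝ), (m, n), fun w ↦ ?_, fun k τ hτ ↦ ?_, rfl⟩
  · rw [← D.cover_fiberMap_zpow n w.1 w.2,
      ← D.cover_add_lattice hm ((D.fiberMap ^ n) w.1, w.2 + n)]
    exact congrArg D.cover (Prod.ext rfl (add_zero _).symm)
  · obtain ⟨hper, hshift⟩ := mem_twistedForms.1 hτ
    rw [one_smul] at hshift
    refine Eq.trans (funext fun w ↦ ?_) (shiftPullback_zpow_eq_self hshift n)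
    rw [shiftPullback, affinePullback_apply, affinePullback_apply,
      ← hper.2 m hm (_ + (0, (n : ℝ))), add_assoc, Prod.mk_add_mk 0, zero_add, add_zero]

theorem chart_symm_eq {x : D.Surface} {u : ℂ × ℂ} (hu : u ∈ (extChartAt model x).target) :
    0 < u.2.im ∧ (extChartAt model x).symm u = D.cover (D.logCoord u) := by
  have hq := D.isLocalHomeomorph_mk
  set p := (Quotient.mk_surjective (s := MulAction.orbitRel D.group
    (ℂ × ℍ))).hasRightInverse.choose x
  set e := chartAt (ModelProd ℂ ℂ) p
  rw [extChartAt_target] at hu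
  have hlocal : u ∈ ((hq.localInverseAt p).trans e).target := hu.1
  have heu : (((e.symm u).1, ((e.symm u).2 : ℂ)) : ℂ × ℂ) = u := e.right_inv hlocal.1
  constructor
  · rw [← heu]
    exact (e.symm u).2.im_pos
  · change (hq.localInverseAt p).symm (e.symm u) = _
    rw [hq.localInverseAt_symm, mk_eq_cover, heu]

/-- The point of the universal covering that corresponds to the center of the chart around `x`. -/
def basePoint (x : D.Surface) : (ℂ × ℝ) × ℝ :=
  D.logCoord (extChartAt model x x)

theorem cover_basePoint (x : D.Surface) : D.cover (D.basePoint x) = x := by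
  rw [basePoint, ← (D.chart_symm_eq (mem_extChartAt_target x)).2, extChartAt_to_inv]

theorem expCoord_basePoint (x : D.Surface) : D.expCoord (D.basePoint x) = extChartAt model x x :=
  D.expCoord_logCoord (D.chart_symm_eq (mem_extChartAt_target x)).1

theorem eventually_expCoord_mem_target (x : D.Surface) :
    ∀ᶠ v in 𝓝 (D.basePoint x), D.expCoord v ∈ (extChartAt model x).target := by
  refine D.contDiff_expCoord.continuous.continuousAt.eventually_mem
    ((isOpen_extChartAt_target x).mem_nhds ?_)
  rw [expCoord_basePoint]
  exact mem_extChartAt_target x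

theorem cover_eq_chart_symm {x : D.Surface} {v : (ℂ × ℝ) × ℝ}
    (hv : D.expCoord v ∈ (extChartAt model x).target) :
    D.cover v = (extChartAt model x).symm (D.expCoord v) := by
  rw [(D.chart_symm_eq hv).2, logCoord_expCoord]

theorem mdifferentiableAt_cover_basePoint (x : D.Surface) :
    MDifferentiableAt 𝓘(ℝ, (ℂ × ℝ) × ℝ) model D.cover (D.basePoint x) := by
  have hexp : MDifferentiableAt 𝓘(ℝ, (ℂ × ℝ) × ℝ) 𝓘(ℝ, ℂ × ℂ) D.expCoord (D.basePoint x) :=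
    (D.contDiff_expCoord.differentiable (by simp) _).mdifferentiableAt
  have hsymm := mdifferentiableWithinAt_extChartAt_symm (I := model)
    (D.eventually_expCoord_mem_target x).self_of_nhds
  rw [ModelWithCorners.range_eq_univ, mdifferentiableWithinAt_univ] at hsymm
  refine (hsymm.comp _ hexp).congr_of_eventuallyEq ?_
  filter_upwards [D.eventually_expCoord_mem_target x] with w hw using D.cover_eq_chart_symm hw

theorem mdifferentiableAt_cover (v : (ℂ × ℝ) × ℝ) :
    MDifferentiableAt 𝓘(ℝ, (ℂ × ℝ) × ℝ) model D.cover v := by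
  obtain ⟨A, a, hcover, -, hv⟩ := D.exists_deck_of_cover_eq (D.cover_basePoint (D.cover v))
  rw [show D.cover = D.cover ∘ fun w ↦ A w + a from funext fun w ↦ (hcover w).symm]
  have hdiff : DifferentiableAt ℝ (fun w ↦ A w + a) v := by fun_prop
  exact MDifferentiableAt.comp v (hv ▸ D.mdifferentiableAt_cover_basePoint _)
    hdiff.mdifferentiableAt

variable {k : ℕ}

/-- The derivative of `cover`. -/
def coverDeriv (v : (ℂ × ℝ) × ℝ) : (ℂ × ℝ) × ℝ →L[ℝ] ℂ × ℂ :=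
  mfderiv 𝓘(ℝ, (ℂ × ℝ) × ℝ) model D.cover v

/-- The derivative of the chart around `x` at `x`. -/
def chartDeriv (x : D.Surface) : ℂ × ℂ →L[ℝ] ℂ × ℂ :=
  mfderiv model 𝓘(ℝ, ℂ × ℂ) (extChartAt model x) x

/-- The pullback of a form on the surface by `cover`. -/
def lift (k : ℕ) : FormField model D.Surface k →ₗ[ℝ]
    ((ℂ × ℝ) × ℝ → ((ℂ × ℝ) × ℝ) [⋀^Fin k]→L[ℝ] ℝ) where
  toFun σ v := ContinuousAlternatingMap.compContinuousLinearMap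
    (σ (D.cover v) : (ℂ × ℂ) [⋀^Fin k]→L[ℝ] ℝ) (D.coverDeriv v)
  map_add' _ _ := rfl
  map_smul' _ _ := rfl

theorem lift_apply (σ : FormField model D.Surface k) (v : (ℂ × ℝ) × ℝ) :
    D.lift k σ v = ContinuousAlternatingMap.compContinuousLinearMap
      (σ (D.cover v) : (ℂ × ℂ) [⋀^Fin k]→L[ℝ] ℝ) (D.coverDeriv v) := rfl

-- Tangent spaces at different points are different types, so `rw` cannot move the base point.
theorem comp_congr (σ : FormField model D.Surface k) {x y : D.Surface} (h : x = y)
    {E : Type*} [NormedAddCommGroup E] [NormedSpace ℝ E] (T : E →L[ℝ] ℂ × ℂ) :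
    ContinuousAlternatingMap.compContinuousLinearMap (σ x : (ℂ × ℂ) [⋀^Fin k]→L[ℝ] ℝ) T =
      ContinuousAlternatingMap.compContinuousLinearMap (σ y : (ℂ × ℂ) [⋀^Fin k]→L[ℝ] ℝ) T := by
  subst h
  rfl

variable {D} in
theorem coverDeriv_comp {A : (ℂ × ℝ) × ℝ →L[ℝ] (ℂ × ℝ) × ℝ} {a : (ℂ × ℝ) × ℝ}
    (hA : ∀ w, D.cover (A w + a) = D.cover w) (v : (ℂ × ℝ) × ℝ) :
    (D.coverDeriv (A v + a)).comp A = D.coverDeriv v := by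
  have hderiv := HasMFDerivAt.comp v (D.mdifferentiableAt_cover (A v + a)).hasMFDerivAt
    (A.hasFDerivAt.add_const a).hasMFDerivAt
  rw [show D.cover ∘ (fun v ↦ A v + a) = D.cover from funext hA] at hderiv
  exact hderiv.mfderiv.symm

variable {D} in
theorem affinePullback_lift {A : (ℂ × ℝ) × ℝ →L[ℝ] (ℂ × ℝ) × ℝ} {a : (ℂ × ℝ) × ℝ}
    (hA : ∀ w, D.cover (A w + a) = D.cover w) (σ : FormField model D.Surface k) :
    affinePullback A a k (D.lift k σ) = D.lift k σ := by
  funext v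
  rw [affinePullback_apply, lift_apply, lift_apply, ← coverDeriv_comp hA v, D.comp_congr σ (hA v)]
  rfl

theorem shiftPullback_lift (σ : FormField model D.Surface k) :
    shiftPullback D.fiberMap 1 k (D.lift k σ) = D.lift k σ := by
  refine affinePullback_lift (fun w ↦ ?_) σ
  rw [← D.cover_fiberMap w.1 w.2]
  exact congrArg D.cover (Prod.ext (add_zero _) rfl)

theorem lift_add_lattice (σ : FormField model D.Surface k) {m : ℂ × ℝ}
    (hm : m ∈ D.lattice) (v : (ℂ × ℝ) × ℝ) : D.lift k σ (v + (m, 0)) = D.lift k σ v :=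
  congrFun (affinePullback_lift (A := .id ℝ _) (D.cover_add_lattice hm) σ) v

theorem chartDeriv_comp_coverDeriv (x : D.Surface) :
    (D.chartDeriv x).comp (D.coverDeriv (D.basePoint x)) = fderiv ℝ D.expCoord (D.basePoint x) := by
  have hchart : MDifferentiableAt model 𝓘(ℝ, ℂ × ℂ) (extChartAt model x)
      (D.cover (D.basePoint x)) := by
    rw [cover_basePoint]
    exact mdifferentiableAt_extChartAt (mem_chart_source _ x)
  have hcomp := HasMFDerivAt.comp _ hchart.hasMFDerivAt
    (D.mdifferentiableAt_cover (D.basePoint x)).hasMFDerivAt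
  have heq : extChartAt model x ∘ D.cover =ᶠ[𝓝 (D.basePoint x)] D.expCoord := by
    filter_upwards [D.eventually_expCoord_mem_target x] with v hv
    rw [Function.comp_apply, D.cover_eq_chart_symm hv, (extChartAt model x).right_inv hv]
  let chartDerivAt (y : D.Surface) : ℂ × ℂ →L[ℝ] ℂ × ℂ :=
    mfderiv model 𝓘(ℝ, ℂ × ℂ) (extChartAt model x) y
  have hexp : HasFDerivAt D.expCoord ((chartDerivAt (D.cover (D.basePoint x))).comp
      (D.coverDeriv (D.basePoint x))) (D.basePoint x) :=
    hasMFDerivAt_iff_hasFDerivAt.1 (hcomp.congr_of_eventuallyEq heq.symm)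
  rw [hexp.fderiv, cover_basePoint]
  rfl

theorem mfderivWithin_chart_symm {x : D.Surface} {u : ℂ × ℂ}
    (hu : u ∈ (extChartAt model x).target) :
    (mfderivWithin 𝓘(ℝ, ℂ × ℂ) model (extChartAt model x).symm (range model) u :
      ℂ × ℂ →L[ℝ] ℂ × ℂ) = (D.coverDeriv (D.logCoord u)).comp (fderiv ℝ D.logCoord u) := by
  rw [ModelWithCorners.range_eq_univ, mfderivWithin_univ]
  have hlog := ((D.contDiffAt_logCoord (D.chart_symm_eq hu).1).differentiableAt
    (by simp)).hasFDerivAt.hasMFDerivAt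
  have hcomp := HasMFDerivAt.comp u (D.mdifferentiableAt_cover (D.logCoord u)).hasMFDerivAt hlog
  refine (hcomp.congr_of_eventuallyEq ?_).mfderiv
  filter_upwards [(isOpen_extChartAt_target x).mem_nhds hu] with w hw using (D.chart_symm_eq hw).2

theorem inChart_eq (σ : FormField model D.Surface k) {x : D.Surface} {u : ℂ × ℂ}
    (hu : u ∈ (extChartAt model x).target) :
    σ.inChart x u =
      (D.lift k σ (D.logCoord u)).compContinuousLinearMap (fderiv ℝ D.logCoord u) :=
  (congrArg (ContinuousAlternatingMap.compContinuousLinearMap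
    (σ ((extChartAt model x).symm u) : (ℂ × ℂ) [⋀^Fin k]→L[ℝ] ℝ))
      (D.mfderivWithin_chart_symm hu)).trans
    (D.comp_congr σ (D.chart_symm_eq hu).2
      ((D.coverDeriv (D.logCoord u)).comp (fderiv ℝ D.logCoord u)))

theorem lift_eq_inChart (σ : FormField model D.Surface k) {x : D.Surface}
    {v : (ℂ × ℝ) × ℝ} (hv : D.expCoord v ∈ (extChartAt model x).target) :
    D.lift k σ v =
      (σ.inChart x (D.expCoord v)).compContinuousLinearMap (fderiv ℝ D.expCoord v) := by
  rw [D.inChart_eq σ hv, logCoord_expCoord]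
  ext w
  exact congrArg (D.lift k σ v) (funext fun i ↦
    (congrArg (fun T ↦ T (w i)) (D.fderiv_logCoord_comp_fderiv_expCoord v)).symm)

theorem apply_eq_inChart (σ : FormField model D.Surface k) (x : D.Surface) :
    (σ x : (ℂ × ℂ) [⋀^Fin k]→L[ℝ] ℝ) =
      (σ.inChart x (extChartAt model x x)).compContinuousLinearMap (D.chartDeriv x) := by
  let symmDeriv : ℂ × ℂ →L[ℝ] ℂ × ℂ :=
    mfderivWithin 𝓘(ℝ, ℂ × ℂ) model (extChartAt model x).symm (range model) (extChartAt model x x)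
  have hinv : symmDeriv.comp (D.chartDeriv x) = .id ℝ (ℂ × ℂ) :=
    mfderivWithin_extChartAt_symm_comp_mfderiv_extChartAt' (I := model)
      (mem_extChartAt_source (I := model) x)
  refine Eq.trans ?_ (D.comp_congr σ (extChartAt_to_inv (I := model) x)
    (symmDeriv.comp (D.chartDeriv x))).symm
  rw [hinv]
  rfl

theorem lift_injective (k : ℕ) : Function.Injective (D.lift k) := by
  refine fun σ τ h ↦ funext fun x ↦ ?_
  refine (D.apply_eq_inChart σ x).trans (Eq.trans ?_ (D.apply_eq_inChart τ x).symm)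
  rw [D.inChart_eq σ (mem_extChartAt_target x), D.inChart_eq τ (mem_extChartAt_target x), h]

theorem contDiffAt_inChart_basePoint {σ : FormField model D.Surface k}
    (hσ : σ ∈ smoothForms model D.Surface k) (x : D.Surface) :
    ContDiffAt ℝ ∞ (σ.inChart x) (D.expCoord (D.basePoint x)) :=
  (hσ x).contDiffAt ((isOpen_extChartAt_target x).mem_nhds
    (D.eventually_expCoord_mem_target x).self_of_nhds)

theorem eventuallyEq_lift_basePoint (σ : FormField model D.Surface k) (x : D.Surface) :
    D.lift k σ =ᶠ[𝓝 (D.basePoint x)] fun v ↦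
      (σ.inChart x (D.expCoord v)).compContinuousLinearMap (fderiv ℝ D.expCoord v) := by
  filter_upwards [D.eventually_expCoord_mem_target x] with v hv using D.lift_eq_inChart σ hv

theorem contDiff_lift {σ : FormField model D.Surface k}
    (hσ : σ ∈ smoothForms model D.Surface k) : ContDiff ℝ ∞ (D.lift k σ) := by
  rw [contDiff_iff_contDiffAt]
  have hbase (x : D.Surface) : ContDiffAt ℝ ∞ (D.lift k σ) (D.basePoint x) :=
    (contDiffAt_compContinuousLinearMap
      ((D.contDiffAt_inChart_basePoint hσ x).comp _ D.contDiff_expCoord.contDiffAt)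
      (D.contDiff_expCoord.contDiffAt.fderiv_right (m := ∞) (by simp))).congr_of_eventuallyEq
      (D.eventuallyEq_lift_basePoint σ x)
  intro v
  obtain ⟨A, a, hA, -, hv⟩ := D.exists_deck_of_cover_eq (D.cover_basePoint (D.cover v))
  rw [← affinePullback_lift hA σ]
  have haffine : ContDiffAt ℝ ∞ (fun v ↦ A v + a) v := by fun_prop
  exact contDiffAt_compContinuousLinearMap (ContDiffAt.comp v (hv ▸ hbase _) haffine)
    contDiffAt_const

theorem mem_smoothForms_of_contDiff_lift {σ : FormField model D.Surface k}
    (hσ : ContDiff ℝ ∞ (D.lift k σ)) : σ ∈ smoothForms model D.Surface k := by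
  intro x
  refine ContDiffOn.congr (fun u hu ↦ ?_) fun u hu ↦ D.inChart_eq σ hu
  have hlog := D.contDiffAt_logCoord (D.chart_symm_eq hu).1
  exact (contDiffAt_compContinuousLinearMap (hσ.contDiffAt.comp u hlog)
    (hlog.fderiv_right (m := ∞) (by simp))).contDiffWithinAt

theorem lift_mem_twistedForms {σ : FormField model D.Surface k}
    (hσ : σ ∈ smoothForms model D.Surface k) :
    D.lift k σ ∈ twistedForms D.lattice D.fiberMap 1 k :=
  mem_twistedForms.2 ⟨⟨D.contDiff_lift hσ, fun _ hm v ↦ D.lift_add_lattice σ hm v⟩, by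
    rw [one_smul, shiftPullback_lift]⟩

theorem lift_eq_of_basePoint {σ : FormField model D.Surface k}
    {τ : (ℂ × ℝ) × ℝ → ((ℂ × ℝ) × ℝ) [⋀^Fin k]→L[ℝ] ℝ}
    (hτ : τ ∈ twistedForms D.lattice D.fiberMap 1 k)
    (h : ∀ x, D.lift k σ (D.basePoint x) = τ (D.basePoint x)) : D.lift k σ = τ := by
  funext v
  obtain ⟨A, a, hA, hpull, hv⟩ := D.exists_deck_of_cover_eq (D.cover_basePoint (D.cover v))
  rw [← affinePullback_lift hA σ, ← hpull k τ hτ, affinePullback_apply, affinePullback_apply, ← hv,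
    h]

theorem lift_d {σ : FormField model D.Surface k}
    (hσ : σ ∈ smoothForms model D.Surface k) : D.lift (k + 1) σ.d = extDeriv (D.lift k σ) := by
  refine D.lift_eq_of_basePoint (extDeriv_mem_twistedForms (D.lift_mem_twistedForms hσ)) fun x ↦ ?_
  have hpull := extDeriv_pullback (r := ∞)
    ((D.contDiffAt_inChart_basePoint hσ x).differentiableAt (by simp))
    D.contDiff_expCoord.contDiffAt (by simpa using WithTop.coe_le_coe.2 (le_top : (2 : ℕ∞) ≤ ⊤))
  rw [(D.eventuallyEq_lift_basePoint σ x).extDeriv_eq, hpull, lift_apply,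
    D.comp_congr σ.d (D.cover_basePoint x), ← chartDeriv_comp_coverDeriv, expCoord_basePoint,
    ← extDerivWithin_univ, ← ModelWithCorners.range_eq_univ model]
  rfl

theorem exists_lift_eq {τ : (ℂ × ℝ) × ℝ → ((ℂ × ℝ) × ℝ) [⋀^Fin k]→L[ℝ] ℝ}
    (hτ : τ ∈ twistedForms D.lattice D.fiberMap 1 k) :
    ∃ σ ∈ smoothForms model D.Surface k, D.lift k σ = τ := by
  let σ : FormField model D.Surface k := fun x ↦
    (τ (D.basePoint x)).compContinuousLinearMap
      ((fderiv ℝ D.logCoord (extChartAt model x x)).comp (D.chartDeriv x))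
  have hlift : D.lift k σ = τ := by
    refine D.lift_eq_of_basePoint hτ fun x ↦ ?_
    rw [lift_apply, D.comp_congr σ (D.cover_basePoint x)]
    have hinv := D.fderiv_logCoord_comp_fderiv_expCoord (D.basePoint x)
    rw [← chartDeriv_comp_coverDeriv, expCoord_basePoint] at hinv
    ext w
    exact congrArg (τ (D.basePoint x)) (funext fun i ↦ congrArg (fun T ↦ T (w i)) hinv)
  exact ⟨σ, D.mem_smoothForms_of_contDiff_lift (hlift ▸ hτ.1.1), hlift⟩

theorem lift_wedge (η : FormField model D.Surface 1) (σ : FormField model D.Surface k)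
    (v : (ℂ × ℝ) × ℝ) : D.lift (k + 1) (η.wedge σ) v = wedgeOne (D.lift 1 η v) (D.lift k σ v) := by
  ext w
  rw [wedgeOne_apply]
  refine (wedgeOne_apply (E := ℂ × ℂ) (η (D.cover v)) (σ (D.cover v)) _).trans ?_
  refine Finset.sum_congr rfl fun i _ ↦ ?_
  have hvec : ![D.coverDeriv v (w i)] = ⇑(D.coverDeriv v) ∘ ![w i] := by
    ext j <;> simp
  exact congrArg (fun u ↦ (-1) ^ (i : ℕ) * ((η (D.cover v) : (ℂ × ℂ) [⋀^Fin 1]→L[ℝ] ℝ) u *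
    D.lift k σ v (i.removeNth w))) hvec

theorem proj_cover (v : (ℂ × ℝ) × ℝ) :
    (D.proj (D.cover v) : ℂ) = Complex.exp ((2 * Real.pi * v.2 : ℝ) * Complex.I) := by
  have hproj : D.proj (D.cover v) =
      Circle.exp (2 * Real.pi * Real.logb D.α (D.expCoord v).2.im) := rfl
  rw [hproj, expCoord_im, Real.logb_rpow D.α_pos D.one_lt_α.ne', Circle.coe_exp]

theorem hasFDerivAt_proj_cover (v : (ℂ × ℝ) × ℝ) :
    HasFDerivAt (fun v ↦ (D.proj (D.cover v) : ℂ))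
      ((2 * Real.pi) • (ContinuousLinearMap.snd ℝ (ℂ × ℝ) ℝ).smulRight
        ((D.proj (D.cover v) : ℂ) * Complex.I)) v := by
  simp only [proj_cover]
  have hangle : HasFDerivAt (fun v : (ℂ × ℝ) × ℝ ↦ 2 * Real.pi * v.2)
      ((2 * Real.pi) • ContinuousLinearMap.snd ℝ (ℂ × ℝ) ℝ) v :=
    (ContinuousLinearMap.snd ℝ (ℂ × ℝ) ℝ).hasFDerivAt.const_mul (2 * Real.pi)
  refine ((Complex.ofRealCLM.hasFDerivAt.comp v hangle).mul_const Complex.I).cexp.congr_fderiv ?_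
  ext w <;> simp; ring

theorem mdifferentiableAt_proj (x : D.Surface) :
    MDifferentiableAt model 𝓘(ℝ, ℂ) (fun y : D.Surface ↦ (D.proj y : ℂ)) x := by
  have hchart : MDifferentiableAt model 𝓘(ℝ, ℂ × ℂ) (extChartAt model x) x :=
    mdifferentiableAt_extChartAt (mem_chart_source _ x)
  have hlog := (D.contDiffAt_logCoord
    (D.chart_symm_eq (mem_extChartAt_target x)).1).differentiableAt (by simp)
  have hproj := (D.hasFDerivAt_proj_cover (D.logCoord (extChartAt model x x))).differentiableAt.comp
    (extChartAt model x x) hlog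
  refine (hproj.mdifferentiableAt.comp x hchart).congr_of_eventuallyEq ?_
  filter_upwards [extChartAt_source_mem_nhds (I := model) x] with y hy
  simp only [Function.comp_apply]
  rw [← (D.chart_symm_eq ((extChartAt model x).map_source hy)).2, (extChartAt model x).left_inv hy]

theorem lift_vartheta (v : (ℂ × ℝ) × ℝ) : D.lift 1 D.vartheta v =
    ContinuousAlternatingMap.ofSubsingleton ℝ ((ℂ × ℝ) × ℝ) ℝ (0 : Fin 1)
      (ContinuousLinearMap.snd ℝ (ℂ × ℝ) ℝ) := by
  let projDeriv : ℂ × ℂ →L[ℝ] ℂ :=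
    mfderiv model 𝓘(ℝ, ℂ) (fun y : D.Surface ↦ (D.proj y : ℂ)) (D.cover v)
  have hchain : HasFDerivAt (fun v ↦ (D.proj (D.cover v) : ℂ))
      (projDeriv.comp (D.coverDeriv v)) v :=
    hasMFDerivAt_iff_hasFDerivAt.1 (HasMFDerivAt.comp (f := D.cover) v
      (D.mdifferentiableAt_proj _).hasMFDerivAt (D.mdifferentiableAt_cover v).hasMFDerivAt)
  have hderiv := hchain.unique (D.hasFDerivAt_proj_cover v)
  have hcircle : conj (D.proj (D.cover v) : ℂ) * (D.proj (D.cover v) : ℂ) = 1 := by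
    rw [← Complex.normSq_eq_conj_mul_self, Circle.normSq_coe, Complex.ofReal_one]
  ext w
  refine (congrArg (fun z : ℂ ↦ (2 * Real.pi)⁻¹ * (conj (D.proj (D.cover v) : ℂ) * z).im)
    (congrArg (fun T ↦ T (w 0)) hderiv)).trans ?_
  change (2 * Real.pi)⁻¹ * (conj (D.proj (D.cover v) : ℂ) *
    ((2 * Real.pi) • ((w 0).2 • ((D.proj (D.cover v) : ℂ) * Complex.I)))).im = (w 0).2
  rw [mul_smul_comm, mul_smul_comm, ← mul_assoc, hcircle, one_mul, Complex.smul_im,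
    Complex.smul_im, Complex.I_im, smul_eq_mul, smul_eq_mul, mul_one,
    inv_mul_cancel_left₀ Real.two_pi_pos.ne']

end InoueData

namespace MorseNovikov

variable {E : Type*} [NormedAddCommGroup E] [NormedSpace ℝ E] {k : ℕ}

theorem extDeriv_exp_neg_smul {F : E → ℝ} {τ : E → E [⋀^Fin k]→L[ℝ] ℝ} {v : E}
    (hF : DifferentiableAt ℝ F v) (hτ : DifferentiableAt ℝ τ v) :
    extDeriv (fun v ↦ Real.exp (-F v) • τ v) v =
      Real.exp (-F v) • (extDeriv τ v -
        wedgeOne (ContinuousAlternatingMap.ofSubsingleton ℝ E ℝ (0 : Fin 1) (fderiv ℝ F v))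
          (τ v)) := by
  have hderiv : HasFDerivAt (fun v ↦ Real.exp (-F v) • τ v)
      (Real.exp (-F v) • (fderiv ℝ τ v + (-1 : ℝ) • (fderiv ℝ F v).smulRight (τ v))) v := by
    refine (hF.hasFDerivAt.neg.exp.smul hτ.hasFDerivAt).congr_fderiv ?_
    ext w u
    simp
    ring
  rw [extDeriv, hderiv.fderiv, ContinuousAlternatingMap.alternatizeUncurryFin_smul,
    ContinuousAlternatingMap.alternatizeUncurryFin_add,
    ContinuousAlternatingMap.alternatizeUncurryFin_smul, neg_one_smul, ← sub_eq_add_neg]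
  rfl

theorem extDeriv_zeroForm (f : E → E [⋀^Fin 0]→L[ℝ] ℝ) (v : E) :
    extDeriv f v = ContinuousAlternatingMap.ofSubsingleton ℝ E ℝ (0 : Fin 1)
      (fderiv ℝ (fun v ↦ f v ![]) v) := by
  rw [← extDeriv_constOfIsEmpty]
  congr 1
  funext w
  ext u
  rw [Subsingleton.elim u ![]]
  rfl

end MorseNovikov

namespace InoueData

open MappingTorus MorseNovikov

/-- `F` is a primitive of the pullback of `η` to the universal covering; it is invariant under
the lattice and grows by `t` under the deck transformation `(p, s) ↦ (D.fiberMap p, s + 1)`. -/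
structure IsPotential (D : InoueData) (η : FormField model D.Surface 1) (F : (ℂ × ℝ) × ℝ → ℝ)
    (t : ℝ) : Prop where
  contDiff : ContDiff ℝ ∞ F
  add_lattice : ∀ m ∈ D.lattice, ∀ v, F (v + (m, 0)) = F v
  shift_eq : ∀ v, F (D.fiberMap.prodCongr (.refl ℝ ℝ) v + (0, 1)) = F v + t
  lift_eq : ∀ v, D.lift 1 η v =
    ContinuousAlternatingMap.ofSubsingleton ℝ ((ℂ × ℝ) × ℝ) ℝ (0 : Fin 1) (fderiv ℝ F v)

variable (D : InoueData)

theorem isPotential_smul_vartheta_add_d (t : ℝ) {f : FormField model D.Surface 0}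
    (hf : f ∈ smoothForms model D.Surface 0) :
    D.IsPotential (t • D.vartheta + f.d) (fun v ↦ t * v.2 + D.lift 0 f v ![]) t where
  contDiff := (contDiff_const.mul contDiff_snd).add
    ((ContinuousAlternatingMap.apply ℝ ((ℂ × ℝ) × ℝ) ℝ ![]).contDiff.comp (D.contDiff_lift hf))
  add_lattice m hm v := by
    rw [D.lift_add_lattice f hm, Prod.snd_add, add_zero]
  shift_eq v := by
    have hlift : D.lift 0 f (D.fiberMap.prodCongr (.refl ℝ ℝ) v + (0, 1)) ![] =
        D.lift 0 f v ![] := by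
      conv_rhs => rw [← D.shiftPullback_lift f]
      exact congrArg (D.lift 0 f _) (Subsingleton.elim _ _)
    rw [hlift, Prod.snd_add, mul_add, mul_one, add_right_comm]
    rfl
  lift_eq v := by
    have hf' : DifferentiableAt ℝ (fun v ↦ D.lift 0 f v ![]) v :=
      ((ContinuousAlternatingMap.apply ℝ ((ℂ × ℝ) × ℝ) ℝ ![]).contDiff.comp
        (D.contDiff_lift hf)).differentiable (by simp) v
    have hsnd : HasFDerivAt (fun v : (ℂ × ℝ) × ℝ ↦ t * v.2)
        (t • ContinuousLinearMap.snd ℝ (ℂ × ℝ) ℝ) v :=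
      (ContinuousLinearMap.snd ℝ (ℂ × ℝ) ℝ).hasFDerivAt.const_mul t
    rw [(hsnd.fun_add hf'.hasFDerivAt).fderiv, map_add, map_smul, D.lift_d hf, Pi.add_apply,
      Pi.smul_apply, lift_vartheta, extDeriv_zeroForm]
    rfl

theorem isPotential_smul_vartheta (t : ℝ) :
    D.IsPotential (t • D.vartheta) (fun v ↦ t * v.2) t := by
  have hd : (0 : FormField model D.Surface 0).d = 0 := by
    simpa using FormField.d_smul (0 : ℝ) (0 : FormField model D.Surface 0)
  simpa [hd] using D.isPotential_smul_vartheta_add_d t (zero_mem (smoothForms model D.Surface 0))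

variable {D} {η : FormField model D.Surface 1} {F : (ℂ × ℝ) × ℝ → ℝ} {t : ℝ} {k : ℕ}

theorem IsPotential.unique {F' : (ℂ × ℝ) × ℝ → ℝ} {t' : ℝ} (h : D.IsPotential η F t)
    (h' : D.IsPotential η F' t') : t = t' := by
  have hd (v : (ℂ × ℝ) × ℝ) : fderiv ℝ (F - F') v = 0 := by
    rw [fderiv_sub (h.contDiff.differentiable (by simp) v)
      (h'.contDiff.differentiable (by simp) v), sub_eq_zero]
    exact (ContinuousAlternatingMap.ofSubsingleton ℝ ((ℂ × ℝ) × ℝ) ℝ (0 : Fin 1)).injective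
      ((h.lift_eq v).symm.trans (h'.lift_eq v))
  have hconst := is_const_of_fderiv_eq_zero ((h.contDiff.differentiable (by simp)).sub
    (h'.contDiff.differentiable (by simp))) hd (D.fiberMap.prodCongr (.refl ℝ ℝ) 0 + (0, 1)) 0
  rw [Pi.sub_apply, Pi.sub_apply, h.shift_eq, h'.shift_eq] at hconst
  linarith

variable (D) in
/-- The pullback of forms to the universal covering, multiplied by `exp (-F)`; for a primitive
`F` of the pullback of `η` this turns the differential `d - η ∧ ·` into `d`. -/
def expLift (F : (ℂ × ℝ) × ℝ → ℝ) (k : ℕ) : FormField model D.Surface k →ₗ[ℝ]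
    ((ℂ × ℝ) × ℝ → ((ℂ × ℝ) × ℝ) [⋀^Fin k]→L[ℝ] ℝ) where
  toFun σ v := Real.exp (-F v) • D.lift k σ v
  map_add' σ τ := by
    funext v
    rw [map_add, Pi.add_apply, smul_add]
    rfl
  map_smul' c σ := by
    funext v
    rw [map_smul, Pi.smul_apply, smul_comm]
    rfl

theorem expLift_apply (σ : FormField model D.Surface k) (v : (ℂ × ℝ) × ℝ) :
    D.expLift F k σ v = Real.exp (-F v) • D.lift k σ v := rfl

theorem expLift_injective (k : ℕ) : Function.Injective (D.expLift F k) := by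
  refine fun σ τ h ↦ D.lift_injective k (funext fun v ↦ ?_)
  exact smul_right_injective _ (Real.exp_ne_zero (-F v)) (congrFun h v)

theorem IsPotential.expLift_mem (h : D.IsPotential η F t) {σ : FormField model D.Surface k}
    (hσ : σ ∈ smoothForms model D.Surface k) :
    D.expLift F k σ ∈ twistedForms D.lattice D.fiberMap (Real.exp (-t)) k := by
  refine mem_twistedForms.2 ⟨⟨h.contDiff.neg.exp.smul (D.contDiff_lift hσ), fun m hm v ↦ ?_⟩, ?_⟩
  · rw [expLift_apply, expLift_apply, h.add_lattice m hm, D.lift_add_lattice σ hm]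
  · funext v
    rw [Pi.smul_apply, expLift_apply, smul_smul, ← Real.exp_add, ← neg_add_rev, ← h.shift_eq]
    exact congrArg (Real.exp _ • ·) (congrFun (D.shiftPullback_lift σ) v)

theorem IsPotential.exists_expLift_eq (h : D.IsPotential η F t)
    {τ : (ℂ × ℝ) × ℝ → ((ℂ × ℝ) × ℝ) [⋀^Fin k]→L[ℝ] ℝ}
    (hτ : τ ∈ twistedForms D.lattice D.fiberMap (Real.exp (-t)) k) :
    ∃ σ ∈ smoothForms model D.Surface k, D.expLift F k σ = τ := by
  obtain ⟨hper, hshift⟩ := mem_twistedForms.1 hτ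
  have hexp : (fun v ↦ Real.exp (F v) • τ v) ∈ twistedForms D.lattice D.fiberMap 1 k := by
    refine mem_twistedForms.2 ⟨⟨h.contDiff.exp.smul hper.1, fun m hm v ↦ ?_⟩, funext fun v ↦ ?_⟩
    · simp only [h.add_lattice m hm, hper.2 m hm]
    · refine (congrArg (Real.exp (F _) • ·) (congrFun hshift v)).trans ?_
      rw [Pi.smul_apply, smul_smul, ← Real.exp_add, one_smul]
      exact congrArg (Real.exp · • τ v) (add_neg_eq_of_eq_add (h.shift_eq v))
  obtain ⟨σ, hσ, hlift⟩ := D.exists_lift_eq hexp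
  refine ⟨σ, hσ, funext fun v ↦ ?_⟩
  rw [expLift_apply, hlift, smul_smul, ← Real.exp_add, neg_add_cancel, Real.exp_zero, one_smul]

theorem IsPotential.expLift_twistedD (h : D.IsPotential η F t)
    (σ : smoothForms model D.Surface k) :
    D.expLift F (k + 1) (twistedD η k σ) = extDeriv (D.expLift F k σ) := by
  funext v
  refine Eq.trans ?_ (extDeriv_exp_neg_smul (h.contDiff.differentiable (by simp) v)
    ((D.contDiff_lift σ.2).differentiable (by simp) v)).symm
  rw [expLift_apply, ← h.lift_eq, ← D.lift_wedge, ← D.lift_d σ.2, ← Pi.sub_apply, ← map_sub]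
  rfl

theorem IsPotential.mem_cocycles_iff (h : D.IsPotential η F t)
    (σ : smoothForms model D.Surface k) :
    σ ∈ cocycles η k ↔ extDeriv (D.expLift F k σ) = 0 := by
  rw [← h.expLift_twistedD, cocycles, LinearMap.mem_ker]
  exact ((D.expLift F (k + 1)).map_eq_zero_iff (expLift_injective _)).symm

/-- `expLift` as an isomorphism from smooth forms on the surface onto twisted forms. -/
def IsPotential.formsEquiv (h : D.IsPotential η F t) (k : ℕ) :
    smoothForms model D.Surface k ≃ₗ[ℝ]
      twistedForms D.lattice D.fiberMap (Real.exp (-t)) k :=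
  LinearEquiv.ofBijective
    (((D.expLift F k).domRestrict _).codRestrict _ fun σ ↦ h.expLift_mem σ.2)
    ⟨fun _ _ hστ ↦ Subtype.ext (expLift_injective k (congrArg Subtype.val hστ)), fun τ ↦
      let ⟨σ, hσ, hlift⟩ := h.exists_expLift_eq τ.2
      ⟨⟨σ, hσ⟩, Subtype.ext hlift⟩⟩

theorem IsPotential.expLift_formsEquiv_symm (h : D.IsPotential η F t)
    (τ : twistedForms D.lattice D.fiberMap (Real.exp (-t)) k) :
    D.expLift F k ((h.formsEquiv k).symm τ) = τ :=
  congrArg Subtype.val ((h.formsEquiv k).apply_symm_apply τ)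

theorem IsPotential.nonempty_equiv_cohomology (h : D.IsPotential η F t) {X : Type*}
    [AddCommGroup X] [Module ℝ X]
    (φ : X →ₗ[ℝ] ((ℂ × ℝ) × ℝ → ((ℂ × ℝ) × ℝ) [⋀^Fin k]→L[ℝ] ℝ))
    (hmem : ∀ x, φ x ∈ twistedForms D.lattice D.fiberMap (Real.exp (-t)) k)
    (hd : ∀ x, extDeriv (φ x) = 0)
    (hinj : ∀ x, ∀ w ∈ coboundaries η k, D.expLift F k w = φ x → x = 0)
    (hsurj : ∀ z ∈ cocycles η k, ∃ x, ∀ w : smoothForms model D.Surface k,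
      D.expLift F k w = φ x → z - w ∈ coboundaries η k) :
    Nonempty (X ≃ₗ[ℝ] Cohomology η k) := by
  have hlift (x : X) : D.expLift F k ((h.formsEquiv k).symm (φ.codRestrict _ hmem x)) = φ x :=
    h.expLift_formsEquiv_symm _
  let ψ : X →ₗ[ℝ] cocycles η k :=
    ((h.formsEquiv k).symm.toLinearMap ∘ₗ φ.codRestrict _ hmem).codRestrict _ fun x ↦
      (h.mem_cocycles_iff _).2 ((congrArg extDeriv (hlift x)).trans (hd x))
  let g : X →ₗ[ℝ] Cohomology η k := ((coboundaries η k).submoduleOf (cocycles η k)).mkQ ∘ₗ ψ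
  refine ⟨.ofBijective g ⟨(injective_iff_map_eq_zero g).2 fun x hx ↦ ?_, fun q ↦ ?_⟩⟩
  · have hψ : ψ x ∈ (coboundaries η k).submoduleOf (cocycles η k) :=
      (Submodule.Quotient.mk_eq_zero _).1 hx
    exact hinj x (ψ x) hψ (hlift x)
  · obtain ⟨z, rfl⟩ := Submodule.Quotient.mk_surjective _ q
    obtain ⟨x, hx⟩ := hsurj z z.2
    have hsub : z - ψ x ∈ (coboundaries η k).submoduleOf (cocycles η k) := hx _ (hlift x)
    exact ⟨x, ((Submodule.Quotient.eq _).2 hsub).symm⟩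

theorem IsPotential.nonempty_cohomology_zero_equiv (h : D.IsPotential η F t) :
    Nonempty (eigenforms D.fiberMap (Real.exp (-t)) 0 ≃ₗ[ℝ] Cohomology η 0) := by
  refine h.nonempty_equiv_cohomology ((MappingTorus.cylinder 0).domRestrict _)
    (fun e ↦ cylinder_mem_twistedForms e.2) (fun e ↦ extDeriv_cylinder e.1)
    (fun e w hw he ↦ Subtype.ext (eq_zero_of_cylinder_mem_exactPeriodicForms D.latticeBasis ?_))
    fun z hz ↦ ?_
  · rw [(Submodule.mem_bot ℝ).1 hw, Submodule.coe_zero, map_zero] at he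
    exact he ▸ zero_mem _
  · obtain ⟨e, he, hze⟩ := exists_eq_cylinder_of_extDeriv_eq_zero
      (fun m hm ↦ (D.fiberMap_mem_lattice m).2 hm) (h.expLift_mem z.2) ((h.mem_cocycles_iff z).1 hz)
    refine ⟨⟨e, he⟩, fun w hw ↦ (Submodule.mem_bot ℝ).2 (sub_eq_zero.2 (Subtype.ext ?_))⟩
    exact expLift_injective 0 (hze.trans hw.symm)

theorem IsPotential.nonempty_cohomology_succ_equiv (h : D.IsPotential η F t) (k : ℕ) :
    Nonempty ((eigenforms D.fiberMap (Real.exp (-t)) (k + 1) ×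
      eigenforms D.fiberMap (Real.exp (-t)) k) ≃ₗ[ℝ] Cohomology η (k + 1)) := by
  have hc := Real.exp_ne_zero (-t)
  have hss := D.disjoint_eigenforms (Real.exp (-t)) k
  refine h.nonempty_equiv_cohomology
    (((MappingTorus.cylinder (k + 1)).domRestrict _).coprod ((dsWedge k).domRestrict _))
    (fun e : eigenforms _ _ _ × eigenforms _ _ _ ↦ add_mem (cylinder_mem_twistedForms e.1.2)
      (dsWedge_mem_twistedForms e.2.2))
    (fun e ↦ ?_) (fun e w hw he ↦ ?_) fun z hz ↦ ?_
  · change extDeriv (MappingTorus.cylinder (k + 1) e.1.1 + dsWedge k e.2.1) = 0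
    rw [extDeriv_add_eq (cylinder_mem_periodicForms D.lattice e.1.1).1
      (dsWedge_mem_twistedForms (L := D.lattice) e.2.2).1.1, extDeriv_cylinder, extDeriv_dsWedge,
      add_zero]
  · obtain ⟨θ, hθ⟩ : ∃ θ, twistedD η k θ = w := hw
    rw [← hθ, h.expLift_twistedD] at he
    obtain ⟨he₁, he₂⟩ := eq_zero_of_cylinder_add_dsWedge_eq_extDeriv hc
      (fun m hm ↦ (D.fiberMap_mem_lattice m).2 hm) hss e.2.2 (h.expLift_mem θ.2) he.symm
    exact Prod.ext (Subtype.ext he₁) (Subtype.ext he₂)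
  · obtain ⟨e, he, e', he', τ, hτ, hze⟩ := exists_eq_cylinder_add_dsWedge_add_extDeriv hc
      D.fiberMap_mem_lattice hss (h.expLift_mem z.2) ((h.mem_cocycles_iff z).1 hz)
    obtain ⟨θ, hθ, rfl⟩ := h.exists_expLift_eq hτ
    refine ⟨(⟨e, he⟩, ⟨e', he'⟩), fun w hw ↦ ⟨⟨θ, hθ⟩, expLift_injective (F := F) (k + 1) ?_⟩⟩
    rw [h.expLift_twistedD]
    change _ = D.expLift F (k + 1) (z.1 - w.1)
    rw [map_sub, hw, hze]
    exact (add_sub_cancel_left _ _).symm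

theorem IsPotential.nonempty_cohomology_equiv (h : D.IsPotential η F t)
    {η' : FormField model D.Surface 1} {F' : (ℂ × ℝ) × ℝ → ℝ} (h' : D.IsPotential η' F' t) (i : ℕ) :
    Nonempty (Cohomology η i ≃ₗ[ℝ] Cohomology η' i) := by
  cases i with
  | zero =>
    obtain ⟨e⟩ := h.nonempty_cohomology_zero_equiv
    obtain ⟨e'⟩ := h'.nonempty_cohomology_zero_equiv
    exact ⟨e.symm.trans e'⟩
  | succ k =>
    obtain ⟨e⟩ := h.nonempty_cohomology_succ_equiv k
    obtain ⟨e'⟩ := h'.nonempty_cohomology_succ_equiv k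
    exact ⟨e.symm.trans e'⟩

theorem IsPotential.subsingleton_cohomology (h : D.IsPotential η F t) {i : ℕ}
    (hi : ∀ k ≤ 3, k = i ∨ k + 1 = i → Real.exp (-t) ≠ D.eigenvalue k) :
    Subsingleton (Cohomology η i) := by
  cases i with
  | zero =>
    obtain ⟨e⟩ := h.nonempty_cohomology_zero_equiv
    have := D.subsingleton_eigenforms fun hk ↦ hi 0 hk (Or.inl rfl)
    exact e.symm.toEquiv.subsingleton
  | succ k =>
    obtain ⟨e⟩ := h.nonempty_cohomology_succ_equiv k
    have := D.subsingleton_eigenforms fun hk ↦ hi (k + 1) hk (Or.inl rfl)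
    have := D.subsingleton_eigenforms fun hk ↦ hi k hk (Or.inr rfl)
    exact e.symm.toEquiv.subsingleton

theorem IsPotential.nonempty_cohomology_equiv_real (h : D.IsPotential η F t) (hk : k ≤ 3)
    (hc : Real.exp (-t) = D.eigenvalue k)
    (hne : ∀ j, j + 1 = k → Real.exp (-t) ≠ D.eigenvalue j) :
    Nonempty (Cohomology η k ≃ₗ[ℝ] ℝ) := by
  obtain ⟨f⟩ := hc ▸ D.nonempty_eigenforms_equiv hk
  cases k with
  | zero =>
    obtain ⟨e⟩ := h.nonempty_cohomology_zero_equiv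
    exact ⟨e.symm.trans f⟩
  | succ k =>
    obtain ⟨e⟩ := h.nonempty_cohomology_succ_equiv k
    have := D.subsingleton_eigenforms fun _ ↦ hne k rfl
    have := Unique.mk' (eigenforms D.fiberMap (Real.exp (-t)) k)
    exact ⟨(e.symm.trans LinearEquiv.prodUnique).trans f⟩

theorem IsPotential.nonempty_cohomology_succ_equiv_real (h : D.IsPotential η F t)
    (hk : k ≤ 3) (hc : Real.exp (-t) = D.eigenvalue k)
    (hne : k + 1 ≤ 3 → Real.exp (-t) ≠ D.eigenvalue (k + 1)) :
    Nonempty (Cohomology η (k + 1) ≃ₗ[ℝ] ℝ) := by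
  obtain ⟨f⟩ := hc ▸ D.nonempty_eigenforms_equiv hk
  obtain ⟨e⟩ := h.nonempty_cohomology_succ_equiv k
  have := D.subsingleton_eigenforms hne
  have := Unique.mk' (eigenforms D.fiberMap (Real.exp (-t)) (k + 1))
  exact ⟨(e.symm.trans LinearEquiv.uniqueProd).trans f⟩

variable (D) in
theorem isClosedOneForm_vartheta : IsClosedOneForm D.vartheta := by
  have hsmooth : D.vartheta ∈ smoothForms model D.Surface 1 :=
    D.mem_smoothForms_of_contDiff_lift (funext D.lift_vartheta ▸ contDiff_const)
  refine ⟨hsmooth, D.lift_injective 2 ?_⟩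
  rw [D.lift_d hsmooth, funext D.lift_vartheta, extDeriv_const, map_zero]

theorem dsWedge_zero_eq_smul_lift_vartheta (e : (ℂ × ℝ) [⋀^Fin 0]→L[ℝ] ℝ) :
    dsWedge 0 e = e ![] • D.lift 1 D.vartheta := by
  funext v
  have hslant : (fun v : (ℂ × ℝ) × ℝ ↦ slant 0 e v ![]) = fun v ↦ v.2 * e ![] :=
    funext fun v ↦ congrArg (v.2 * e ·) (Subsingleton.elim _ _)
  have hderiv : HasFDerivAt (fun v : (ℂ × ℝ) × ℝ ↦ v.2 * e ![])
      (e ![] • ContinuousLinearMap.snd ℝ (ℂ × ℝ) ℝ) v :=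
    (ContinuousLinearMap.snd ℝ (ℂ × ℝ) ℝ).hasFDerivAt.mul_const (e ![])
  rw [dsWedge_apply, extDeriv_zeroForm, Pi.smul_apply, lift_vartheta, hslant, hderiv.fderiv]
  rfl

theorem exists_eq_smul_vartheta_add_d (hη : IsClosedOneForm η) :
    ∃ t : ℝ, ∃ f ∈ smoothForms model D.Surface 0, η = t • D.vartheta + f.d := by
  have hd : extDeriv (D.lift 1 η) = 0 := by rw [← D.lift_d hη.1, hη.2, map_zero]
  obtain ⟨e, he, e', -, τ, hτ, hlift⟩ := exists_eq_cylinder_add_dsWedge_add_extDeriv one_ne_zero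
    D.fiberMap_mem_lattice (D.disjoint_eigenforms 1 0) (D.lift_mem_twistedForms hη.1) hd
  obtain ⟨f, hf, rfl⟩ := D.exists_lift_eq hτ
  have := D.subsingleton_eigenforms (c := 1) (k := 1) fun _ ↦ D.one_lt_α.ne
  have he0 : e = 0 := congrArg Subtype.val (Subsingleton.elim (⟨e, he⟩ : eigenforms _ _ _) 0)
  refine ⟨e' ![], f, hf, D.lift_injective 1 ?_⟩
  rw [hlift, he0, map_zero, dsWedge_zero_eq_smul_lift_vartheta, map_add, map_smul, D.lift_d hf]
  exact congrArg (· + _) (zero_add _)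

end InoueData

namespace InoueData

open MorseNovikov

variable {D : InoueData} {η : FormField model D.Surface 1} {F : (ℂ × ℝ) × ℝ → ℝ} {t : ℝ} {i : ℕ}

theorem IsPotential.subsingleton_cohomology_of_ne (h : D.IsPotential η F t) (hzero : t ≠ 0)
    (hlog : t ≠ Real.log D.α) (hneglog : t ≠ -Real.log D.α) (i : ℕ) :
    Subsingleton (Cohomology η i) := by
  refine h.subsingleton_cohomology fun k hk _ hexp ↦ ?_
  have ht : t = -Real.log (D.eigenvalue k) := by rw [← hexp, Real.log_exp, neg_neg]
  interval_cases k
  · exact hzero (ht.trans (neg_eq_zero.2 Real.log_one))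
  · exact hneglog ht
  · exact hlog (by rw [ht, eigenvalue, Real.log_inv, neg_neg])
  · exact hzero (ht.trans (neg_eq_zero.2 Real.log_one))

section NegLog

variable (h : D.IsPotential η F (-Real.log D.α))
include h

theorem IsPotential.nonempty_cohomology_equiv_real_of_neg_log (hi : i = 1 ∨ i = 2) :
    Nonempty (Cohomology η i ≃ₗ[ℝ] ℝ) := by
  have hα := D.one_lt_α
  have hexp : Real.exp (-(-Real.log D.α)) = D.eigenvalue 1 := by
    rw [neg_neg, Real.exp_log D.α_pos, eigenvalue]
  rcases hi with rfl | rfl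
  · refine h.nonempty_cohomology_equiv_real (by simp) hexp fun j hj ↦ ?_
    obtain rfl : j = 0 := by lia
    exact hexp ▸ hα.ne'
  · exact h.nonempty_cohomology_succ_equiv_real (by simp) hexp fun _ ↦
      hexp ▸ ((inv_lt_one_of_one_lt₀ hα).trans hα).ne'

theorem IsPotential.subsingleton_cohomology_of_neg_log (hi₁ : i ≠ 1) (hi₂ : i ≠ 2) :
    Subsingleton (Cohomology η i) := by
  have hα := D.one_lt_α
  refine h.subsingleton_cohomology fun k hk hki ↦ ?_
  rw [neg_neg, Real.exp_log D.α_pos]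
  interval_cases k
  · exact hα.ne'
  · lia
  · exact ((inv_lt_one_of_one_lt₀ hα).trans hα).ne'
  · exact hα.ne'

end NegLog

section Log

variable (h : D.IsPotential η F (Real.log D.α))
include h

theorem IsPotential.nonempty_cohomology_equiv_real_of_log (hi : i = 2 ∨ i = 3) :
    Nonempty (Cohomology η i ≃ₗ[ℝ] ℝ) := by
  have hα := D.one_lt_α
  have hα' := inv_lt_one_of_one_lt₀ hα
  have hexp : Real.exp (-Real.log D.α) = D.eigenvalue 2 := by
    rw [Real.exp_neg, Real.exp_log D.α_pos, eigenvalue]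
  rcases hi with rfl | rfl
  · refine h.nonempty_cohomology_equiv_real (by simp) hexp fun j hj ↦ ?_
    obtain rfl : j = 1 := by lia
    exact hexp ▸ (hα'.trans hα).ne
  · exact h.nonempty_cohomology_succ_equiv_real (by simp) hexp fun _ ↦ hexp ▸ hα'.ne

theorem IsPotential.subsingleton_cohomology_of_log (hi₂ : i ≠ 2) (hi₃ : i ≠ 3) :
    Subsingleton (Cohomology η i) := by
  have hα := D.one_lt_α
  have hα' := inv_lt_one_of_one_lt₀ hα
  refine h.subsingleton_cohomology fun k hk hki ↦ ?_
  rw [Real.exp_neg, Real.exp_log D.α_pos]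
  interval_cases k
  · exact hα'.ne
  · exact (hα'.trans hα).ne
  · lia
  · exact hα'.ne

end Log

section Zero

variable (h : D.IsPotential η F 0)
include h

theorem IsPotential.nonempty_cohomology_equiv_real_of_zero (hi : i ∈ ({0, 1, 3, 4} : Set ℕ)) :
    Nonempty (Cohomology η i ≃ₗ[ℝ] ℝ) := by
  have hα := D.one_lt_α
  have hexp : Real.exp (-0) = 1 := by rw [neg_zero, Real.exp_zero]
  simp only [mem_insert_iff, mem_singleton_iff] at hi
  rcases hi with rfl | rfl | rfl | rfl
  · exact h.nonempty_cohomology_equiv_real (by simp) hexp (by simp)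
  · exact h.nonempty_cohomology_succ_equiv_real (by simp) hexp fun _ ↦ hexp ▸ hα.ne
  · refine h.nonempty_cohomology_equiv_real le_rfl hexp fun j hj ↦ ?_
    obtain rfl : j = 2 := by lia
    exact hexp ▸ (inv_lt_one_of_one_lt₀ hα).ne'
  · exact h.nonempty_cohomology_succ_equiv_real le_rfl hexp (by simp)

theorem IsPotential.subsingleton_cohomology_of_zero (hi : i ∉ ({0, 1, 3, 4} : Set ℕ)) :
    Subsingleton (Cohomology η i) := by
  have hα := D.one_lt_α
  simp only [mem_insert_iff, mem_singleton_iff, not_or] at hi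
  refine h.subsingleton_cohomology fun k hk hki ↦ ?_
  rw [neg_zero, Real.exp_zero]
  interval_cases k
  · lia
  · exact hα.ne
  · exact (inv_lt_one_of_one_lt₀ hα).ne'
  · lia

end Zero

theorem existsUnique_eq_smul_vartheta_add_d (hη : IsClosedOneForm η) :
    ∃! t : ℝ, ∃ f ∈ smoothForms model D.Surface 0, η = t • D.vartheta + f.d := by
  obtain ⟨t, f, hf, h⟩ := exists_eq_smul_vartheta_add_d hη
  refine ⟨t, ⟨f, hf, h⟩, ?_⟩
  rintro t' ⟨f', hf', h'⟩
  exact (h' ▸ D.isPotential_smul_vartheta_add_d t' hf').unique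
    (h ▸ D.isPotential_smul_vartheta_add_d t hf)

end InoueData

end

open MorseNovikov in
theorem mainTheorem2 (D : InoueData) :
    IsClosedOneForm D.vartheta ∧
    -- `t ≠ 0, ± ln α`: all cohomology groups vanish
    (∀ t : ℝ, t ≠ 0 → t ≠ Real.log D.α → t ≠ -Real.log D.α →
      ∀ i : ℕ, Subsingleton (Cohomology (t • D.vartheta) i)) ∧
    -- `t = - ln α`
    (Nonempty (Cohomology (-Real.log D.α • D.vartheta) 1 ≃ₗ[ℝ] ℝ) ∧
      Nonempty (Cohomology (-Real.log D.α • D.vartheta) 2 ≃ₗ[ℝ] ℝ) ∧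
      ∀ i : ℕ, i ≠ 1 → i ≠ 2 → Subsingleton (Cohomology (-Real.log D.α • D.vartheta) i)) ∧
    -- `t = ln α`
    (Nonempty (Cohomology (Real.log D.α • D.vartheta) 2 ≃ₗ[ℝ] ℝ) ∧
      Nonempty (Cohomology (Real.log D.α • D.vartheta) 3 ≃ₗ[ℝ] ℝ) ∧
      ∀ i : ℕ, i ≠ 2 → i ≠ 3 → Subsingleton (Cohomology (Real.log D.α • D.vartheta) i)) ∧
    -- `t = 0`: de Rham cohomology
    ((∀ i ∈ ({0, 1, 3, 4} : Set ℕ),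
        Nonempty (Cohomology (0 : FormField InoueData.model D.Surface 1) i ≃ₗ[ℝ] ℝ)) ∧
      ∀ i ∉ ({0, 1, 3, 4} : Set ℕ),
        Subsingleton (Cohomology (0 : FormField InoueData.model D.Surface 1) i)) ∧
    -- every closed one-form is `t ϑ + df` for a unique `t`, and its cohomology is that of `t ϑ`
    ∀ η : FormField InoueData.model D.Surface 1, IsClosedOneForm η →
      (∃! t : ℝ, ∃ f ∈ smoothForms InoueData.model D.Surface 0, η = t • D.vartheta + f.d) ∧
      ∀ t : ℝ, ∀ f ∈ smoothForms InoueData.model D.Surface 0, η = t • D.vartheta + f.d →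
        ∀ i : ℕ, Nonempty (Cohomology η i ≃ₗ[ℝ] Cohomology (t • D.vartheta) i) := by
  have hlift (t : ℝ) := D.isPotential_smul_vartheta t
  have hzero : D.IsPotential 0 (fun v ↦ 0 * v.2) 0 := by simpa only [zero_smul] using hlift 0
  refine ⟨D.isClosedOneForm_vartheta, fun t ↦ (hlift t).subsingleton_cohomology_of_ne,
    ⟨(hlift _).nonempty_cohomology_equiv_real_of_neg_log (.inl rfl),
      (hlift _).nonempty_cohomology_equiv_real_of_neg_log (.inr rfl),
      fun _ ↦ (hlift _).subsingleton_cohomology_of_neg_log⟩,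
    ⟨(hlift _).nonempty_cohomology_equiv_real_of_log (.inl rfl),
      (hlift _).nonempty_cohomology_equiv_real_of_log (.inr rfl),
      fun _ ↦ (hlift _).subsingleton_cohomology_of_log⟩,
    ⟨fun _ ↦ hzero.nonempty_cohomology_equiv_real_of_zero,
      fun _ ↦ hzero.subsingleton_cohomology_of_zero⟩,
    fun η hη ↦ ⟨InoueData.existsUnique_eq_smul_vartheta_add_d hη, ?_⟩⟩
  rintro t f hf rfl i
  exact (D.isPotential_smul_vartheta_add_d t hf).nonempty_cohomology_equiv (hlift t) i
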